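/- Let $(M,\nabla,\langle\;,\;\rangle)$ be an affine-Riemann manifold: a smooth finite-dimensional manifold without boundary with a smooth flat torsion-free connection $\nabla$ and a smooth Riemannian metric. Let $D$ be the Levi-Civita connection of $\langle\;,\;\rangle$, let $\gamma_XY=D_XY-\nabla_XY$, let $\gamma^*$ be given by $\langle\gamma^*_XY,Z\rangle=\langle Y,\gamma_XZ\rangle$, let $\mathrm{tr}(\gamma)=\sum_i\gamma_{E_i}E_i$ and $\mathrm{tr}(\gamma^*)=\sum_i\gamma^*_{E_i}E_i$ for an orthonormal frame $(E_i)$, and let $\xi(X)=\langle\mathrm{tr}(\gamma),X\rangle$. Let $X^h,X^v$ be the horizontal (with respect to $\nabla$) and vertical lifts to $TM$ of a vector field $X$ on $M$, and $\pi:TM\to M$ the projection. On $TM$ put $$J_1X^h=X^v,\quad J_1X^v=-X^h,\qquad g_1(X^h,Y^h)=g_1(X^v,Y^v)=\langle X,Y\rangle\circ\pi,\quad g_1(X^h,Y^v)=0,$$ $$\nabla^1_{X^h}Y^h=(\nabla_XY)^h,\quad \nabla^1_{X^h}Y^v=(\nabla_XY)^v,\quad \nabla^1_{X^v}Y^h=\nabla^1_{X^v}Y^v=0.$$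 Put $T^0M=M$, $\nabla^0=\nabla$, $g_0=\langle\;,\;\rangle$, $T^kM=T(T^{k-1}M)$ for $k\ge1$, and let $(J_k,g_k,\nabla^k)$ be obtained on $T^kM$ by applying this construction to $(T^{k-1}M,\nabla^{k-1},g_{k-1})$. For a Hermitian manifold $(N,J,g)$ put $\omega=g(J\cdot,\cdot)$; let $d^*$ be the codifferential of $g$ and let $\theta=-d^*\omega\circ J$ be the Lee form. The manifold is Kähler if $d\omega=0$, balanced if $\theta=0$, and locally conformally balanced if $d\theta=0$. With $\nabla^{LC}$ the Levi-Civita connection of $g$, the Bismut and Chern connections are $$g(\nabla^B_XY,Z)=g(\nabla^{LC}_XY,Z)+\tfrac12d\omega(JX,JY,JZ),\qquad g(\nabla^C_XY,Z)=g(\nabla^{LC}_XY,Z)-\tfrac12d\omega(JX,Y,Z).$$ For $\tau\in\{B,C\}$ let $R^\tau(X,Y)=\nabla^\tau_{[X,Y]}-\nabla^\tau_X\nabla^\tau_Y+\nabla^\tau_Y\nabla^\tau_X$, and let $\rho^\tau(X,Y)=\frac12\sum_ig(R^\tau(X,Y)E_i,JE_i)$ be the Ricci form, where $(E_i)$ is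 a $g$-orthonormal frame. The manifold is Calabi–Yau with torsion if $\rho^B=0$. Then every $(T^kM,\nabla^k,g_k)$, $k\ge0$, is an affine-Riemann manifold, every $(T^kM,J_k,g_k)$, $k\ge1$, is a Hermitian manifold, and: 1. If $\gamma=0$, then for every $k\ge1$ the connection $\nabla^k$ is the Levi-Civita connection of $g_k$, and $(T^kM,J_k,g_k)$ is Kähler and flat. 2. For every $k\ge2$, $(T^kM,J_k,g_k)$ is Kähler if and only if $\gamma=0$. 3. For every $k\ge1$, $(T^kM,J_k,g_k)$ is locally conformally balanced if and only if $(TM,J_1,g_1)$ is locally conformally balanced, and this holds if and only if $d\xi=0$. 4. For every $k_0\ge1$, $(T^{k_0}M,J_{k_0},g_{k_0})$ is balanced if and only if $\mathrm{tr}(\gamma)=(2^{k_0}-1)\,\mathrm{tr}(\gamma^*)$. In this case $(T^{k_0+1}M,J_{k_0+1},g_{k_0+1})$ is Calabi–Yau with torsion, and $(T^kM,J_k,g_k)$ is locally conformally balanced for every $k\ge1$ with $k\ne k_0$. 5. If $\mathrm{tr}(\gamma)=\mathrm{tr}(\gamma^*)=0$, then for every $k\ge1$ the manifold $(T^kM,J_k,g_k)$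 is balanced and Calabi–Yau with torsion, and its Chern Ricci form vanishes. -/

import Mathlib

open Bundle Manifold ContDiff Set

universe u v

noncomputable section

/-! ### Riemannian and Hermitian geometry on a manifold

`M` is a smooth manifold modelled on `(E, H)`. A field of bilinear forms is a family
`g x : T_xM →L T_xM →L ℝ`, an almost complex structure is a family `J x : T_xM →L T_xM`, and a
connection takes a vector field `Y`, a point `x` and a vector `w ∈ T_xM` to `∇_w Y ∈ T_xM`.
The value of a tensor at `x` on given tangent vectors is computed on the vector fields
`FiberBundle.extend E w`, which extend a tangent vector `w` at `x` and are smooth near `x`. -/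

namespace AffRiem

section Geometry

variable {E : Type*} [NormedAddCommGroup E] [NormedSpace ℝ E] [FiniteDimensional ℝ E]
  {H : Type*} [TopologicalSpace H] {I : ModelWithCorners ℝ E H}
  {M : Type*} [TopologicalSpace M] [ChartedSpace H M] [IsManifold I ∞ M]

/-- `g` is a smooth Riemannian metric. -/
def IsRiemannianMetric
    (g : Π x : M, TangentSpace I x →L[ℝ] TangentSpace I x →L[ℝ] ℝ) : Prop :=
  ∃ G : ContMDiffRiemannianMetric I ∞ E (fun x : M => TangentSpace I x), G.inner = g

/-- The torsion `∇_X Y - ∇_Y X - [X, Y]` vanishes. -/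
def IsTorsionFree
    (nabla : (Π x : M, TangentSpace I x) → Π x : M, TangentSpace I x →L[ℝ] TangentSpace I x) :
    Prop :=
  ∀ (x : M) (X Y : Π y : M, TangentSpace I y),
    MDiffAt (T% X) x → MDiffAt (T% Y) x →
    nabla Y x (X x) - nabla X x (Y x) = VectorField.mlieBracket I X Y x

/-- The curvature `R(u, v) w` at `x`, where
`R(X, Y) = ∇_{[X, Y]} - ∇_X ∇_Y + ∇_Y ∇_X`. -/
def curvature
    (nabla : (Π x : M, TangentSpace I x) → Π x : M, TangentSpace I x → TangentSpace I x)
    (x : M) (u v w : TangentSpace I x) : TangentSpace I x :=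
  let X : Π y : M, TangentSpace I y := FiberBundle.extend E u
  let Y : Π y : M, TangentSpace I y := FiberBundle.extend E v
  let Z : Π y : M, TangentSpace I y := FiberBundle.extend E w
  nabla Z x (VectorField.mlieBracket I X Y x)
    - nabla (fun y => nabla Z y (Y y)) x u + nabla (fun y => nabla Z y (X y)) x v

/-- The curvature vanishes. -/
def IsFlat
    (nabla : (Π x : M, TangentSpace I x) → Π x : M, TangentSpace I x → TangentSpace I x) :
    Prop :=
  ∀ (x : M) (u v w : TangentSpace I x), curvature nabla x u v w = 0

/-- `D` is a torsion-free connection with `w⟨Y, Z⟩ = ⟨D_w Y, Z⟩ + ⟨Y, D_w Z⟩`. -/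
structure IsLeviCivita
    (g : Π x : M, TangentSpace I x →L[ℝ] TangentSpace I x →L[ℝ] ℝ)
    (D : (Π x : M, TangentSpace I x) → Π x : M, TangentSpace I x →L[ℝ] TangentSpace I x) :
    Prop where
  isCovariantDerivative : IsCovariantDerivativeOn E D univ
  torsionFree : IsTorsionFree D
  metric : ∀ (x : M) (Y Z : Π y : M, TangentSpace I y),
    MDiffAt (T% Y) x → MDiffAt (T% Z) x → ∀ w : TangentSpace I x,
    mvfderiv I (fun y => g y (Y y) (Z y)) x w = g x (D Y x w) (Z x) + g x (Y x) (D Z x w)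

/-- The Levi-Civita connection of `g`. -/
def leviCivita (g : Π x : M, TangentSpace I x →L[ℝ] TangentSpace I x →L[ℝ] ℝ) :
    (Π x : M, TangentSpace I x) → Π x : M, TangentSpace I x →L[ℝ] TangentSpace I x :=
  Classical.epsilon (IsLeviCivita g)

/-- The vector `s` with `⟨s, z⟩ = φ z` for all `z`. -/
def sharp (g : Π x : M, TangentSpace I x →L[ℝ] TangentSpace I x →L[ℝ] ℝ) (x : M)
    (φ : TangentSpace I x → ℝ) : TangentSpace I x :=
  Classical.epsilon fun s => ∀ z, g x s z = φ z

/-- A `g`-orthonormal basis of `T_xM`. -/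
def frame (g : Π x : M, TangentSpace I x →L[ℝ] TangentSpace I x →L[ℝ] ℝ) (x : M) :
    Fin (Module.finrank ℝ E) → TangentSpace I x :=
  Classical.epsilon fun e => ∀ i j, g x (e i) (e j) = if i = j then 1 else 0

/-- The exterior derivative of a 1-form:
`dη(X, Y) = X η(Y) - Y η(X) - η([X, Y])`. -/
def extDerivOne (η : Π x : M, TangentSpace I x → ℝ) (x : M) (u v : TangentSpace I x) : ℝ :=
  let X : Π y : M, TangentSpace I y := FiberBundle.extend E u
  let Y : Π y : M, TangentSpace I y := FiberBundle.extend E v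
  mvfderiv I (fun y => η y (Y y)) x u - mvfderiv I (fun y => η y (X y)) x v
    - η x (VectorField.mlieBracket I X Y x)

/-- The exterior derivative of a 2-form: `dη(X, Y, Z)` is the cyclic sum of
`X η(Y, Z) - η([X, Y], Z)`. -/
def extDerivTwo (η : Π x : M, TangentSpace I x → TangentSpace I x → ℝ) (x : M)
    (u v w : TangentSpace I x) : ℝ :=
  let X : Π y : M, TangentSpace I y := FiberBundle.extend E u
  let Y : Π y : M, TangentSpace I y := FiberBundle.extend E v
  let Z : Π y : M, TangentSpace I y := FiberBundle.extend E w
  mvfderiv I (fun y => η y (Y y) (Z y)) x u + mvfderiv I (fun y => η y (Z y) (X y)) x v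
    + mvfderiv I (fun y => η y (X y) (Y y)) x w
    - η x (VectorField.mlieBracket I X Y x) w - η x (VectorField.mlieBracket I Y Z x) u
    - η x (VectorField.mlieBracket I Z X x) v

/-- The codifferential of a 2-form: `d^*η(v) = - ∑ i, (D_{E_i} η)(E_i, v)`, where
`(D_u η)(V, W) = u η(V, W) - η(D_u V, W) - η(V, D_u W)`. -/
def codiffTwo (g : Π x : M, TangentSpace I x →L[ℝ] TangentSpace I x →L[ℝ] ℝ)
    (η : Π x : M, TangentSpace I x → TangentSpace I x → ℝ) (x : M) (v : TangentSpace I x) : ℝ :=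
  let V : Π y : M, TangentSpace I y := FiberBundle.extend E v
  let e : Fin (Module.finrank ℝ E) → Π y : M, TangentSpace I y :=
    fun i => FiberBundle.extend E (frame g x i);
  - ∑ i, (mvfderiv I (fun y => η y (e i y) (V y)) x (e i x)
      - η x (leviCivita g (e i) x (e i x)) v - η x (e i x) (leviCivita g V x (e i x)))

/-- `(M, J, g)` is a Hermitian manifold: `J` is a smooth almost complex structure with vanishing
Nijenhuis tensor `[JX, JY] - J[JX, Y] - J[X, JY] - [X, Y]`, and `g` is a smooth Riemannian metric
with `g(JX, JY) = g(X, Y)`. -/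
structure IsHermitian (g : Π x : M, TangentSpace I x →L[ℝ] TangentSpace I x →L[ℝ] ℝ)
    (J : Π x : M, TangentSpace I x →L[ℝ] TangentSpace I x) : Prop where
  metric : IsRiemannianMetric g
  smooth : ContMDiff I (I.prod 𝓘(ℝ, E →L[ℝ] E)) ∞
    (fun x => TotalSpace.mk' (E →L[ℝ] E)
      (E := fun x : M => TangentSpace I x →L[ℝ] TangentSpace I x) x (J x))
  sq : ∀ (x : M) (u : TangentSpace I x), J x (J x u) = -u
  integrable : ∀ (x : M) (u v : TangentSpace I x),
    let X : Π y : M, TangentSpace I y := FiberBundle.extend E u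
    let Y : Π y : M, TangentSpace I y := FiberBundle.extend E v
    VectorField.mlieBracket I (fun y => J y (X y)) (fun y => J y (Y y)) x
      - J x (VectorField.mlieBracket I (fun y => J y (X y)) Y x)
      - J x (VectorField.mlieBracket I X (fun y => J y (Y y)) x)
      - VectorField.mlieBracket I X Y x = 0
  compatible : ∀ (x : M) (u v : TangentSpace I x), g x (J x u) (J x v) = g x u v

/-- The fundamental form `ω = g(J·, ·)`. -/
def fundamentalForm (g : Π x : M, TangentSpace I x →L[ℝ] TangentSpace I x →L[ℝ] ℝ)
    (J : Π x : M, TangentSpace I x →L[ℝ] TangentSpace I x) (x : M) (u v : TangentSpace I x) : ℝ :=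
  g x (J x u) v

/-- The Lee form `θ = - d^*ω ∘ J`. -/
def leeForm (g : Π x : M, TangentSpace I x →L[ℝ] TangentSpace I x →L[ℝ] ℝ)
    (J : Π x : M, TangentSpace I x →L[ℝ] TangentSpace I x) (x : M) (v : TangentSpace I x) : ℝ :=
  - codiffTwo g (fundamentalForm g J) x (J x v)

/-- `(M, J, g)` is a Hermitian manifold with `dω = 0`. -/
def IsKahler (g : Π x : M, TangentSpace I x →L[ℝ] TangentSpace I x →L[ℝ] ℝ)
    (J : Π x : M, TangentSpace I x →L[ℝ] TangentSpace I x) : Prop :=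
  IsHermitian g J ∧ ∀ x u v w, extDerivTwo (fundamentalForm g J) x u v w = 0

/-- `(M, J, g)` is a Hermitian manifold with `θ = 0`. -/
def IsBalanced (g : Π x : M, TangentSpace I x →L[ℝ] TangentSpace I x →L[ℝ] ℝ)
    (J : Π x : M, TangentSpace I x →L[ℝ] TangentSpace I x) : Prop :=
  IsHermitian g J ∧ ∀ x v, leeForm g J x v = 0

/-- `(M, J, g)` is a Hermitian manifold with `dθ = 0`. -/
def IsLocallyConformallyBalanced
    (g : Π x : M, TangentSpace I x →L[ℝ] TangentSpace I x →L[ℝ] ℝ)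
    (J : Π x : M, TangentSpace I x →L[ℝ] TangentSpace I x) : Prop :=
  IsHermitian g J ∧ ∀ x u v, extDerivOne (leeForm g J) x u v = 0

/-- The Bismut connection: `g(∇^B_X Y, Z) = g(D_X Y, Z) + 1/2 dω(JX, JY, JZ)`. -/
def bismut (g : Π x : M, TangentSpace I x →L[ℝ] TangentSpace I x →L[ℝ] ℝ)
    (J : Π x : M, TangentSpace I x →L[ℝ] TangentSpace I x)
    (Y : Π x : M, TangentSpace I x) (x : M) (u : TangentSpace I x) : TangentSpace I x :=
  leviCivita g Y x u + (1 / 2 : ℝ) • sharp g x (fun z =>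
    extDerivTwo (fundamentalForm g J) x (J x u) (J x (Y x)) (J x z))

/-- The Chern connection: `g(∇^C_X Y, Z) = g(D_X Y, Z) - 1/2 dω(JX, Y, Z)`. -/
def chern (g : Π x : M, TangentSpace I x →L[ℝ] TangentSpace I x →L[ℝ] ℝ)
    (J : Π x : M, TangentSpace I x →L[ℝ] TangentSpace I x)
    (Y : Π x : M, TangentSpace I x) (x : M) (u : TangentSpace I x) : TangentSpace I x :=
  leviCivita g Y x u - (1 / 2 : ℝ) • sharp g x (fun z =>
    extDerivTwo (fundamentalForm g J) x (J x u) (Y x) z)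

/-- The Ricci form of a connection: `ρ(u, v) = 1/2 ∑ i, g(R(u, v) E_i, J E_i)`. -/
def ricciForm (g : Π x : M, TangentSpace I x →L[ℝ] TangentSpace I x →L[ℝ] ℝ)
    (J : Π x : M, TangentSpace I x →L[ℝ] TangentSpace I x)
    (nabla : (Π x : M, TangentSpace I x) → Π x : M, TangentSpace I x → TangentSpace I x)
    (x : M) (u v : TangentSpace I x) : ℝ :=
  (1 / 2 : ℝ) * ∑ i, g x (curvature nabla x u v (frame g x i)) (J x (frame g x i))

/-- `(M, J, g)` is a Hermitian manifold whose Bismut Ricci form vanishes. -/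
def IsCalabiYauWithTorsion
    (g : Π x : M, TangentSpace I x →L[ℝ] TangentSpace I x →L[ℝ] ℝ)
    (J : Π x : M, TangentSpace I x →L[ℝ] TangentSpace I x) : Prop :=
  IsHermitian g J ∧ ∀ x u v, ricciForm g J (bismut g J) x u v = 0

end Geometry

/-! ### Affine-Riemann manifolds and the tower of tangent bundles -/

/-- A smooth finite-dimensional manifold `M` without boundary, with an operator `nabla` on vector
fields (`nabla Y x w` is `∇_w Y` at `x`) and a field `g` of bilinear forms. -/
structure ConnMetricManifold where
  E : Type u
  [normedAddCommGroup : NormedAddCommGroup E]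
  [normedSpace : NormedSpace ℝ E]
  [finiteDimensional : FiniteDimensional ℝ E]
  H : Type u
  [topologicalSpaceModel : TopologicalSpace H]
  I : ModelWithCorners ℝ E H
  [boundaryless : I.Boundaryless]
  M : Type (max u v)
  [topologicalSpace : TopologicalSpace M]
  [chartedSpace : ChartedSpace H M]
  [isManifold : IsManifold I ∞ M]
  nabla : (Π x : M, TangentSpace I x) → Π x : M, TangentSpace I x →L[ℝ] TangentSpace I x
  g : Π x : M, TangentSpace I x →L[ℝ] TangentSpace I x →L[ℝ] ℝ

namespace ConnMetricManifold

attribute [instance] normedAddCommGroup normedSpace finiteDimensional topologicalSpaceModel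
  boundaryless topologicalSpace chartedSpace isManifold

/-- `nabla` is a smooth flat torsion-free connection and `g` is a smooth Riemannian metric. -/
structure IsAffineRiemann (A : ConnMetricManifold.{u, v}) : Prop where
  isCovariantDerivative : IsCovariantDerivativeOn A.E A.nabla univ
  smooth : ∀ s : Set A.M, IsOpen s → ContMDiffCovariantDerivativeOn A.E ∞ A.nabla s
  torsionFree : IsTorsionFree A.nabla
  flat : IsFlat (fun Y x w => A.nabla Y x w)
  metric : IsRiemannianMetric A.g

section TensorsOnBase

variable (A : ConnMetricManifold.{u, v})

/-- The difference tensor `γ_X Y = D_X Y - ∇_X Y`. -/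
def gamma (x : A.M) (u v : TangentSpace A.I x) : TangentSpace A.I x :=
  leviCivita A.g (FiberBundle.extend A.E v) x u - A.nabla (FiberBundle.extend A.E v) x u

/-- The adjoint `γ^*`: `⟨γ^*_X Y, Z⟩ = ⟨Y, γ_X Z⟩`. -/
def gammaStar (x : A.M) (u v : TangentSpace A.I x) : TangentSpace A.I x :=
  sharp A.g x (fun z => A.g x v (A.gamma x u z))

/-- `tr(γ) = ∑ i, γ_{E_i} E_i`. -/
def trGamma (x : A.M) : TangentSpace A.I x :=
  ∑ i, A.gamma x (frame A.g x i) (frame A.g x i)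

/-- `tr(γ^*) = ∑ i, γ^*_{E_i} E_i`. -/
def trGammaStar (x : A.M) : TangentSpace A.I x :=
  ∑ i, A.gammaStar x (frame A.g x i) (frame A.g x i)

/-- The adjoint Koszul form `ξ(X) = ⟨tr(γ), X⟩`. -/
def xi (x : A.M) (v : TangentSpace A.I x) : ℝ := A.g x (A.trGamma x) v

end TensorsOnBase

section TangentLift

variable (A : ConnMetricManifold.{u, v})

/-- The differential of the projection `π : TM → M`. At `p`, the tangent space of `TM` is `E × E`,
with coordinates `(b, Z)` associated to the coordinates `(x, μ)` of `TM` induced by the preferred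
chart of `M` at `π p`. -/
def dproj (p : TangentBundle A.I A.M) :
    TangentSpace A.I.tangent p →L[ℝ] TangentSpace A.I p.proj :=
  ContinuousLinearMap.fst ℝ A.E A.E

/-- The connection map `Q : TTM → TM` of `∇`, in the coordinates of `dproj`:
`Q(b, Z)^l = Z^l + ∑ b^i μ^j Γ_{ij}^l`. The second summand is the derivative along `b` of the vector
field with constant coordinates `μ`. -/
def connMap (p : TangentBundle A.I A.M) :
    TangentSpace A.I.tangent p →L[ℝ] TangentSpace A.I p.proj :=
  letI snd : TangentSpace A.I.tangent p →L[ℝ] TangentSpace A.I p.proj :=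
    ContinuousLinearMap.snd ℝ A.E A.E
  snd + (A.nabla (FiberBundle.extend A.E p.snd) p.proj).comp (A.dproj p)

/-- The vertical lift `T_{π p}M → T_p(TM)`. -/
def vlift (p : TangentBundle A.I A.M) :
    TangentSpace A.I p.proj →L[ℝ] TangentSpace A.I.tangent p :=
  ContinuousLinearMap.inr ℝ A.E A.E

/-- The horizontal lift `T_{π p}M → ker Q_p`, the inverse of `dproj` on `ker Q_p`. -/
def hlift (p : TangentBundle A.I A.M) :
    TangentSpace A.I p.proj →L[ℝ] TangentSpace A.I.tangent p :=
  letI inl : TangentSpace A.I p.proj →L[ℝ] TangentSpace A.I.tangent p :=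
    ContinuousLinearMap.inl ℝ A.E A.E
  inl - (A.vlift p).comp (A.nabla (FiberBundle.extend A.E p.snd) p.proj)

/-- The complex structure on `TM`: `J X^h = X^v`, `J X^v = - X^h`. -/
def tangentJ (p : TangentBundle A.I A.M) :
    TangentSpace A.I.tangent p →L[ℝ] TangentSpace A.I.tangent p :=
  (A.vlift p).comp (A.dproj p) - (A.hlift p).comp (A.connMap p)

/-- The metric on `TM`: `g(X^h, Y^h) = g(X^v, Y^v) = ⟨X, Y⟩` and `g(X^h, Y^v) = 0`. -/
def tangentMetric (p : TangentBundle A.I A.M) :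
    TangentSpace A.I.tangent p →L[ℝ] TangentSpace A.I.tangent p →L[ℝ] ℝ :=
  ((A.dproj p).precomp ℝ).comp ((A.g p.proj).comp (A.dproj p))
    + ((A.connMap p).precomp ℝ).comp ((A.g p.proj).comp (A.connMap p))

/-- The covariant derivative, at `p ∈ TM`, of a section `s` of `π^*TM`: the connection map applied to
the differential of the map `q ↦ s q` from `TM` to `TM`. -/
def pullbackNabla (s : Π q : TangentBundle A.I A.M, TangentSpace A.I q.proj)
    (p : TangentBundle A.I A.M) : TangentSpace A.I.tangent p →L[ℝ] TangentSpace A.I p.proj :=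
  let f : TangentBundle A.I A.M → TangentBundle A.I A.M := fun q => ⟨q.proj, s q⟩
  (A.connMap (f p)).comp (mfderiv A.I.tangent A.I.tangent f p)

/-- The connection `∇^1` on `TM`: the connection with `∇^1_{X^h} Y^h = (∇_X Y)^h`,
`∇^1_{X^h} Y^v = (∇_X Y)^v` and `∇^1_{X^v} Y^h = ∇^1_{X^v} Y^v = 0`. A vector field `V` on `TM` is the
sum of the horizontal lift of the section `dπ V` and the vertical lift of the section `Q V` of
`π^*TM`, and `∇^1` acts on both by the pullback of `∇`. -/
def tangentNabla (V : Π q : TangentBundle A.I A.M, TangentSpace A.I.tangent q)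
    (p : TangentBundle A.I A.M) :
    TangentSpace A.I.tangent p →L[ℝ] TangentSpace A.I.tangent p :=
  (A.hlift p).comp (A.pullbackNabla (fun q => A.dproj q (V q)) p)
    + (A.vlift p).comp (A.pullbackNabla (fun q => A.connMap q (V q)) p)

/-- `(TM, ∇^1, g_1)`. -/
def tangent : ConnMetricManifold.{u, v} where
  E := A.E × A.E
  H := ModelProd A.H A.E
  I := A.I.tangent
  M := TangentBundle A.I A.M
  nabla := A.tangentNabla
  g := A.tangentMetric

/-- The tower `(T^kM, ∇^k, g_k)`, with `T^0M = M` and `T^{k+1}M = T(T^kM)`. -/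
def tower : ℕ → ConnMetricManifold.{u, v}
  | 0 => A
  | k + 1 => (tower k).tangent

/-- The complex structure `J_k` on `T^kM` for `k ≥ 1`; the value at `k = 0` is a placeholder. -/
def towerJ : (k : ℕ) → Π x : (A.tower k).M,
    TangentSpace (A.tower k).I x →L[ℝ] TangentSpace (A.tower k).I x
  | 0 => fun _ => 0
  | k + 1 => (A.tower k).tangentJ

end TangentLift

end ConnMetricManifold

end AffRiem

end

/-!
Let `∇g` be the covariant derivative of the metric, a tensor with three arguments. Everything in the
theorem is governed by two of its traces, the 1-forms
`a(v) = ∑ i, (∇_{E_i} g)(E_i, v)` and `s(v) = 1/2 ∑ i, (∇_v g)(E_i, E_i)` (`aForm` and `sForm`). Since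
`2⟨γ_u v, w⟩ = (∇_u g)(v, w) + (∇_v g)(u, w) - (∇_w g)(u, v)`, one has `⟨tr γ, ·⟩ = a - s` and
`⟨tr γ^*, ·⟩ = s`, and `γ = 0` if and only if `∇g = 0`. The form `s` is closed, because the
Levi-Civita connection `∇ + γ` has traceless curvature (`extDerivOne_sForm`); hence `dξ = da`.

On `TM`, the connection `∇^1` is the pullback of `∇` on both the horizontal and the vertical bundle,
which are copies of `π^*TM`. It follows that `∇^1` is flat, that `∇^1 J_1 = 0`, and, in coordinates,
that `∇^1` is torsion-free (`isAffRiem_tangent`, `isParallelHermitian_tangentJ`). In particular `J_1` is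
integrable. Moreover `∇^1 g_1` is the sum of the pullbacks of `∇g` to the two components
(`nablaG_tangent`), so that passing from `M` to `TM` replaces `a` by `π^*a` and `s` by `2 π^*s`
(`aForm_tangent`, `sForm_tangent`). On `T^kM` the forms are the pullbacks of `a` and `2^k s`.

For a torsion-free flat connection with an orthogonal parallel complex structure, all quantities of
Hermitian geometry are expressed by `∇g`: `dω(u, v, w)` is the cyclic sum of `(∇_u g)(Jv, w)`, the Lee
form is `-(a - s)` (`IsParallelHermitian.leeForm_eq`), and the Bismut and Chern connections are
`∇ + B` with `B` commuting with `J`. As `∇` is flat, the Ricci form of such a connection is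
`1/2 dβ` with `β(v) = tr (J ∘ B_v)` (`IsParallelHermitian.ricciForm_eq`), which is `(2a - s) ∘ J` for
Bismut and `s ∘ J` for Chern. Thus the Lee form of `T^kM` is the pullback of `-(a - 2^k s)`, and the
form `2a - s` of `T^{k+1}M` is the pullback of `2(a - 2^k s)`; the assertions on balanced, locally
conformally balanced and Calabi–Yau structures can be read off. If `TM` is Kähler, then `∇g` is
cyclic, and if `TTM` is Kähler, then the cyclic symmetry of `∇^1 g_1` forces `∇g = 0`
(`nablaG_cyclic_of_isKahler`, `nablaG_tower_eq_zero_of_isKahler`).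
-/

noncomputable section

open Filter Topology

set_option linter.unusedSectionVars false

namespace AffRiem

/-! ### Tangent vectors and vector fields in charts -/

section ChartCalculus

variable {E : Type*} [NormedAddCommGroup E] [NormedSpace ℝ E]
  {H : Type*} [TopologicalSpace H] {I : ModelWithCorners ℝ E H}
  {M : Type*} [TopologicalSpace M] [ChartedSpace H M] [IsManifold I ∞ M]
  {F : Type*} [NormedAddCommGroup F] [NormedSpace ℝ F]
  {F' : Type*} [NormedAddCommGroup F'] [NormedSpace ℝ F']
  {F'' : Type*} [NormedAddCommGroup F''] [NormedSpace ℝ F'']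

variable (I) in
/-- The coordinates of a tangent vector at `y` in the preferred chart at `x` (zero if `y` lies outside
the domain of that chart). -/
def tcoord (x y : M) : TangentSpace I y →L[ℝ] E :=
  (trivializationAt E (TangentSpace I) x).continuousLinearMapAt ℝ y

variable (I) in
/-- The tangent vector at `y` with given coordinates in the preferred chart at `x`. -/
def tlift (x y : M) : E →L[ℝ] TangentSpace I y :=
  (trivializationAt E (TangentSpace I) x).symmL ℝ y

variable (I) in
/-- The vector field with constant coordinates in the preferred chart at `x`. -/
def cfield (x : M) (e : E) (y : M) : TangentSpace I y := tlift I x y e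

lemma tcoord_tlift {x y : M} (hy : y ∈ (chartAt H x).source) (e : E) :
    tcoord I x y (tlift I x y e) = e :=
  (trivializationAt E (TangentSpace I) x).continuousLinearMapAt_symmL hy e

lemma tlift_tcoord {x y : M} (hy : y ∈ (chartAt H x).source) (v : TangentSpace I y) :
    tlift I x y (tcoord I x y v) = v :=
  (trivializationAt E (TangentSpace I) x).symmL_continuousLinearMapAt hy v

lemma tcoord_eq_mfderiv {x y : M} (hy : y ∈ (chartAt H x).source) (v : TangentSpace I y) :
    tcoord I x y v = mvfderiv I (extChartAt I x) y v := by
  unfold tcoord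
  rw [TangentBundle.continuousLinearMapAt_trivializationAt hy]
  rfl

lemma tcoord_self (x : M) (v : TangentSpace I x) : tcoord I x x v = (v : E) := by
  rw [tcoord, TangentBundle.continuousLinearMapAt_trivializationAt_eq_core (mem_chart_source H x)]
  exact (tangentBundleCore I M).coordChange_self _ _ (mem_chart_source H x) _

lemma tlift_self (x : M) (e : E) : tlift I x x e = (e : E) := by
  rw [tlift, TangentBundle.symmL_trivializationAt_eq_core (mem_chart_source H x)]
  exact (tangentBundleCore I M).coordChange_self _ _ (mem_chart_source H x) _

lemma extend_eq_cfield {x y : M} (hy : y ∈ (chartAt H x).source) (v : TangentSpace I x) :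
    (FiberBundle.extend E v : Π z : M, TangentSpace I z) y = cfield I x (v : E) y := by
  have h : ((trivializationAt E (TangentSpace I) x) ⟨x, v⟩).2 = (v : E) := by
    have := tcoord_self (I := I) x v
    rw [tcoord, Trivialization.continuousLinearMapAt_apply,
      Trivialization.coe_linearMapAt_of_mem _ (mem_chart_source H x)] at this
    exact this
  unfold FiberBundle.extend cfield tlift
  rw [h]
  exact ((trivializationAt E (TangentSpace I) x).symmL_apply hy _).symm

lemma extend_eventuallyEq_cfield {x : M} (v : TangentSpace I x) :
    (FiberBundle.extend E v : Π z : M, TangentSpace I z) =ᶠ[𝓝 x] cfield I x (v : E) := by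
  filter_upwards [chart_source_mem_nhds H x] with y hy using extend_eq_cfield hy v

lemma eventually_mem_chart (x : M) : ∀ᶠ y in 𝓝 x, y ∈ (chartAt H x).source :=
  chart_source_mem_nhds H x

lemma cmdiffAt_iff_tcoord {n : ℕ∞} {x y : M} (hy : y ∈ (chartAt H x).source)
    {Y : Π z : M, TangentSpace I z} :
    CMDiffAt n (T% Y) y ↔ ContMDiffAt I 𝓘(ℝ, E) n (fun z => tcoord I x z (Y z)) y := by
  have : ContMDiffVectorBundle n E (TangentSpace I : M → Type _) I :=
    ContMDiffVectorBundle.of_le (n := ∞) (mod_cast le_top)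
  rw [(trivializationAt E (TangentSpace I) x).contMDiffAt_section_iff (s := Y) (n := n) (IB := I) hy]
  refine ⟨fun h => h.congr_of_eventuallyEq ?_, fun h => h.congr_of_eventuallyEq ?_⟩ <;>
  · filter_upwards [(chartAt H x).open_source.mem_nhds hy] with z hz
    rw [tcoord, Trivialization.continuousLinearMapAt_apply,
      Trivialization.coe_linearMapAt_of_mem _ hz]

lemma mdiffAt_iff_tcoord {x y : M} (hy : y ∈ (chartAt H x).source)
    {Y : Π z : M, TangentSpace I z} :
    MDiffAt (T% Y) y ↔ MDifferentiableAt I 𝓘(ℝ, E) (fun z => tcoord I x z (Y z)) y := by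
  have : ContMDiffVectorBundle 1 E (TangentSpace I : M → Type _) I :=
    ContMDiffVectorBundle.of_le (n := ∞) (mod_cast le_top)
  rw [(trivializationAt E (TangentSpace I) x).mdifferentiableAt_section_iff I Y hy]
  refine ⟨fun h => h.congr_of_eventuallyEq ?_, fun h => h.congr_of_eventuallyEq ?_⟩ <;>
  · filter_upwards [(chartAt H x).open_source.mem_nhds hy] with z hz
    rw [tcoord, Trivialization.continuousLinearMapAt_apply,
      Trivialization.coe_linearMapAt_of_mem _ hz]

lemma cmdiffAt_cfield {n : ℕ∞} {x y : M} (hy : y ∈ (chartAt H x).source) (e : E) :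
    CMDiffAt n (T% (cfield I x e)) y := by
  rw [cmdiffAt_iff_tcoord hy]
  refine (contMDiffAt_const (c := e)).congr_of_eventuallyEq ?_
  filter_upwards [(chartAt H x).open_source.mem_nhds hy] with z hz
  exact tcoord_tlift hz e

lemma mdiffAt_cfield {x y : M} (hy : y ∈ (chartAt H x).source) (e : E) :
    MDiffAt (T% (cfield I x e)) y :=
  (cmdiffAt_cfield (n := 1) hy e).mdifferentiableAt (by simp)

/-! ### Functions with values in a vector space -/

lemma contMDiffAt_clm_of_apply [FiniteDimensional ℝ F] {n : ℕ∞} {f : M → F →L[ℝ] F'} {x : M}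
    (h : ∀ e, ContMDiffAt I 𝓘(ℝ, F') n (fun y => f y e) x) :
    ContMDiffAt I 𝓘(ℝ, F →L[ℝ] F') n f x := by
  let b := Module.finBasis ℝ F
  have key : f = fun y => ∑ i, ContinuousLinearMap.smulRightL ℝ F F'
      (LinearMap.toContinuousLinearMap (b.coord i)) (f y (b i)) := by
    funext y
    ext e
    conv_lhs => rw [← b.sum_repr e, map_sum]
    simp only [map_smul]
    simp
  rw [key]
  refine ContMDiffAt.sum fun i _ => ?_
  exact (ContinuousLinearMap.contMDiff (ContinuousLinearMap.smulRightL ℝ F F'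
      (LinearMap.toContinuousLinearMap (b.coord i)))).contMDiffAt.comp x (h (b i))

lemma mdiffAt_clm_of_apply [FiniteDimensional ℝ F] {f : M → F →L[ℝ] F'} {x : M}
    (h : ∀ e, MDifferentiableAt I 𝓘(ℝ, F') (fun y => f y e) x) :
    MDifferentiableAt I 𝓘(ℝ, F →L[ℝ] F') f x := by
  let b := Module.finBasis ℝ F
  have key : f = ∑ i, fun y => ContinuousLinearMap.smulRightL ℝ F F'
      (LinearMap.toContinuousLinearMap (b.coord i)) (f y (b i)) := by
    funext y
    ext e
    conv_lhs => rw [← b.sum_repr e, map_sum]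
    simp only [map_smul]
    simp
  rw [key]
  refine MDifferentiableAt.sum fun i _ => ?_
  exact ((ContinuousLinearMap.smulRightL ℝ F F'
      (LinearMap.toContinuousLinearMap (b.coord i))).mdifferentiableAt).comp x (h (b i))

lemma mvfderiv_congr {f g : M → F} {x : M} (h : f =ᶠ[𝓝 x] g) : mvfderiv I f x = mvfderiv I g x := by
  unfold mvfderiv
  ext v
  have := h.mfderiv_eq (I := I) (I' := 𝓘(ℝ, F))
  have e := h.eq_of_nhds
  change (mfderiv I 𝓘(ℝ, F) f x : E →L[ℝ] F) v = (mfderiv I 𝓘(ℝ, F) g x : E →L[ℝ] F) v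
  exact congrArg (fun L : E →L[ℝ] F => L v) this

/-- Derivatives of functions into a normed space, in terms of `HasMFDerivAt`. -/
lemma mvfderiv_of_hasMFDerivAt {f : M → F} {x : M} {f' : TangentSpace I x →L[ℝ] F}
    (h : HasMFDerivAt I 𝓘(ℝ, F) f x f') : mvfderiv I f x = f' := by
  ext v
  change (mfderiv I 𝓘(ℝ, F) f x : E →L[ℝ] F) v = _
  rw [h.mfderiv]
  rfl

lemma hasMFDerivAt_mvfderiv {f : M → F} {x : M} (h : MDifferentiableAt I 𝓘(ℝ, F) f x) :
    HasMFDerivAt I 𝓘(ℝ, F) f x (mvfderiv I f x) := h.hasMFDerivAt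

lemma mvfderiv_of_eventually_const {f : M → F} {x : M} (c : F) (h : ∀ᶠ y in 𝓝 x, f y = c) :
    mvfderiv I f x = 0 := by
  rw [mvfderiv_congr (g := fun _ => c) h, mvfderiv_const]

lemma mvfderiv_clm_comp (L : F →L[ℝ] F') {f : M → F} {x : M}
    (hf : MDifferentiableAt I 𝓘(ℝ, F) f x) (u : TangentSpace I x) :
    mvfderiv I (fun y => L (f y)) x u = L (mvfderiv I f x u) := by
  have h : HasMFDerivAt 𝓘(ℝ, F) 𝓘(ℝ, F') L (f x) L := L.hasFDerivAt.hasMFDerivAt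
  have := mvfderiv_of_hasMFDerivAt (h.comp x (hasMFDerivAt_mvfderiv hf))
  exact congrArg (fun L : E →L[ℝ] F' => L u) this

/-- The product rule for the evaluation of a linear map. -/
lemma mvfderiv_clm_apply {B : M → F →L[ℝ] F'} {s : M → F} {x : M}
    (hB : MDifferentiableAt I 𝓘(ℝ, F →L[ℝ] F') B x) (hs : MDifferentiableAt I 𝓘(ℝ, F) s x)
    (u : TangentSpace I x) :
    mvfderiv I (fun y => B y (s y)) x u = mvfderiv I B x u (s x) + B x (mvfderiv I s x u) := by
  have h := (isBoundedBilinearMap_apply (𝕜 := ℝ) (E := F) (F := F')).hasFDerivAt (B x, s x)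
  have h' := h.hasMFDerivAt
  have h2 := (hasMFDerivAt_mvfderiv hB).prodMk (hasMFDerivAt_mvfderiv hs)
  have := mvfderiv_of_hasMFDerivAt (HasMFDerivAt.comp x h' h2)
  refine (congrArg (fun L : E →L[ℝ] F' => L u) this).trans ?_
  change B x (mvfderiv I s x u) + mvfderiv I B x u (s x) = _
  abel

/-- The product rule for the evaluation of a bilinear map. -/
lemma mvfderiv_clm_apply₂ {B : M → F →L[ℝ] F' →L[ℝ] F''} {s : M → F} {r : M → F'} {x : M}
    (hB : MDifferentiableAt I 𝓘(ℝ, F →L[ℝ] F' →L[ℝ] F'') B x)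
    (hs : MDifferentiableAt I 𝓘(ℝ, F) s x) (hr : MDifferentiableAt I 𝓘(ℝ, F') r x)
    (u : TangentSpace I x) :
    mvfderiv I (fun y => B y (s y) (r y)) x u = mvfderiv I B x u (s x) (r x)
      + B x (mvfderiv I s x u) (r x) + B x (s x) (mvfderiv I r x u) := by
  rw [mvfderiv_clm_apply (hB.clm_apply hs) hr, mvfderiv_clm_apply hB hs]
  rfl

/-- The derivative of a smooth function along a smooth vector field is smooth. -/
lemma contMDiffAt_mvfderiv_apply {f : M → F} {X : Π y : M, TangentSpace I y} {x : M}
    (hf : ContMDiffAt I 𝓘(ℝ, F) ∞ f x) (hX : CMDiffAt ∞ (T% X) x) :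
    ContMDiffAt I 𝓘(ℝ, F) ∞ (fun y => mvfderiv I f y (X y)) x := by
  have h1 := ContMDiffAt.mfderiv_const (m := ∞) hf (by simp)
  have h2 := ContMDiffAt.clm_apply_of_inCoordinates (n := ∞) (b₁ := id) (b₂ := f) (v := X)
    (ϕ := fun y => mfderiv I 𝓘(ℝ, F) f y) (E₂ := fun z : F => TangentSpace 𝓘(ℝ, F) z) h1 hX hf
  exact (contMDiff_snd_tangentBundle_modelSpace F 𝓘(ℝ, F)).contMDiffAt.comp x h2

lemma eventually_mdiffAt {f : M → F} {x : M} (hf : ContMDiffAt I 𝓘(ℝ, F) ∞ f x) :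
    ∀ᶠ y in 𝓝 x, MDifferentiableAt I 𝓘(ℝ, F) f y := by
  have h1 := (contMDiffAt_iff_contMDiffAt_nhds (n := 1) (by simp)).1 (hf.of_le (by norm_cast))
  filter_upwards [h1] with y hy using hy.mdifferentiableAt (by simp)

lemma eventually_mdiffAt_section {V : Π y : M, TangentSpace I y} {x : M}
    (hV : CMDiffAt ∞ (T% V) x) : ∀ᶠ y in 𝓝 x, MDiffAt (T% V) y := by
  have h1 := (contMDiffAt_iff_contMDiffAt_nhds (n := 1) (by simp)).1 (hV.of_le (by norm_cast))
  filter_upwards [h1] with y hy using hy.mdifferentiableAt (by simp)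

variable [CompleteSpace E]

/-- A Lie bracket acts on functions as a commutator. This follows from the Jacobi identity for vector
fields, applied to `X`, `Y` and `f Z` with `Z` nonzero at `x`. -/
lemma mvfderiv_mlieBracket {f : M → ℝ} {X Y : Π y : M, TangentSpace I y} {x : M}
    (hf : ContMDiffAt I 𝓘(ℝ, ℝ) ∞ f x) (hX : CMDiffAt ∞ (T% X) x) (hY : CMDiffAt ∞ (T% Y) x) :
    mvfderiv I f x (VectorField.mlieBracket I X Y x)
      = mvfderiv I (fun y => mvfderiv I f y (Y y)) x (X x)
        - mvfderiv I (fun y => mvfderiv I f y (X y)) x (Y x) := by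
  -- a nonvanishing `Z` exists unless the model space is trivial
  by_cases hE : Subsingleton E
  · have h : ∀ v : TangentSpace I x, v = 0 := fun v => @Subsingleton.elim E hE v 0
    rw [h (VectorField.mlieBracket I X Y x), h (X x), h (Y x)]
    simp
  rw [not_subsingleton_iff_nontrivial] at hE
  obtain ⟨e, he⟩ := exists_ne (0 : E)
  have hM : IsManifold I (minSmoothness ℝ 3) M := by
    simp only [minSmoothness_of_isRCLikeNormedField]
    exact IsManifold.of_le (n := ∞) (by norm_cast)
  have hM2 : IsManifold I (minSmoothness ℝ 2) M := by
    simp only [minSmoothness_of_isRCLikeNormedField]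
    exact IsManifold.of_le (n := ∞) (by norm_cast)
  set Z : Π y : M, TangentSpace I y := cfield I x e with hZdef
  have hZ : CMDiffAt ∞ (T% Z) x := cmdiffAt_cfield (n := ⊤) (mem_chart_source H x) e
  have hfn := eventually_mdiffAt hf
  have hbr : ∀ {V W : Π y : M, TangentSpace I y}, CMDiffAt ∞ (T% V) x → CMDiffAt ∞ (T% W) x →
      CMDiffAt ∞ (T% (VectorField.mlieBracket I V W)) x := fun hV hW => by
    have : IsManifold I (((⊤ : ℕ∞) : WithTop ℕ∞) + 1) M := by
      have h : ((⊤ : ℕ∞) : WithTop ℕ∞) + 1 = ∞ := by norm_cast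
      rw [h]
      infer_instance
    exact ContMDiffAt.mlieBracket_vectorField (m := ⊤) (n := ⊤) hV hW (by simp)
  have expand : ∀ {V W : Π y : M, TangentSpace I y}, CMDiffAt ∞ (T% V) x → CMDiffAt ∞ (T% W) x →
      VectorField.mlieBracket I V (VectorField.mlieBracket I W (f • Z)) x
        = mvfderiv I (fun y => mvfderiv I f y (W y)) x (V x) • Z x
          + mvfderiv I f x (W x) • VectorField.mlieBracket I V Z x
          + (mvfderiv I f x (V x) • VectorField.mlieBracket I W Z x
          + f x • VectorField.mlieBracket I V (VectorField.mlieBracket I W Z) x) := fun {V W} hV hW => by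
    have e1 : VectorField.mlieBracket I W (f • Z) =ᶠ[𝓝 x]
        ((fun y => mvfderiv I f y (W y)) • Z + f • VectorField.mlieBracket I W Z) := by
      filter_upwards [hfn, eventually_mdiffAt_section hZ] with y h1 h2
      rw [VectorField.mlieBracket_smul_right h1 h2]
      rfl
    rw [Filter.EventuallyEq.mlieBracket_vectorField_eq (EventuallyEq.refl _ V) e1]
    have hWf := (contMDiffAt_mvfderiv_apply hf hW).mdifferentiableAt (by simp)
    have hZ' := hZ.mdifferentiableAt (by simp)
    have hf' := hf.mdifferentiableAt (by simp)
    have hWZ := (hbr hW hZ).mdifferentiableAt (by simp)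
    rw [VectorField.mlieBracket_add_right (hWf.smul_section hZ') (hf'.smul_section hWZ),
      VectorField.mlieBracket_smul_right hWf hZ', VectorField.mlieBracket_smul_right hf' hWZ]
  have two : ∀ {V : Π y : M, TangentSpace I y}, CMDiffAt ∞ (T% V) x →
      CMDiffAt (minSmoothness ℝ 2) (T% V) x := fun hV => hV.of_le (by simp; norm_cast)
  have jac := VectorField.leibniz_identity_mlieBracket_apply (two hX) (two hY) (two (hf.smul_section hZ))
  have jac' := VectorField.leibniz_identity_mlieBracket_apply (two hX) (two hY) (two hZ)
  have hZ' := hZ.mdifferentiableAt (by simp)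
  have hf' := hf.mdifferentiableAt (by simp)
  rw [expand hX hY, expand hY hX, VectorField.mlieBracket_smul_right hf' hZ', jac'] at jac
  have h0 : (mvfderiv I f x (VectorField.mlieBracket I X Y x)
      - (mvfderiv I (fun y => mvfderiv I f y (Y y)) x (X x)
        - mvfderiv I (fun y => mvfderiv I f y (X y)) x (Y x))) • Z x = 0 := by
    have jac2 := sub_eq_zero.2 jac
    rw [← neg_eq_zero, ← jac2]
    module
  have hZx : Z x ≠ 0 := by
    rw [hZdef, cfield, tlift_self]
    exact he
  exact sub_eq_zero.1 ((smul_eq_zero.1 h0).resolve_right hZx)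

end ChartCalculus

section Connections

variable {E : Type*} [NormedAddCommGroup E] [NormedSpace ℝ E] [FiniteDimensional ℝ E]
  {H : Type*} [TopologicalSpace H] {I : ModelWithCorners ℝ E H}
  {M : Type*} [TopologicalSpace M] [ChartedSpace H M] [IsManifold I ∞ M]
  {nabla : (Π x : M, TangentSpace I x) → Π x : M, TangentSpace I x →L[ℝ] TangentSpace I x}
  {g : Π x : M, TangentSpace I x →L[ℝ] TangentSpace I x →L[ℝ] ℝ}

/-! ### Christoffel symbols -/

variable (I) in
/-- The flat connection on the domain of the preferred chart at `x` which differentiates the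
coordinates of vector fields. -/
def chartConn (x : M) (Y : Π y : M, TangentSpace I y) (y : M) :
    TangentSpace I y →L[ℝ] TangentSpace I y :=
  (tlift I x y).comp (mvfderiv I (fun z => tcoord I x z (Y z)) y)

lemma isCovariantDerivativeOn_chartConn (x : M) :
    IsCovariantDerivativeOn E (chartConn I x) (chartAt H x).source where
  add {σ σ' y} hσ hσ' hy := by
    rw [mdiffAt_iff_tcoord hy] at hσ hσ'
    ext w
    simp only [chartConn, Pi.add_apply, map_add, ContinuousLinearMap.comp_apply,
      add_apply]
    rw [mvfderiv_fun_add hσ hσ', add_apply, map_add]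
  leibniz {σ f y} hσ hf hy := by
    rw [mdiffAt_iff_tcoord hy] at hσ
    ext w
    simp only [chartConn, Pi.smul_apply', map_smul, ContinuousLinearMap.comp_apply,
      add_apply, smul_apply,
      ContinuousLinearMap.smulRight_apply]
    rw [mvfderiv_fun_smul hf hσ]
    simp [tlift_tcoord hy]

/-- The Christoffel symbol of a connection in the preferred chart at `x`: `christ x y e b` are the
coordinates of the derivative at `y`, in the direction with coordinates `b`, of the field with
constant coordinates `e`. -/
def christ (hcov : IsCovariantDerivativeOn E nabla univ) (x y : M) : E →L[ℝ] E →L[ℝ] E :=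
  (LinearMap.mk₂ ℝ (fun e b => tcoord I x y
    (IsCovariantDerivativeOn.difference (hcov.mono (subset_univ _))
      (isCovariantDerivativeOn_chartConn (I := I) x) y (tlift I x y e) (tlift I x y b)))
    (by simp) (by simp) (by simp) (by simp)).toContinuousBilinearMap

/-- A connection in the preferred chart at `x`. -/
lemma tcoord_nabla (hcov : IsCovariantDerivativeOn E nabla univ) {x y : M}
    (hy : y ∈ (chartAt H x).source) {Y : Π z : M, TangentSpace I z} (hY : MDiffAt (T% Y) y)
    (w : TangentSpace I y) :
    tcoord I x y (nabla Y y w) = mvfderiv I (fun z => tcoord I x z (Y z)) y w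
      + christ hcov x y (tcoord I x y (Y y)) (tcoord I x y w) := by
  have h : christ hcov x y (tcoord I x y (Y y)) (tcoord I x y w) = tcoord I x y
    (IsCovariantDerivativeOn.difference (hcov.mono (subset_univ _))
      (isCovariantDerivativeOn_chartConn (I := I) x) y (tlift I x y (tcoord I x y (Y y)))
        (tlift I x y (tcoord I x y w))) := rfl
  rw [h, tlift_tcoord hy, tlift_tcoord hy, IsCovariantDerivativeOn.difference_apply _ _ hy hY]
  simp [chartConn, tcoord_tlift hy]

lemma christ_apply (hcov : IsCovariantDerivativeOn E nabla univ) {x y : M}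
    (hy : y ∈ (chartAt H x).source) (e b : E) :
    christ hcov x y e b = tcoord I x y (nabla (cfield I x e) y (tlift I x y b)) := by
  rw [tcoord_nabla hcov hy (mdiffAt_cfield hy e), tcoord_tlift hy,
    mvfderiv_of_eventually_const (x := y) e, cfield, tcoord_tlift hy]
  · simp
  · filter_upwards [(chartAt H x).open_source.mem_nhds hy] with z hz using tcoord_tlift hz e

lemma mdiffAt_extend {x : M} (v : TangentSpace I x) :
    MDiffAt (T% (FiberBundle.extend E v : Π z : M, TangentSpace I z)) x :=
  FiberBundle.mdifferentiableAt_extend ..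

lemma cmdiffAt_extend {n : ℕ∞} {x : M} (v : TangentSpace I x) :
    CMDiffAt n (T% (FiberBundle.extend E v : Π z : M, TangentSpace I z)) x := by
  rw [cmdiffAt_iff_tcoord (mem_chart_source H x)]
  refine (contMDiffAt_const (M' := E) (c := v)).congr_of_eventuallyEq ?_
  filter_upwards [chart_source_mem_nhds H x] with z hz
  rw [extend_eq_cfield hz]
  exact tcoord_tlift hz _

lemma nabla_congr (hcov : IsCovariantDerivativeOn E nabla univ) {x : M}
    {Y Y' : Π z : M, TangentSpace I z} (hY : MDiffAt (T% Y) x) (h : Y =ᶠ[𝓝 x] Y') :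
    nabla Y x = nabla Y' x := by
  refine hcov.congr_of_eventuallyEq hY (hY.congr_of_eventuallyEq ?_) univ_mem h
  filter_upwards [h] with y hy
  rw [hy]

/-- For smooth fields, `∇_X Y` is smooth. -/
lemma cmdiffAt_nabla
    (hsm : ∀ s : Set M, IsOpen s → ContMDiffCovariantDerivativeOn E ∞ nabla s) {s : Set M} {x : M}
    (hs : IsOpen s) (hx : x ∈ s) {X Y : Π z : M, TangentSpace I z}
    (hY : ContMDiffOn I I.tangent ∞ (T% Y) s) (hX : CMDiffAt ∞ (T% X) x) :
    CMDiffAt ∞ (T% (fun y => nabla Y y (X y))) x := by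
  have h := ((hsm s hs).contMDiff (σ := Y) (by simpa using hY)).contMDiffAt (hs.mem_nhds hx)
  exact h.clm_bundle_apply hX

lemma contMDiffOn_cfield (x : M) (e : E) :
    ContMDiffOn I I.tangent ∞ (T% (cfield I x e)) (chartAt H x).source :=
  fun _ hy => (cmdiffAt_cfield (n := ⊤) hy e).contMDiffWithinAt

lemma contMDiffAt_christ (hcov : IsCovariantDerivativeOn E nabla univ)
    (hsm : ∀ s : Set M, IsOpen s → ContMDiffCovariantDerivativeOn E ∞ nabla s) {x y : M}
    (hy : y ∈ (chartAt H x).source) :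
    ContMDiffAt I 𝓘(ℝ, E →L[ℝ] E →L[ℝ] E) ∞ (christ hcov x) y := by
  refine contMDiffAt_clm_of_apply (n := ⊤) fun e => contMDiffAt_clm_of_apply (n := ⊤) fun b => ?_
  have h := cmdiffAt_nabla hsm (chartAt H x).open_source hy (contMDiffOn_cfield x e)
    (cmdiffAt_cfield (n := ⊤) hy b)
  have h' := (cmdiffAt_iff_tcoord (n := ⊤) hy).1 h
  refine h'.congr_of_eventuallyEq ?_
  filter_upwards [(chartAt H x).open_source.mem_nhds hy] with z hz using christ_apply hcov hz e b

/-! ### Differentiability of tensors -/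

/-- A field of linear forms is differentiable if its values on fields with constant coordinates are. -/
lemma mdiffAt_form_of_const {φ : Π y : M, TangentSpace I y →ₗ[ℝ] ℝ} {x : M}
    (h : ∀ e, MDifferentiableAt I 𝓘(ℝ, ℝ) (fun y => φ y (cfield I x e y)) x)
    {Z : Π y : M, TangentSpace I y} (hZ : MDiffAt (T% Z) x) :
    MDifferentiableAt I 𝓘(ℝ, ℝ) (fun y => φ y (Z y)) x := by
  rw [mdiffAt_iff_tcoord (mem_chart_source H x)] at hZ
  let F : M → E →L[ℝ] ℝ := fun y => LinearMap.toContinuousLinearMap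
    ((φ y).comp (tlift I x y).toLinearMap)
  have hF : MDifferentiableAt I 𝓘(ℝ, E →L[ℝ] ℝ) F x := mdiffAt_clm_of_apply h
  refine (hF.clm_apply hZ).congr_of_eventuallyEq ?_
  filter_upwards [chart_source_mem_nhds H x] with y hy
  change φ y (Z y) = φ y (tlift I x y (tcoord I x y (Z y)))
  rw [tlift_tcoord hy]

lemma IsRiemannianMetric.symm (hg : IsRiemannianMetric g) {x : M} (u v : TangentSpace I x) :
    g x u v = g x v u := by
  obtain ⟨G, rfl⟩ := hg
  exact G.symm x u v

lemma IsRiemannianMetric.pos (hg : IsRiemannianMetric g) {x : M} {u : TangentSpace I x}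
    (hu : u ≠ 0) : 0 < g x u u := by
  obtain ⟨G, rfl⟩ := hg
  exact G.pos x u hu

lemma IsRiemannianMetric.contMDiffAt (hg : IsRiemannianMetric g) {n : ℕ∞} {x : M}
    {X Y : Π y : M, TangentSpace I y} (hX : CMDiffAt n (T% X) x) (hY : CMDiffAt n (T% Y) x) :
    ContMDiffAt I 𝓘(ℝ, ℝ) n (fun y => g y (X y) (Y y)) x := by
  obtain ⟨G, rfl⟩ := hg
  have h := (G.contMDiff.contMDiffAt (x := x)).of_le (m := n) (by exact_mod_cast le_top)
  have h2 : ContMDiffAt I (I.prod 𝓘(ℝ, ℝ)) n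
      (fun y => TotalSpace.mk' ℝ (E := Bundle.Trivial M ℝ) y (G.inner y (X y) (Y y))) x :=
    ContMDiffAt.clm_bundle_apply₂ (F₁ := E) (F₂ := E) h hX hY
  simp only [contMDiffAt_totalSpace] at h2
  exact h2.2

/-- The metric in the preferred chart at `x`. -/
def metricCoord (g : Π x : M, TangentSpace I x →L[ℝ] TangentSpace I x →L[ℝ] ℝ) (x y : M) :
    E →L[ℝ] E →L[ℝ] ℝ :=
  (LinearMap.mk₂ ℝ (fun e b => g y (tlift I x y e) (tlift I x y b))
    (by simp) (by simp) (by simp) (by simp)).toContinuousBilinearMap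

lemma metricCoord_apply (x y : M) (e b : E) :
    metricCoord g x y e b = g y (tlift I x y e) (tlift I x y b) := rfl

lemma metricCoord_tcoord {x y : M} (hy : y ∈ (chartAt H x).source) (v w : TangentSpace I y) :
    metricCoord g x y (tcoord I x y v) (tcoord I x y w) = g y v w := by
  rw [metricCoord_apply, tlift_tcoord hy, tlift_tcoord hy]

lemma contMDiffAt_metricCoord (hg : IsRiemannianMetric g) {x y : M}
    (hy : y ∈ (chartAt H x).source) :
    ContMDiffAt I 𝓘(ℝ, E →L[ℝ] E →L[ℝ] ℝ) ∞ (metricCoord g x) y :=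
  contMDiffAt_clm_of_apply (n := ⊤) fun e => contMDiffAt_clm_of_apply (n := ⊤) fun b =>
    hg.contMDiffAt (cmdiffAt_cfield hy e) (cmdiffAt_cfield hy b)

lemma IsRiemannianMetric.mdiffAt (hg : IsRiemannianMetric g) {x : M}
    {X Y : Π y : M, TangentSpace I y} (hX : MDiffAt (T% X) x) (hY : MDiffAt (T% Y) x) :
    MDifferentiableAt I 𝓘(ℝ, ℝ) (fun y => g y (X y) (Y y)) x := by
  have hx := mem_chart_source H x
  rw [mdiffAt_iff_tcoord hx] at hX hY
  refine ((((contMDiffAt_metricCoord hg hx).mdifferentiableAt (by simp)).clm_apply hX).clm_apply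
    hY).congr_of_eventuallyEq ?_
  filter_upwards [chart_source_mem_nhds H x] with y hy
  rw [metricCoord_tcoord hy]

end Connections

section MetricTensors

set_option synthInstance.maxHeartbeats 200000

variable {E : Type*} [NormedAddCommGroup E] [NormedSpace ℝ E] [FiniteDimensional ℝ E]
  {H : Type*} [TopologicalSpace H] {I : ModelWithCorners ℝ E H}
  {M : Type*} [TopologicalSpace M] [ChartedSpace H M] [IsManifold I ∞ M]
  {nabla : (Π x : M, TangentSpace I x) → Π x : M, TangentSpace I x →L[ℝ] TangentSpace I x}
  {g : Π x : M, TangentSpace I x →L[ℝ] TangentSpace I x →L[ℝ] ℝ}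

instance (x : M) : FiniteDimensional ℝ (TangentSpace I x) := inferInstanceAs (FiniteDimensional ℝ E)

lemma finrank_tangentSpace (x : M) : Module.finrank ℝ (TangentSpace I x) = Module.finrank ℝ E := rfl

/-! ### Musical isomorphisms -/

lemma mdiffAt_clm_inverse {F F' : Type*} [NormedAddCommGroup F] [NormedSpace ℝ F] [CompleteSpace F]
    [NormedAddCommGroup F'] [NormedSpace ℝ F'] {f : M → F →L[ℝ] F'} {x : M}
    (hf : MDifferentiableAt I 𝓘(ℝ, F →L[ℝ] F') f x) (L : F ≃L[ℝ] F') (hL : (L : F →L[ℝ] F') = f x) :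
    MDifferentiableAt I 𝓘(ℝ, F' →L[ℝ] F) (fun y => ContinuousLinearMap.inverse (f y)) x := by
  have h1 : DifferentiableAt ℝ (ContinuousLinearMap.inverse : (F →L[ℝ] F') → F' →L[ℝ] F) (f x) := by
    rw [← hL]
    exact (contDiffAt_map_inverse (n := 1) L).differentiableAt (by simp)
  exact h1.comp_mdifferentiableAt hf

lemma IsRiemannianMetric.ext (hg : IsRiemannianMetric g) {x : M} {u v : TangentSpace I x}
    (h : ∀ z, g x u z = g x v z) : u = v := by
  by_contra hne
  have h1 := hg.pos (sub_ne_zero.2 hne)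
  have h2 : ∀ z, g x (u - v) z = 0 := fun z => by
    rw [(g x).map_sub u v, sub_apply, h, sub_self]
  exact h1.ne' (h2 _)

lemma sharp_spec (hg : IsRiemannianMetric g) (x : M) (φ : TangentSpace I x →ₗ[ℝ] ℝ)
    (z : TangentSpace I x) : g x (sharp g x φ) z = φ z := by
  let B : TangentSpace I x →ₗ[ℝ] Module.Dual ℝ (TangentSpace I x) :=
    LinearMap.mk₂ ℝ (fun u v => g x u v) (by simp) (by simp) (by simp) (by simp)
  have hinj : Function.Injective B := fun u v huv => hg.ext fun z => LinearMap.congr_fun huv z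
  have hsurj : Function.Surjective B :=
    (LinearMap.injective_iff_surjective_of_finrank_eq_finrank Subspace.dual_finrank_eq.symm).1 hinj
  obtain ⟨s, hs⟩ := hsurj φ
  have := Classical.epsilon_spec (p := fun s => ∀ z, g x s z = φ z)
    ⟨s, fun z => LinearMap.congr_fun hs z⟩
  exact this z

lemma sharp_eq (hg : IsRiemannianMetric g) {x : M} {φ : TangentSpace I x → ℝ} {s : TangentSpace I x}
    (h : ∀ z, g x s z = φ z) : sharp g x φ = s :=
  hg.ext fun z =>
    (Classical.epsilon_spec (p := fun s => ∀ z, g x s z = φ z) ⟨s, h⟩ z).trans (h z).symm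

/-- The vector field dual to a differentiable field of linear forms is differentiable. -/
lemma mdiffAt_sharp (hg : IsRiemannianMetric g) {x : M} (φ : Π y : M, TangentSpace I y →ₗ[ℝ] ℝ)
    (h : ∀ e, MDifferentiableAt I 𝓘(ℝ, ℝ) (fun y => φ y (cfield I x e y)) x) :
    MDiffAt (T% (fun y => sharp g y (φ y))) x := by
  have hx := mem_chart_source H x
  rw [mdiffAt_iff_tcoord hx]
  let F : M → E →L[ℝ] ℝ := fun y => LinearMap.toContinuousLinearMap
    ((φ y).comp (tlift I x y).toLinearMap)
  have hF : MDifferentiableAt I 𝓘(ℝ, E →L[ℝ] ℝ) F x := mdiffAt_clm_of_apply h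
  have hG := (contMDiffAt_metricCoord hg hx).mdifferentiableAt (n := ∞) (by simp)
  have hequiv : ∀ y ∈ (chartAt H x).source, ∃ L : E ≃L[ℝ] (E →L[ℝ] ℝ),
      (L : E →L[ℝ] E →L[ℝ] ℝ) = metricCoord g x y := by
    intro y hy
    have hinj : Function.Injective (metricCoord g x y).toLinearMap := by
      rw [← LinearMap.ker_eq_bot, LinearMap.ker_eq_bot']
      intro e he
      by_contra hne
      have h1 : tlift I x y e ≠ 0 := fun h0 => hne (by rw [← tcoord_tlift (I := I) hy e, h0, map_zero])
      have h2 := hg.pos h1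
      rw [← metricCoord_apply] at h2
      have h3 : metricCoord g x y e e = 0 := congrArg (fun L : E →L[ℝ] ℝ => L e) he
      exact h2.ne' h3
    have hfr : Module.finrank ℝ E = Module.finrank ℝ (E →L[ℝ] ℝ) := by
      rw [← (LinearMap.toContinuousLinearMap (𝕜 := ℝ) (E := E) (F' := ℝ)).finrank_eq]
      exact Subspace.dual_finrank_eq.symm
    refine ⟨(LinearEquiv.ofInjectiveOfFinrankEq (metricCoord g x y).toLinearMap hinj
      hfr).toContinuousLinearEquiv, ?_⟩
    ext e : 1
    rfl
  have hinv : MDifferentiableAt I 𝓘(ℝ, (E →L[ℝ] ℝ) →L[ℝ] E)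
      (fun y => ContinuousLinearMap.inverse (metricCoord g x y)) x := by
    obtain ⟨L, hL⟩ := hequiv x hx
    exact mdiffAt_clm_inverse hG L hL
  refine (hinv.clm_apply hF).congr_of_eventuallyEq ?_
  filter_upwards [chart_source_mem_nhds H x] with y hy
  obtain ⟨L, hL⟩ := hequiv y hy
  have h1 : metricCoord g x y (tcoord I x y (sharp g y (φ y))) = F y := by
    ext e
    rw [metricCoord_apply, tlift_tcoord hy, sharp_spec hg]
    rfl
  rw [← h1, ← hL, ContinuousLinearMap.inverse_equiv]
  exact (L.symm_apply_apply _).symm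

/-! ### The covariant derivative of the metric -/

/-- The tensor `∇g`: `nablaG u v w = (∇_u g)(v, w)`, computed at `x` in the preferred chart at `x`. -/
def nablaG (hcov : IsCovariantDerivativeOn E nabla univ)
    (g : Π x : M, TangentSpace I x →L[ℝ] TangentSpace I x →L[ℝ] ℝ) (x : M) :
    TangentSpace I x →ₗ[ℝ] TangentSpace I x →ₗ[ℝ] TangentSpace I x →ₗ[ℝ] ℝ :=
  LinearMap.mk₂ ℝ (fun u v =>
    { toFun := fun w => mvfderiv I (metricCoord g x) x u (tcoord I x x v) (tcoord I x x w)
        - metricCoord g x x (christ hcov x x (tcoord I x x v) (tcoord I x x u)) (tcoord I x x w)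
        - metricCoord g x x (tcoord I x x v) (christ hcov x x (tcoord I x x w) (tcoord I x x u))
      map_add' := fun w w' => by simp only [map_add, add_apply]; ring
      map_smul' := fun c w => by
        simp only [map_smul, smul_apply, smul_eq_mul, RingHom.id_apply]; ring })
    (fun u u' v => by
      ext w; simp only [map_add, add_apply, LinearMap.add_apply, LinearMap.coe_mk, AddHom.coe_mk]; ring)
    (fun c u v => by
      ext w
      simp only [map_smul, smul_apply, LinearMap.smul_apply, LinearMap.coe_mk, AddHom.coe_mk,
        smul_eq_mul]
      ring)
    (fun u v v' => by
      ext w; simp only [map_add, add_apply, LinearMap.add_apply, LinearMap.coe_mk, AddHom.coe_mk]; ring)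
    (fun c u v => by
      ext w
      simp only [map_smul, smul_apply, LinearMap.smul_apply, LinearMap.coe_mk, AddHom.coe_mk,
        smul_eq_mul]
      ring)

variable (hcov : IsCovariantDerivativeOn E nabla univ)

lemma nablaG_apply (x : M) (u v w : TangentSpace I x) :
    nablaG hcov g x u v w = mvfderiv I (metricCoord g x) x u (tcoord I x x v) (tcoord I x x w)
      - metricCoord g x x (christ hcov x x (tcoord I x x v) (tcoord I x x u)) (tcoord I x x w)
      - metricCoord g x x (tcoord I x x v) (christ hcov x x (tcoord I x x w) (tcoord I x x u)) := rfl

/-- `u⟨Y, Z⟩ = (∇_u g)(Y, Z) + ⟨∇_u Y, Z⟩ + ⟨Y, ∇_u Z⟩`. -/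
lemma mvfderiv_metric (hg : IsRiemannianMetric g) {x : M} {Y Z : Π y : M, TangentSpace I y}
    (hY : MDiffAt (T% Y) x) (hZ : MDiffAt (T% Z) x) (u : TangentSpace I x) :
    mvfderiv I (fun y => g y (Y y) (Z y)) x u
      = nablaG hcov g x u (Y x) (Z x) + g x (nabla Y x u) (Z x) + g x (Y x) (nabla Z x u) := by
  have hx := mem_chart_source H x
  have hY' := (mdiffAt_iff_tcoord hx).1 hY
  have hZ' := (mdiffAt_iff_tcoord hx).1 hZ
  have hG := (contMDiffAt_metricCoord hg hx).mdifferentiableAt (n := ∞) (by simp)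
  have e1 : (fun y => g y (Y y) (Z y)) =ᶠ[𝓝 x]
      fun y => metricCoord g x y (tcoord I x y (Y y)) (tcoord I x y (Z y)) := by
    filter_upwards [chart_source_mem_nhds H x] with y hy
    rw [metricCoord_tcoord hy]
  rw [mvfderiv_congr e1, mvfderiv_clm_apply₂ hG hY' hZ', nablaG_apply, ← metricCoord_tcoord hx,
    ← metricCoord_tcoord hx, tcoord_nabla hcov hx hY, tcoord_nabla hcov hx hZ]
  simp only [map_add, add_apply]
  ring

lemma nablaG_symm (hg : IsRiemannianMetric g) (x : M) (u v w : TangentSpace I x) :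
    nablaG hcov g x u v w = nablaG hcov g x u w v := by
  have h1 := mvfderiv_metric hcov hg (mdiffAt_extend v) (mdiffAt_extend w) u
  have h2 := mvfderiv_metric hcov hg (mdiffAt_extend w) (mdiffAt_extend v) u
  have e : (fun y => g y (FiberBundle.extend E v y) (FiberBundle.extend E w y))
      = fun y => g y (FiberBundle.extend E w y) (FiberBundle.extend E v y) :=
    funext fun y => hg.symm _ _
  rw [e, h2] at h1
  simp only [FiberBundle.extend_apply_self] at h1
  rw [hg.symm (nabla _ x u) w, hg.symm (nabla _ x u) v] at h1
  linarith

variable (hsm : ∀ s : Set M, IsOpen s → ContMDiffCovariantDerivativeOn E ∞ nabla s)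
include hsm

lemma mdiffAt_nablaG (hg : IsRiemannianMetric g) {x : M} {X Y Z : Π y : M, TangentSpace I y}
    (hX : MDiffAt (T% X) x) (hY : MDiffAt (T% Y) x) (hZ : MDiffAt (T% Z) x) :
    MDifferentiableAt I 𝓘(ℝ, ℝ) (fun y => nablaG hcov g y (X y) (Y y) (Z y)) x := by
  refine mdiffAt_form_of_const (φ := fun y => nablaG hcov g y (X y) (Y y)) (fun e₃ => ?_) hZ
  refine mdiffAt_form_of_const (φ := fun y => (nablaG hcov g y (X y)).flip (cfield I x e₃ y))
    (fun e₂ => ?_) hY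
  refine mdiffAt_form_of_const (φ := fun y => ((nablaG hcov g y).flip (cfield I x e₂ y)).flip
    (cfield I x e₃ y)) (fun e₁ => ?_) hX
  have hx := mem_chart_source H x
  have hc : ∀ e, CMDiffAt ∞ (T% (cfield I x e)) x := fun e => cmdiffAt_cfield (n := ⊤) hx e
  have hd : ∀ e e', MDiffAt (T% (fun y => nabla (cfield I x e) y (cfield I x e' y))) x := fun e e' =>
    (cmdiffAt_nabla hsm (chartAt H x).open_source hx (contMDiffOn_cfield x e) (hc e')).mdifferentiableAt
      (by simp)
  have h1 := (contMDiffAt_mvfderiv_apply (hg.contMDiffAt (n := ⊤) (hc e₂) (hc e₃))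
    (hc e₁)).mdifferentiableAt (by simp)
  have h2 := hg.mdiffAt (hd e₂ e₁) (mdiffAt_cfield hx e₃)
  have h3 := hg.mdiffAt (mdiffAt_cfield hx e₂) (hd e₃ e₁)
  refine ((h1.sub h2).sub h3).congr_of_eventuallyEq ?_
  filter_upwards [chart_source_mem_nhds H x] with y hy
  have := mvfderiv_metric hcov hg (mdiffAt_cfield hy e₂) (mdiffAt_cfield hy e₃) (cfield I x e₁ y)
  simp only [LinearMap.flip_apply, Pi.sub_apply]
  rw [this]
  ring

end MetricTensors

section LeviCivita

variable {E : Type*} [NormedAddCommGroup E] [NormedSpace ℝ E] [FiniteDimensional ℝ E]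
  {H : Type*} [TopologicalSpace H] {I : ModelWithCorners ℝ E H}
  {M : Type*} [TopologicalSpace M] [ChartedSpace H M] [IsManifold I ∞ M]
  {nabla : (Π x : M, TangentSpace I x) → Π x : M, TangentSpace I x →L[ℝ] TangentSpace I x}
  {g : Π x : M, TangentSpace I x →L[ℝ] TangentSpace I x →L[ℝ] ℝ}

/-! ### Affine-Riemann structures and their Levi-Civita connections -/

/-- `nabla` is a smooth flat torsion-free connection and `g` is a smooth Riemannian metric. This is
`ConnMetricManifold.IsAffineRiemann` for an unbundled manifold. -/
structure IsAffRiem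
    (nabla : (Π x : M, TangentSpace I x) → Π x : M, TangentSpace I x →L[ℝ] TangentSpace I x)
    (g : Π x : M, TangentSpace I x →L[ℝ] TangentSpace I x →L[ℝ] ℝ) : Prop where
  cov : IsCovariantDerivativeOn E nabla univ
  smooth : ∀ s : Set M, IsOpen s → ContMDiffCovariantDerivativeOn E ∞ nabla s
  torsionFree : IsTorsionFree nabla
  flat : IsFlat (fun Y x w => nabla Y x w)
  metric : IsRiemannianMetric g

instance (x : M) : T2Space (TangentSpace I x) := inferInstanceAs (T2Space E)

variable (h : IsAffRiem nabla g)

/-- Half of the Koszul combination of `∇g`; the linear form dual to `γ_u v`. -/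
def koszul (hcov : IsCovariantDerivativeOn E nabla univ)
    (g : Π x : M, TangentSpace I x →L[ℝ] TangentSpace I x →L[ℝ] ℝ) (x : M) (u v : TangentSpace I x) :
    TangentSpace I x →ₗ[ℝ] ℝ :=
  (1 / 2 : ℝ) • (nablaG hcov g x u v + nablaG hcov g x v u
    - ((nablaG hcov g x).flip u).flip v)

lemma koszul_apply (hcov : IsCovariantDerivativeOn E nabla univ) (x : M) (u v w : TangentSpace I x) :
    koszul hcov g x u v w = 1 / 2 * (nablaG hcov g x u v w + nablaG hcov g x v u w
      - nablaG hcov g x w u v) := rfl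

/-- The difference tensor `γ = D - ∇` of the Levi-Civita connection, given by
`2⟨γ_u v, w⟩ = (∇_u g)(v, w) + (∇_v g)(u, w) - (∇_w g)(u, v)`. -/
def gam (h : IsAffRiem nabla g) (x : M) :
    TangentSpace I x →ₗ[ℝ] TangentSpace I x →ₗ[ℝ] TangentSpace I x :=
  LinearMap.mk₂ ℝ (fun u v => sharp g x (koszul h.cov g x u v))
    (fun u u' v => sharp_eq h.metric fun z => by
      rw [map_add, add_apply, sharp_spec h.metric, sharp_spec h.metric]
      simp only [koszul_apply, map_add, LinearMap.add_apply]; ring)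
    (fun c u v => sharp_eq h.metric fun z => by
      rw [map_smul, smul_apply, sharp_spec h.metric]
      simp only [koszul_apply, map_smul, LinearMap.smul_apply, smul_eq_mul]; ring)
    (fun u v v' => sharp_eq h.metric fun z => by
      rw [map_add, add_apply, sharp_spec h.metric, sharp_spec h.metric]
      simp only [koszul_apply, map_add, LinearMap.add_apply]; ring)
    (fun c u v => sharp_eq h.metric fun z => by
      rw [map_smul, smul_apply, sharp_spec h.metric]
      simp only [koszul_apply, map_smul, LinearMap.smul_apply, smul_eq_mul]; ring)

lemma metric_gam (x : M) (u v w : TangentSpace I x) :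
    g x (gam h x u v) w = 1 / 2 * (nablaG h.cov g x u v w + nablaG h.cov g x v u w
      - nablaG h.cov g x w u v) := by
  change g x (sharp g x (koszul h.cov g x u v)) w = _
  rw [sharp_spec h.metric, koszul_apply]

lemma gam_symm (x : M) (u v : TangentSpace I x) : gam h x u v = gam h x v u :=
  h.metric.ext fun z => by
    rw [metric_gam, metric_gam, nablaG_symm h.cov h.metric x z u v]; ring

lemma metric_gam_add (x : M) (u v w : TangentSpace I x) :
    g x (gam h x u v) w + g x v (gam h x u w) = nablaG h.cov g x u v w := by
  rw [h.metric.symm v, metric_gam, metric_gam, nablaG_symm h.cov h.metric x u w v,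
    nablaG_symm h.cov h.metric x w u v, nablaG_symm h.cov h.metric x v u w]
  ring

lemma mdiffAt_gam {x : M} {X Y : Π y : M, TangentSpace I y}
    (hX : MDiffAt (T% X) x) (hY : MDiffAt (T% Y) x) :
    MDiffAt (T% (fun y => gam h y (X y) (Y y))) x := by
  refine mdiffAt_sharp h.metric (fun y => koszul h.cov g y (X y) (Y y)) fun e => ?_
  have he := mdiffAt_cfield (I := I) (mem_chart_source H x) e
  have h1 := mdiffAt_nablaG h.cov h.smooth h.metric hX hY he
  have h2 := mdiffAt_nablaG h.cov h.smooth h.metric hY hX he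
  have h3 := mdiffAt_nablaG h.cov h.smooth h.metric he hX hY
  exact ((h1.add h2).sub h3).const_smul (1 / 2 : ℝ)

/-- The connection `∇ + γ`. -/
def lcConn (h : IsAffRiem nabla g) (Y : Π x : M, TangentSpace I x) (x : M) :
    TangentSpace I x →L[ℝ] TangentSpace I x :=
  nabla Y x + (gam h x).flip.toContinuousBilinearMap (Y x)

lemma lcConn_apply (Y : Π x : M, TangentSpace I x) (x : M) (u : TangentSpace I x) :
    lcConn h Y x u = nabla Y x u + gam h x u (Y x) := rfl

lemma isLeviCivita_lcConn : IsLeviCivita g (lcConn h) where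
  isCovariantDerivative := h.cov.add_one_form _
  torsionFree x X Y hX hY := by
    rw [lcConn_apply, lcConn_apply, gam_symm h x (Y x), ← h.torsionFree x X Y hX hY]
    abel
  metric x Y Z hY hZ w := by
    rw [mvfderiv_metric h.cov h.metric hY hZ, ← metric_gam_add h, lcConn_apply, lcConn_apply]
    simp only [map_add, add_apply]
    ring

/-- A metric determines its Levi-Civita connection on differentiable fields: the difference of two
such connections is symmetric in two arguments and skew in two others, hence zero. -/
lemma IsLeviCivita.unique (hg : IsRiemannianMetric g)
    {D D' : (Π x : M, TangentSpace I x) → Π x : M, TangentSpace I x →L[ℝ] TangentSpace I x}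
    (hD : IsLeviCivita g D) (hD' : IsLeviCivita g D') {x : M} {Y : Π y : M, TangentSpace I y}
    (hY : MDiffAt (T% Y) x) : D Y x = D' Y x := by
  let B := IsCovariantDerivativeOn.difference hD.isCovariantDerivative hD'.isCovariantDerivative x
  have hB : ∀ (Y : Π y : M, TangentSpace I y), MDiffAt (T% Y) x → ∀ u, B (Y x) u
      = D Y x u - D' Y x u := fun Y hY u => by
    rw [← sub_apply, ← IsCovariantDerivativeOn.difference_apply
      hD.isCovariantDerivative hD'.isCovariantDerivative (mem_univ x) hY]
  have hBe : ∀ v u, B v u = D (FiberBundle.extend E v) x u - D' (FiberBundle.extend E v) x u :=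
    fun v u => by
      have := hB _ (mdiffAt_extend v) u
      rwa [FiberBundle.extend_apply_self] at this
  have hsymm : ∀ u v, B u v = B v u := fun u v => by
    have h1 := hD.torsionFree x _ _ (mdiffAt_extend u) (mdiffAt_extend v)
    have h2 := hD'.torsionFree x _ _ (mdiffAt_extend u) (mdiffAt_extend v)
    rw [FiberBundle.extend_apply_self, FiberBundle.extend_apply_self] at h1 h2
    rw [hBe, hBe, eq_sub_iff_add_eq, sub_add_eq_add_sub, sub_eq_iff_eq_add]
    rw [sub_eq_iff_eq_add] at h1 h2
    rw [h1, h2]; abel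
  have hskew : ∀ u v w, g x (B v u) w = - g x (B w u) v := fun u v w => by
    have h1 := hD.metric x _ _ (mdiffAt_extend v) (mdiffAt_extend w) u
    have h2 := hD'.metric x _ _ (mdiffAt_extend v) (mdiffAt_extend w) u
    rw [FiberBundle.extend_apply_self, FiberBundle.extend_apply_self] at h1 h2
    rw [hBe, hBe]
    simp only [map_sub, sub_apply]
    rw [hg.symm v] at h1 h2
    linarith
  have hzero : ∀ v u, B v u = 0 := fun v u => hg.ext fun w => by
    rw [(g x).map_zero, zero_apply]
    have a1 := hskew u v w
    have a2 := hskew v w u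
    have a3 := hskew w u v
    rw [hsymm w u] at a1
    rw [hsymm u v] at a2
    rw [hsymm v w] at a3
    linarith
  ext u
  exact sub_eq_zero.1 ((hB Y hY u).symm.trans (hzero _ _))

lemma isLeviCivita_leviCivita (h : IsAffRiem nabla g) : IsLeviCivita g (leviCivita g) :=
  Classical.epsilon_spec ⟨_, isLeviCivita_lcConn h⟩

lemma leviCivita_apply (h : IsAffRiem nabla g) {x : M} {Y : Π y : M, TangentSpace I y} (hY : MDiffAt (T% Y) x)
    (u : TangentSpace I x) : leviCivita g Y x u = nabla Y x u + gam h x u (Y x) := by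
  rw [(isLeviCivita_leviCivita h).unique h.metric (isLeviCivita_lcConn h) hY, lcConn_apply]

/-- `γ_u Y = D_u Y - ∇_u Y`. -/
lemma leviCivita_sub_nabla (x : M) (u v : TangentSpace I x) :
    leviCivita g (FiberBundle.extend E v) x u - nabla (FiberBundle.extend E v) x u = gam h x u v := by
  rw [leviCivita_apply h (mdiffAt_extend v), FiberBundle.extend_apply_self, add_sub_cancel_left]

end LeviCivita

section Frames

variable {E : Type*} [NormedAddCommGroup E] [NormedSpace ℝ E] [FiniteDimensional ℝ E]
  {H : Type*} [TopologicalSpace H] {I : ModelWithCorners ℝ E H}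
  {M : Type*} [TopologicalSpace M] [ChartedSpace H M] [IsManifold I ∞ M]
  {nabla : (Π x : M, TangentSpace I x) → Π x : M, TangentSpace I x →L[ℝ] TangentSpace I x}
  {g : Π x : M, TangentSpace I x →L[ℝ] TangentSpace I x →L[ℝ] ℝ}

/-! ### Frames and traces -/

/-- `v = ∑ i, ⟨v, f i⟩ f i` for all `v`. For a positive definite form this holds for orthonormal
bases, and it is all that is needed to compute traces. -/
def IsParseval {ι : Type*} [Fintype ι]
    (g : Π x : M, TangentSpace I x →L[ℝ] TangentSpace I x →L[ℝ] ℝ) (x : M)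
    (f : ι → TangentSpace I x) : Prop :=
  ∀ v, ∑ i, g x v (f i) • f i = v

/-- The metric at `x` as a bilinear form. -/
def gForm (g : Π x : M, TangentSpace I x →L[ℝ] TangentSpace I x →L[ℝ] ℝ) (x : M) :
    TangentSpace I x →ₗ[ℝ] TangentSpace I x →ₗ[ℝ] ℝ :=
  LinearMap.mk₂ ℝ (fun u v => g x u v) (by simp) (by simp) (by simp) (by simp)

lemma gForm_apply (x : M) (u v : TangentSpace I x) : gForm g x u v = g x u v := rfl

lemma exists_orthonormal (hg : IsRiemannianMetric g) (x : M) :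
    ∃ e : Fin (Module.finrank ℝ E) → TangentSpace I x,
      ∀ i j, g x (e i) (e j) = if i = j then 1 else 0 := by
  obtain ⟨b, hb⟩ := LinearMap.BilinForm.exists_orthogonal_basis (K := ℝ)
    (V := TangentSpace I x) (B := gForm g x) ⟨fun u v => hg.symm u v⟩
  have hpos : ∀ i, 0 < g x (b i) (b i) := fun i => hg.pos (b.ne_zero i)
  refine ⟨fun i => (Real.sqrt (g x (b i) (b i)))⁻¹ • b i, fun i j => ?_⟩
  simp only [map_smul, smul_apply, smul_eq_mul]
  split_ifs with hij
  · subst hij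
    have := Real.mul_self_sqrt (hpos i).le
    have h0 := (Real.sqrt_pos.2 (hpos i)).ne'
    field_simp
    linarith
  · have : g x (b i) (b j) = 0 := hb hij
    rw [this, mul_zero, mul_zero]

lemma frame_orthonormal (hg : IsRiemannianMetric g) (x : M) (i j : Fin (Module.finrank ℝ E)) :
    g x (frame g x i) (frame g x j) = if i = j then 1 else 0 :=
  Classical.epsilon_spec (exists_orthonormal hg x) i j

lemma isParseval_frame (hg : IsRiemannianMetric g) (x : M) : IsParseval g x (frame g x) := by
  have hon := frame_orthonormal hg x
  have hli : LinearIndependent ℝ (frame g x) := by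
    rw [Fintype.linearIndependent_iff]
    intro c hc i
    have h1 := congrArg (fun v => g x v (frame g x i)) hc
    simpa [hon] using h1
  intro v
  have hsp := hli.span_eq_top_of_card_eq_finrank' (by simp [finrank_tangentSpace])
  let L : TangentSpace I x →ₗ[ℝ] TangentSpace I x :=
    ∑ i, ((gForm g x).flip (frame g x i)).smulRight (frame g x i)
  have hL : ∀ v, L v = ∑ i, g x v (frame g x i) • frame g x i := fun v => by simp [L, gForm_apply]
  rw [← hL]
  refine LinearMap.congr_fun (f := L) (g := LinearMap.id)
    (LinearMap.ext_on_range hsp fun i => ?_) v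
  rw [hL]
  simp [hon]

/-- The trace of a bilinear form does not depend on the frame. -/
lemma IsParseval.sum_eq {x : M} {ι κ : Type*} [Fintype ι] [Fintype κ]
    (hg : IsRiemannianMetric g) {f : ι → TangentSpace I x} {e : κ → TangentSpace I x}
    (hf : IsParseval g x f) (he : IsParseval g x e)
    (T : TangentSpace I x →ₗ[ℝ] TangentSpace I x →ₗ[ℝ] ℝ) :
    ∑ i, T (f i) (f i) = ∑ j, T (e j) (e j) := by
  have h1 : ∀ i, T (f i) (f i) = ∑ j, g x (f i) (e j) * T (f i) (e j) := fun i => by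
    have := congrArg (T (f i)) (he (f i))
    simp only [map_sum, map_smul, smul_eq_mul] at this
    exact this.symm
  have h2 : ∀ j, T (e j) (e j) = ∑ i, g x (e j) (f i) * T (f i) (e j) := fun j => by
    have := congrArg (fun v => T v (e j)) (hf (e j))
    simp only [map_sum, map_smul, LinearMap.sum_apply, LinearMap.smul_apply, smul_eq_mul] at this
    exact this.symm
  simp only [h1, h2]
  rw [Finset.sum_comm]
  simp only [hg.symm (f _)]

lemma IsParseval.trace {x : M} {ι : Type*} [Fintype ι] {f : ι → TangentSpace I x}
    (hf : IsParseval g x f) (S : TangentSpace I x →ₗ[ℝ] TangentSpace I x) :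
    LinearMap.trace ℝ _ S = ∑ i, g x (S (f i)) (f i) := by
  have h1 : S = ∑ i, ((gForm g x).flip (f i)).smulRight (S (f i)) := by
    ext v
    conv_lhs => rw [← hf v]
    simp [gForm_apply]
  conv_lhs => rw [h1]
  rw [map_sum]
  simp only [LinearMap.trace_smulRight]
  rfl

lemma IsParseval.map {x : M} {ι : Type*} [Fintype ι] {f : ι → TangentSpace I x}
    (hf : IsParseval g x f) {J : TangentSpace I x →L[ℝ] TangentSpace I x}
    (hJ : ∀ v, J (J v) = -v) (hgJ : ∀ u v, g x (J u) (J v) = g x u v) :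
    IsParseval g x (fun i => J (f i)) := fun v => by
  have h1 : ∀ i, g x v (J (f i)) = - g x (J v) (f i) := fun i => by
    rw [← hgJ v, hJ]; simp
  have h2 := congrArg J (hf (J v))
  rw [hJ, map_sum] at h2
  simp only [map_smul] at h2
  simp only [h1, neg_smul, Finset.sum_neg_distrib, h2, neg_neg]

/-! ### Derivatives of traces -/

/-- The trace of a differentiable field of endomorphisms `S` is differentiable, and its derivative
along `u` is the trace of the covariant derivative of `S`. -/
lemma exists_mvfderiv_trace (hcov : IsCovariantDerivativeOn E nabla univ) {x : M}
    (S : Π y : M, TangentSpace I y →ₗ[ℝ] TangentSpace I y)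
    (hS : ∀ Z : Π y : M, TangentSpace I y, MDiffAt (T% Z) x → MDiffAt (T% (fun y => S y (Z y))) x) :
    MDifferentiableAt I 𝓘(ℝ, ℝ) (fun y => LinearMap.trace ℝ _ (S y)) x ∧
    ∀ u, ∃ P : TangentSpace I x →ₗ[ℝ] TangentSpace I x,
      (∀ Z : Π y : M, TangentSpace I y, MDiffAt (T% Z) x →
        P (Z x) = nabla (fun y => S y (Z y)) x u - S x (nabla Z x u)) ∧
      mvfderiv I (fun y => LinearMap.trace ℝ _ (S y)) x u = LinearMap.trace ℝ _ P := by
  have hx := mem_chart_source H x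
  let K : M → E →L[ℝ] E := fun y => LinearMap.toContinuousLinearMap
    ((tcoord I x y).toLinearMap ∘ₗ S y ∘ₗ (tlift I x y).toLinearMap)
  have hK : MDifferentiableAt I 𝓘(ℝ, E →L[ℝ] E) K x := mdiffAt_clm_of_apply fun e =>
    (mdiffAt_iff_tcoord hx).1 (hS _ (mdiffAt_cfield hx e))
  let tr : (E →L[ℝ] E) →L[ℝ] ℝ := LinearMap.toContinuousLinearMap
    ((LinearMap.trace ℝ E).comp (ContinuousLinearMap.coeLM ℝ))
  have htr : (fun y => LinearMap.trace ℝ _ (S y)) =ᶠ[𝓝 x] fun y => tr (K y) := by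
    filter_upwards [eventually_mem_chart (H := H) x] with y hy
    change _ = LinearMap.trace ℝ E
      ((tcoord I x y).toLinearMap ∘ₗ (S y ∘ₗ (tlift I x y).toLinearMap))
    rw [LinearMap.trace_comp_comm']
    congr 1
    ext v
    simp [tlift_tcoord hy]
  refine ⟨(tr.differentiableAt.comp_mdifferentiableAt hK).congr_of_eventuallyEq htr, fun u => ?_⟩
  let G : E →ₗ[ℝ] E := ((christ hcov x x).flip (tcoord I x x u)).toLinearMap
  let L : E →ₗ[ℝ] E := (mvfderiv I K x u).toLinearMap + (G ∘ₗ (K x).toLinearMap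
    - (K x).toLinearMap ∘ₗ G)
  refine ⟨(tlift I x x).toLinearMap ∘ₗ (L ∘ₗ (tcoord I x x).toLinearMap), fun Z hZ => ?_, ?_⟩
  · have hZ' := (mdiffAt_iff_tcoord hx).1 hZ
    have hK' : ∀ y ∈ (chartAt H x).source, tcoord I x y (S y (Z y)) = K y (tcoord I x y (Z y)) :=
      fun y hy => by
        change _ = tcoord I x y (S y (tlift I x y (tcoord I x y (Z y))))
        rw [tlift_tcoord hy]
    have e1 : (fun y => tcoord I x y (S y (Z y))) =ᶠ[𝓝 x] fun y => K y (tcoord I x y (Z y)) := by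
      filter_upwards [eventually_mem_chart (H := H) x] with y hy using hK' y hy
    have h1 := tcoord_nabla hcov hx (hS Z hZ) u
    have h2 := tcoord_nabla hcov hx hZ u
    rw [mvfderiv_congr e1, mvfderiv_clm_apply hK hZ', hK' x hx] at h1
    have h3 : tcoord I x x (S x (nabla Z x u)) = K x (tcoord I x x (nabla Z x u)) := by
      change _ = tcoord I x x (S x (tlift I x x (tcoord I x x (nabla Z x u))))
      rw [tlift_tcoord hx]
    have h4 : tcoord I x x (nabla (fun y => S y (Z y)) x u - S x (nabla Z x u))
        = L (tcoord I x x (Z x)) := by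
      rw [map_sub, h1, h3, h2, map_add]
      simp only [L, G, LinearMap.add_apply, LinearMap.sub_apply, LinearMap.comp_apply,
        ContinuousLinearMap.coe_coe, ContinuousLinearMap.flip_apply]
      abel
    change tlift I x x (L (tcoord I x x (Z x))) = _
    rw [← h4, tlift_tcoord hx]
  · rw [LinearMap.trace_comp_comm', mvfderiv_congr htr, mvfderiv_clm_comp tr hK]
    have h5 : (L ∘ₗ (tcoord I x x).toLinearMap) ∘ₗ (tlift I x x).toLinearMap = L := by
      ext e
      simp [tcoord_tlift hx]
    have h6 : LinearMap.trace ℝ E L = LinearMap.trace ℝ E (mvfderiv I K x u).toLinearMap := by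
      simp only [L, map_add, map_sub]
      rw [LinearMap.trace_comp_comm', sub_self, add_zero]
    rw [h5, h6]
    rfl

end Frames

section Curvature

variable {E : Type*} [NormedAddCommGroup E] [NormedSpace ℝ E] [FiniteDimensional ℝ E]
  {H : Type*} [TopologicalSpace H] {I : ModelWithCorners ℝ E H}
  {M : Type*} [TopologicalSpace M] [ChartedSpace H M] [IsManifold I ∞ M]
  {nabla : (Π x : M, TangentSpace I x) → Π x : M, TangentSpace I x →L[ℝ] TangentSpace I x}
  {g : Π x : M, TangentSpace I x →L[ℝ] TangentSpace I x →L[ℝ] ℝ}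

/-! ### Traces of curvature -/

lemma contMDiffOn_extend (x : M) (v : TangentSpace I x) :
    ContMDiffOn I I.tangent ∞ (T% (FiberBundle.extend E v : Π z : M, TangentSpace I z))
      (chartAt H x).source :=
  (contMDiffOn_cfield (E := E) x v).congr fun y hy => by rw [extend_eq_cfield hy]

lemma cmdiffAt_nabla_extend (h : IsAffRiem nabla g) {x : M} (v : TangentSpace I x)
    {X : Π z : M, TangentSpace I z} (hX : CMDiffAt ∞ (T% X) x) :
    CMDiffAt ∞ (T% (fun y => nabla (FiberBundle.extend E v) y (X y))) x :=
  cmdiffAt_nabla h.smooth (chartAt H x).open_source (mem_chart_source H x)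
    (contMDiffOn_extend x v) hX

lemma eventually_mdiffAt_extend {x : M} (v : TangentSpace I x) :
    ∀ᶠ y in 𝓝 x, MDiffAt (T% (FiberBundle.extend E v : Π z : M, TangentSpace I z)) y :=
  eventually_mdiffAt_section (cmdiffAt_extend (n := ⊤) v)

lemma mdiffAt_congr {x : M} {Y Y' : Π z : M, TangentSpace I z} (hY : MDiffAt (T% Y) x)
    (h : Y' =ᶠ[𝓝 x] Y) : MDiffAt (T% Y') x :=
  hY.congr_of_eventuallyEq (by filter_upwards [h] with y hy; rw [hy])

/-- The second covariant derivative of a connection `∇ + B`. -/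
lemma second_derivative_add (h : IsAffRiem nabla g)
    {nab' : (Π x : M, TangentSpace I x) → Π x : M, TangentSpace I x → TangentSpace I x}
    {B : Π y : M, TangentSpace I y →ₗ[ℝ] TangentSpace I y →ₗ[ℝ] TangentSpace I y}
    (hnab : ∀ (y : M) (Y : Π z : M, TangentSpace I z), MDiffAt (T% Y) y → ∀ u,
      nab' Y y u = nabla Y y u + B y u (Y y))
    {x : M} (hB : ∀ X Y : Π z : M, TangentSpace I z, MDiffAt (T% X) x → MDiffAt (T% Y) x →
      MDiffAt (T% (fun y => B y (X y) (Y y))) x)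
    (u v w : TangentSpace I x) :
    MDiffAt (T% (fun y => nab' (FiberBundle.extend E w) y (FiberBundle.extend E v y))) x ∧
    nab' (fun y => nab' (FiberBundle.extend E w) y (FiberBundle.extend E v y)) x u
      = nabla (fun y => nabla (FiberBundle.extend E w) y (FiberBundle.extend E v y)) x u
        + nabla (fun y => B y (FiberBundle.extend E v y) (FiberBundle.extend E w y)) x u
        + B x u (nabla (FiberBundle.extend E w) x v + B x v w) := by
  have h1 := (cmdiffAt_nabla_extend h w (cmdiffAt_extend v)).mdifferentiableAt (by simp)
  have h2 := hB _ _ (mdiffAt_extend v) (mdiffAt_extend w)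
  have hW : (fun y => nab' (FiberBundle.extend E w) y (FiberBundle.extend E v y)) =ᶠ[𝓝 x]
      (fun y => nabla (FiberBundle.extend E w) y (FiberBundle.extend E v y))
        + (fun y => B y (FiberBundle.extend E v y) (FiberBundle.extend E w y)) := by
    filter_upwards [eventually_mdiffAt_extend w] with y hy
    rw [hnab y _ hy]; rfl
  have h12 := mdiffAt_congr (mdifferentiableAt_add_section h1 h2) hW
  refine ⟨h12, ?_⟩
  rw [hnab x _ h12, nabla_congr h.cov h12 hW, h.cov.add h1 h2, add_apply, hnab x _ (mdiffAt_extend w),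
    FiberBundle.extend_apply_self, FiberBundle.extend_apply_self]

/-- If `K` is parallel and commutes with `B`, the trace of `K` composed with the curvature of
`∇ + B` is minus the exterior derivative of `v ↦ tr (K ∘ B_v)`. -/
lemma sum_metric_curvature (h : IsAffRiem nabla g)
    {nab' : (Π x : M, TangentSpace I x) → Π x : M, TangentSpace I x → TangentSpace I x}
    {B : Π y : M, TangentSpace I y →ₗ[ℝ] TangentSpace I y →ₗ[ℝ] TangentSpace I y}
    (hnab : ∀ (y : M) (Y : Π z : M, TangentSpace I z), MDiffAt (T% Y) y → ∀ u,
      nab' Y y u = nabla Y y u + B y u (Y y))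
    (hB : ∀ (x : M) (X Y : Π z : M, TangentSpace I z), MDiffAt (T% X) x → MDiffAt (T% Y) x →
      MDiffAt (T% (fun y => B y (X y) (Y y))) x)
    {K : Π y : M, TangentSpace I y →ₗ[ℝ] TangentSpace I y}
    (hK : ∀ (x : M) (Y : Π z : M, TangentSpace I z), MDiffAt (T% Y) x →
      MDiffAt (T% (fun y => K y (Y y))) x)
    (hKpar : ∀ (x : M) (Y : Π z : M, TangentSpace I z), MDiffAt (T% Y) x → ∀ u,
      nabla (fun y => K y (Y y)) x u = K x (nabla Y x u))
    (hcomm : ∀ (x : M) (u v : TangentSpace I x), K x (B x u v) = B x u (K x v))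
    {x : M} {ι : Type*} [Fintype ι] {f : ι → TangentSpace I x} (hf : IsParseval g x f)
    (u v : TangentSpace I x) :
    ∑ i, g x (K x (curvature nab' x u v (f i))) (f i)
      = - extDerivOne (fun y v => LinearMap.trace ℝ _ (K y ∘ₗ B y v)) x u v := by
  set X : Π y : M, TangentSpace I y := FiberBundle.extend E u with hX
  set Y : Π y : M, TangentSpace I y := FiberBundle.extend E v with hY
  have hXd : MDiffAt (T% X) x := mdiffAt_extend u
  have hYd : MDiffAt (T% Y) x := mdiffAt_extend v
  have hS : ∀ V : Π y : M, TangentSpace I y, MDiffAt (T% V) x → ∀ Z : Π y : M, TangentSpace I y,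
      MDiffAt (T% Z) x → MDiffAt (T% (fun y => (K y ∘ₗ B y (V y)) (Z y))) x :=
    fun V hV Z hZ => hK x _ (hB x V Z hV hZ)
  obtain ⟨P, hP, hPt⟩ := (exists_mvfderiv_trace h.cov (fun y => K y ∘ₗ B y (Y y)) (hS Y hYd)).2 u
  obtain ⟨Q, hQ, hQt⟩ := (exists_mvfderiv_trace h.cov (fun y => K y ∘ₗ B y (X y)) (hS X hXd)).2 v
  let br := VectorField.mlieBracket I X Y x
  let L : TangentSpace I x →ₗ[ℝ] TangentSpace I x := K x ∘ₗ B x br - P + Q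
    - ((K x ∘ₗ B x u) ∘ₗ B x v - B x v ∘ₗ (K x ∘ₗ B x u))
  have hL : ∀ w, K x (curvature nab' x u v w) = L w := fun w => by
    have hw := mdiffAt_extend (I := I) w
    have a1 := (second_derivative_add h hnab (hB x) u v w).2
    have a2 := (second_derivative_add h hnab (hB x) v u w).2
    have a3 := h.flat x u v w
    simp only [curvature] at a3 ⊢
    rw [a1, a2, hnab x _ hw]
    have p := hP _ hw
    have q := hQ _ hw
    simp only [LinearMap.comp_apply] at p q
    rw [hKpar x _ (hB x _ _ hYd hw)] at p
    rw [hKpar x _ (hB x _ _ hXd hw)] at q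
    simp only [hX, hY, FiberBundle.extend_apply_self] at p q a3
    simp only [L, LinearMap.add_apply, LinearMap.sub_apply, LinearMap.comp_apply, p, q,
      FiberBundle.extend_apply_self]
    rw [← hcomm x v]
    have a4 := congrArg (K x) a3
    rw [map_zero] at a4
    simp only [map_add, map_sub] at a4 ⊢
    rw [← sub_eq_zero]
    refine Eq.trans ?_ a4
    simp only [br, hX, hY]
    abel
  simp only [hL]
  rw [← hf.trace L]
  simp only [L, map_add, map_sub, extDerivOne]
  rw [LinearMap.trace_comp_comm' (B x v), sub_self, sub_zero, ← hPt, ← hQt]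
  ring

/-! ### The two traces of `∇g` -/

/-- The form `v ↦ tr γ_v`, which is `⟨tr γ^*, v⟩` and half of the trace of `∇_v g`. -/
def sForm (h : IsAffRiem nabla g) (x : M) : TangentSpace I x →ₗ[ℝ] ℝ :=
  (LinearMap.trace ℝ _).comp (gam h x)

lemma sForm_apply (h : IsAffRiem nabla g) (x : M) (v : TangentSpace I x) :
    sForm h x v = LinearMap.trace ℝ _ (gam h x v) := rfl

/-- The vector dual to `(∇_u g)(v, ·)`. -/
def nablaGSharp (h : IsAffRiem nabla g) (x : M) :
    TangentSpace I x →ₗ[ℝ] TangentSpace I x →ₗ[ℝ] TangentSpace I x :=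
  LinearMap.mk₂ ℝ (fun u v => sharp g x (nablaG h.cov g x u v))
    (fun u u' v => sharp_eq h.metric fun z => by
      rw [map_add, add_apply, sharp_spec h.metric, sharp_spec h.metric, map_add]; rfl)
    (fun c u v => sharp_eq h.metric fun z => by
      rw [map_smul, smul_apply, sharp_spec h.metric, map_smul]; rfl)
    (fun u v v' => sharp_eq h.metric fun z => by
      rw [map_add, add_apply, sharp_spec h.metric, sharp_spec h.metric, map_add]; rfl)
    (fun c u v => sharp_eq h.metric fun z => by
      rw [map_smul, smul_apply, sharp_spec h.metric, map_smul]; rfl)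

lemma metric_nablaGSharp (h : IsAffRiem nabla g) (x : M) (u v w : TangentSpace I x) :
    g x (nablaGSharp h x u v) w = nablaG h.cov g x u v w := sharp_spec h.metric x _ w

lemma mdiffAt_nablaGSharp (h : IsAffRiem nabla g) {x : M} {X Y : Π y : M, TangentSpace I y}
    (hX : MDiffAt (T% X) x) (hY : MDiffAt (T% Y) x) :
    MDiffAt (T% (fun y => nablaGSharp h y (X y) (Y y))) x :=
  mdiffAt_sharp h.metric (fun y => nablaG h.cov g y (X y) (Y y)) fun e =>
    mdiffAt_nablaG h.cov h.smooth h.metric hX hY (mdiffAt_cfield (mem_chart_source H x) e)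

/-- The trace `v ↦ ∑ i, (∇_{E_i} g)(E_i, v)`. -/
def aForm (h : IsAffRiem nabla g) (x : M) : TangentSpace I x →ₗ[ℝ] ℝ :=
  (LinearMap.trace ℝ _).comp (nablaGSharp h x).flip

lemma aForm_apply (h : IsAffRiem nabla g) (x : M) (v : TangentSpace I x) :
    aForm h x v = LinearMap.trace ℝ _ ((nablaGSharp h x).flip v) := rfl

lemma mdiffAt_sForm (h : IsAffRiem nabla g) {x : M} {X : Π y : M, TangentSpace I y}
    (hX : MDiffAt (T% X) x) : MDifferentiableAt I 𝓘(ℝ, ℝ) (fun y => sForm h y (X y)) x :=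
  (exists_mvfderiv_trace h.cov (fun y => gam h y (X y)) fun _ hZ => mdiffAt_gam h hX hZ).1

lemma mdiffAt_aForm (h : IsAffRiem nabla g) {x : M} {X : Π y : M, TangentSpace I y}
    (hX : MDiffAt (T% X) x) : MDifferentiableAt I 𝓘(ℝ, ℝ) (fun y => aForm h y (X y)) x := by
  let S : Π y : M, TangentSpace I y →ₗ[ℝ] TangentSpace I y := fun y => (nablaGSharp h y).flip (X y)
  have hS : ∀ Z : Π y : M, TangentSpace I y, MDiffAt (T% Z) x →
      MDiffAt (T% (fun y => S y (Z y))) x := fun Z hZ => by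
    simp only [S, LinearMap.flip_apply]
    exact mdiffAt_nablaGSharp h hZ hX
  exact (exists_mvfderiv_trace h.cov S hS).1

variable {ι : Type*} [Fintype ι]

lemma IsParseval.two_sForm (h : IsAffRiem nabla g) {x : M} {f : ι → TangentSpace I x}
    (hf : IsParseval g x f) (v : TangentSpace I x) :
    2 * sForm h x v = ∑ i, nablaG h.cov g x v (f i) (f i) := by
  rw [sForm_apply, hf.trace, Finset.mul_sum]
  refine Finset.sum_congr rfl fun i _ => ?_
  have := metric_gam_add h x v (f i) (f i)
  rw [h.metric.symm (f i)] at this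
  linarith

lemma IsParseval.aForm (h : IsAffRiem nabla g) {x : M} {f : ι → TangentSpace I x}
    (hf : IsParseval g x f) (v : TangentSpace I x) :
    aForm h x v = ∑ i, nablaG h.cov g x (f i) (f i) v := by
  rw [aForm_apply, hf.trace]
  refine Finset.sum_congr rfl fun i _ => ?_
  rw [LinearMap.flip_apply, metric_nablaGSharp, nablaG_symm h.cov h.metric]

lemma IsParseval.sum_metric_gam (h : IsAffRiem nabla g) {x : M} {f : ι → TangentSpace I x}
    (hf : IsParseval g x f) (v : TangentSpace I x) :
    ∑ i, g x (gam h x (f i) (f i)) v = AffRiem.aForm h x v - sForm h x v := by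
  have h1 := hf.two_sForm h v
  have h2 : sForm h x v = ∑ i, 1 / 2 * nablaG h.cov g x v (f i) (f i) := by
    rw [← Finset.mul_sum, ← h1]; ring
  rw [hf.aForm h, h2, ← Finset.sum_sub_distrib]
  refine Finset.sum_congr rfl fun i _ => ?_
  rw [metric_gam]; ring

lemma extDerivOne_sub {η η' : Π x : M, TangentSpace I x → ℝ} {x : M}
    (hη : ∀ X : Π y : M, TangentSpace I y, MDiffAt (T% X) x →
      MDifferentiableAt I 𝓘(ℝ, ℝ) (fun y => η y (X y)) x)
    (hη' : ∀ X : Π y : M, TangentSpace I y, MDiffAt (T% X) x →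
      MDifferentiableAt I 𝓘(ℝ, ℝ) (fun y => η' y (X y)) x) (u v : TangentSpace I x) :
    extDerivOne (fun y w => η y w - η' y w) x u v = extDerivOne η x u v - extDerivOne η' x u v := by
  simp only [extDerivOne]
  rw [mvfderiv_fun_sub (hη _ (mdiffAt_extend v)) (hη' _ (mdiffAt_extend v)),
    mvfderiv_fun_sub (hη _ (mdiffAt_extend u)) (hη' _ (mdiffAt_extend u))]
  simp only [sub_apply]
  ring

lemma extDerivOne_const_mul {η : Π x : M, TangentSpace I x → ℝ} {x : M} (c : ℝ)
    (hη : ∀ X : Π y : M, TangentSpace I y, MDiffAt (T% X) x →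
      MDifferentiableAt I 𝓘(ℝ, ℝ) (fun y => η y (X y)) x) (u v : TangentSpace I x) :
    extDerivOne (fun y w => c * η y w) x u v = c * extDerivOne η x u v := by
  simp only [extDerivOne]
  have h1 := mvfderiv_clm_comp (I := I) (c • ContinuousLinearMap.id ℝ ℝ) (hη _ (mdiffAt_extend v)) u
  have h2 := mvfderiv_clm_comp (I := I) (c • ContinuousLinearMap.id ℝ ℝ) (hη _ (mdiffAt_extend u)) v
  simp only [smul_apply, ContinuousLinearMap.id_apply, smul_eq_mul] at h1 h2
  rw [h1, h2]
  ring

/-- The Levi-Civita curvature is skew-symmetric: `⟨R(u, v) w, w⟩ = 0`, because `[X, Y]` acts on the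
function `⟨Z, Z⟩` as a commutator. -/
lemma metric_curvature_leviCivita_self (h : IsAffRiem nabla g) (x : M) (u v w : TangentSpace I x) :
    g x (curvature (fun Y x u => leviCivita g Y x u) x u v w) w = 0 := by
  set Z : Π y : M, TangentSpace I y := FiberBundle.extend E w with hZdef
  have hnab : ∀ (y : M) (Y : Π z : M, TangentSpace I z), MDiffAt (T% Y) y → ∀ u,
      (fun Y x u => leviCivita g Y x u : (Π x : M, TangentSpace I x) → Π x : M, TangentSpace I x →
        TangentSpace I x) Y y u = nabla Y y u + gam h y u (Y y) :=
    fun y Y hY u => leviCivita_apply h hY u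
  have hlc := isLeviCivita_leviCivita h
  have hZ : MDiffAt (T% Z) x := mdiffAt_extend w
  have key : ∀ a b : TangentSpace I x,
      mvfderiv I (fun y => mvfderiv I (fun y => g y (Z y) (Z y)) y (FiberBundle.extend E b y)) x a
      = 2 * g x (leviCivita g (fun y => leviCivita g Z y (FiberBundle.extend E b y)) x a) w
        + 2 * g x (leviCivita g Z x b) (leviCivita g Z x a) := fun a b => by
    have hd := (second_derivative_add h hnab (fun X Y => mdiffAt_gam h) a b w).1
    have e1 : (fun y => mvfderiv I (fun y => g y (Z y) (Z y)) y (FiberBundle.extend E b y)) =ᶠ[𝓝 x]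
        fun y => ((2 : ℝ) • ContinuousLinearMap.id ℝ ℝ)
          (g y (leviCivita g Z y (FiberBundle.extend E b y)) (Z y)) := by
      filter_upwards [eventually_mdiffAt_extend w] with y hy
      rw [hlc.metric y Z Z hy hy, h.metric.symm (Z y)]
      simp only [smul_apply, ContinuousLinearMap.id_apply, smul_eq_mul]
      ring
    rw [mvfderiv_congr e1, mvfderiv_clm_comp _ (h.metric.mdiffAt hd hZ), hlc.metric x _ _ hd hZ]
    simp only [hZdef, FiberBundle.extend_apply_self, smul_apply, ContinuousLinearMap.id_apply,
      smul_eq_mul]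
    ring
  have hf : ContMDiffAt I 𝓘(ℝ, ℝ) ∞ (fun y => g y (Z y) (Z y)) x :=
    h.metric.contMDiffAt (n := ⊤) (cmdiffAt_extend w) (cmdiffAt_extend w)
  have hbr := mvfderiv_mlieBracket hf (cmdiffAt_extend (n := ⊤) u) (cmdiffAt_extend (n := ⊤) v)
  rw [FiberBundle.extend_apply_self, FiberBundle.extend_apply_self, key u v, key v u,
    hlc.metric x Z Z hZ hZ, h.metric.symm (Z x)] at hbr
  simp only [curvature, map_add, map_sub, add_apply, sub_apply]
  rw [hZdef, FiberBundle.extend_apply_self, ← hZdef] at hbr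
  rw [h.metric.symm (leviCivita g Z x u) (leviCivita g Z x v)] at hbr
  linarith

/-- The form `v ↦ tr γ_v` is closed: its exterior derivative is minus the trace of the curvature of
`∇ + γ = D`, which is skew-symmetric. -/
lemma extDerivOne_sForm (h : IsAffRiem nabla g) (x : M) (u v : TangentSpace I x) :
    extDerivOne (fun y v => sForm h y v) x u v = 0 := by
  have := sum_metric_curvature h (nab' := fun Y x u => leviCivita g Y x u) (B := gam h)
    (K := fun y => LinearMap.id) (fun y Y hY u => leviCivita_apply h hY u)
    (fun x X Y hX hY => mdiffAt_gam h hX hY) (fun x Y hY => hY) (fun x Y hY u => rfl)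
    (fun x u v => rfl) (isParseval_frame h.metric x) u v
  simp only [LinearMap.id_apply, LinearMap.id_comp, metric_curvature_leviCivita_self h,
    Finset.sum_const_zero] at this
  exact neg_eq_zero.1 this.symm

end Curvature

section ParallelHermitian

variable {E : Type*} [NormedAddCommGroup E] [NormedSpace ℝ E] [FiniteDimensional ℝ E]
  {H : Type*} [TopologicalSpace H] {I : ModelWithCorners ℝ E H}
  {M : Type*} [TopologicalSpace M] [ChartedSpace H M] [IsManifold I ∞ M]
  {nabla : (Π x : M, TangentSpace I x) → Π x : M, TangentSpace I x →L[ℝ] TangentSpace I x}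
  {g : Π x : M, TangentSpace I x →L[ℝ] TangentSpace I x →L[ℝ] ℝ}
  {J : Π x : M, TangentSpace I x →L[ℝ] TangentSpace I x}

/-! ### Hermitian structures with a parallel complex structure -/

/-- A smooth orthogonal almost complex structure which is parallel for `nabla`. -/
structure IsParallelHermitian
    (nabla : (Π x : M, TangentSpace I x) → Π x : M, TangentSpace I x →L[ℝ] TangentSpace I x)
    (g : Π x : M, TangentSpace I x →L[ℝ] TangentSpace I x →L[ℝ] ℝ)
    (J : Π x : M, TangentSpace I x →L[ℝ] TangentSpace I x) : Prop where
  smooth : ContMDiff I (I.prod 𝓘(ℝ, E →L[ℝ] E)) ∞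
    (fun x => TotalSpace.mk' (E →L[ℝ] E)
      (E := fun x : M => TangentSpace I x →L[ℝ] TangentSpace I x) x (J x))
  sq : ∀ (x : M) (u : TangentSpace I x), J x (J x u) = -u
  compatible : ∀ (x : M) (u v : TangentSpace I x), g x (J x u) (J x v) = g x u v
  parallel : ∀ (x : M) (Y : Π y : M, TangentSpace I y), MDiffAt (T% Y) x →
    ∀ u, nabla (fun y => J y (Y y)) x u = J x (nabla Y x u)

variable (h : IsAffRiem nabla g) (hJ : IsParallelHermitian nabla g J)

namespace IsParallelHermitian

include hJ

lemma mdiffAt {x : M} {Y : Π y : M, TangentSpace I y} (hY : MDiffAt (T% Y) x) :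
    MDiffAt (T% (fun y => J y (Y y))) x :=
  (hJ.smooth.mdifferentiable (by simp) x).clm_bundle_apply (F₁ := E) (F₂ := E) hY

lemma metric_J_left (x : M) (u v : TangentSpace I x) : g x (J x u) v = - g x u (J x v) := by
  have := hJ.compatible x u (J x v)
  rw [hJ.sq, map_neg] at this
  linarith

lemma isParseval {ι : Type*} [Fintype ι] {x : M} {f : ι → TangentSpace I x} (hf : IsParseval g x f) :
    IsParseval g x (fun i => J x (f i)) := hf.map (hJ.sq x) (hJ.compatible x)

lemma nablaG_J (x : M) (u v w : TangentSpace I x) :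
    nablaG h.cov g x u (J x v) (J x w) = nablaG h.cov g x u v w := by
  have hv := mdiffAt_extend (I := I) v
  have hw := mdiffAt_extend (I := I) w
  have h1 := mvfderiv_metric h.cov h.metric (hJ.mdiffAt hv) (hJ.mdiffAt hw) u
  have h2 := mvfderiv_metric h.cov h.metric hv hw u
  simp only [hJ.compatible, hJ.parallel x _ hv, hJ.parallel x _ hw] at h1
  simp only [FiberBundle.extend_apply_self] at h1 h2
  linarith

lemma nablaG_J_left (x : M) (u v w : TangentSpace I x) :
    nablaG h.cov g x u (J x v) w = - nablaG h.cov g x u v (J x w) := by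
  have := hJ.nablaG_J h x u v (J x w)
  rw [hJ.sq, map_neg] at this
  linarith

include h in
/-- A complex structure which is parallel for a torsion-free connection is integrable. -/
lemma isHermitian : IsHermitian g J where
  metric := h.metric
  smooth := hJ.smooth
  sq := hJ.sq
  compatible := hJ.compatible
  integrable x u v := by
    have hu := mdiffAt_extend (I := I) u
    have hv := mdiffAt_extend (I := I) v
    simp only
    rw [← h.torsionFree x _ _ (hJ.mdiffAt hu) (hJ.mdiffAt hv), ← h.torsionFree x _ _ (hJ.mdiffAt hu) hv,
      ← h.torsionFree x _ _ hu (hJ.mdiffAt hv), ← h.torsionFree x _ _ hu hv, hJ.parallel x _ hu,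
      hJ.parallel x _ hv, hJ.parallel x _ hu, hJ.parallel x _ hv]
    simp only [map_sub, hJ.sq]
    abel

/-- `dω` in terms of `∇g`. -/
lemma extDerivTwo_fundamentalForm (x : M) (u v w : TangentSpace I x) :
    extDerivTwo (fundamentalForm g J) x u v w = nablaG h.cov g x u (J x v) w
      + nablaG h.cov g x v (J x w) u + nablaG h.cov g x w (J x u) v := by
  have hu := mdiffAt_extend (I := I) u
  have hv := mdiffAt_extend (I := I) v
  have hw := mdiffAt_extend (I := I) w
  simp only [extDerivTwo, fundamentalForm]
  rw [mvfderiv_metric h.cov h.metric (hJ.mdiffAt hv) hw, mvfderiv_metric h.cov h.metric (hJ.mdiffAt hw) hu,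
    mvfderiv_metric h.cov h.metric (hJ.mdiffAt hu) hv, hJ.parallel x _ hu, hJ.parallel x _ hv,
    hJ.parallel x _ hw, ← h.torsionFree x _ _ hu hv, ← h.torsionFree x _ _ hv hw,
    ← h.torsionFree x _ _ hw hu]
  have key : ∀ a b : TangentSpace I x, g x (J x a) b = - g x (J x b) a := fun a b => by
    rw [hJ.metric_J_left, h.metric.symm]
  simp only [FiberBundle.extend_apply_self, map_sub, sub_apply]
  rw [key v (nabla (FiberBundle.extend E w) x u), key w (nabla (FiberBundle.extend E u) x v),
    key u (nabla (FiberBundle.extend E v) x w)]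
  ring

/-- `(D_u ω)(v, w)` in terms of `γ`. -/
lemma leviCivita_fundamentalForm {x : M} {V W : Π y : M, TangentSpace I y} (hV : MDiffAt (T% V) x)
    (hW : MDiffAt (T% W) x) (u : TangentSpace I x) :
    mvfderiv I (fun y => fundamentalForm g J y (V y) (W y)) x u
      - fundamentalForm g J x (leviCivita g V x u) (W x)
      - fundamentalForm g J x (V x) (leviCivita g W x u)
      = g x (gam h x u (J x (V x))) (W x) - g x (J x (gam h x u (V x))) (W x) := by
  simp only [fundamentalForm]
  rw [mvfderiv_metric h.cov h.metric (hJ.mdiffAt hV) hW, leviCivita_apply h hV,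
    leviCivita_apply h hW, hJ.parallel x _ hV, ← metric_gam_add h]
  simp only [map_add, add_apply]
  ring

/-- The sum `∑ i, ⟨γ_{f i} (J (f i)), v⟩` changes sign when the frame `f` is replaced by `J f`, since
`γ` is symmetric. -/
lemma sum_gam_J {ι : Type*} [Fintype ι] {x : M} {f : ι → TangentSpace I x} (hf : IsParseval g x f)
    (v : TangentSpace I x) : ∑ i, g x (gam h x (f i) (J x (f i))) v = 0 := by
  let T : TangentSpace I x →ₗ[ℝ] TangentSpace I x →ₗ[ℝ] ℝ :=
    LinearMap.mk₂ ℝ (fun u w => g x (gam h x u (J x w)) v) (by simp) (by simp) (by simp) (by simp)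
  have hT : ∀ u w, T u w = g x (gam h x u (J x w)) v := fun _ _ => rfl
  have h1 := hf.sum_eq h.metric (hJ.isParseval hf) T
  simp only [hT, hJ.sq, map_neg, neg_apply, Finset.sum_neg_distrib] at h1
  simp only [gam_symm h x (J x _)] at h1
  linarith

/-- The Lee form of a parallel Hermitian structure. -/
lemma leeForm_eq (x : M) (v : TangentSpace I x) : leeForm g J x v = -(aForm h x v - sForm h x v) := by
  have hf := isParseval_frame h.metric x
  simp only [leeForm, codiffTwo, neg_neg]
  have h1 : ∀ i, mvfderiv I (fun y => fundamentalForm g J y (FiberBundle.extend E (frame g x i) y)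
      (FiberBundle.extend E (J x v) y)) x (FiberBundle.extend E (frame g x i) x)
      - fundamentalForm g J x (leviCivita g (FiberBundle.extend E (frame g x i)) x
          (FiberBundle.extend E (frame g x i) x)) (J x v)
      - fundamentalForm g J x (FiberBundle.extend E (frame g x i) x)
        (leviCivita g (FiberBundle.extend E (J x v)) x (FiberBundle.extend E (frame g x i) x))
      = g x (gam h x (frame g x i) (J x (frame g x i))) (J x v)
        - g x (gam h x (frame g x i) (frame g x i)) v := fun i => by
    have := hJ.leviCivita_fundamentalForm h (mdiffAt_extend (frame g x i)) (mdiffAt_extend (J x v))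
      (FiberBundle.extend E (frame g x i) x)
    rw [← hJ.compatible x (gam h x _ _) v]
    simp only [FiberBundle.extend_apply_self] at this ⊢
    exact this
  rw [Finset.sum_congr rfl fun i _ => h1 i, Finset.sum_sub_distrib, hJ.sum_gam_J h hf,
    hf.sum_metric_gam h, zero_sub]

end IsParallelHermitian

/-! ### The Bismut and Chern connections -/

variable (J) in
/-- The difference of the Bismut connection and `∇`, see `IsParallelHermitian.bismut_apply`; its
lowered form is `IsParallelHermitian.metric_bismutTensor`. -/
def bismutTensor (h : IsAffRiem nabla g) (x : M) :
    TangentSpace I x →ₗ[ℝ] TangentSpace I x →ₗ[ℝ] TangentSpace I x :=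
  LinearMap.mk₂ ℝ (fun u v => gam h x u v + (1 / 2 : ℝ) • (nablaGSharp h x (J x u) (J x v)
      - nablaGSharp h x (J x v) (J x u) + J x (nablaGSharp h x u (J x v)
        + nablaGSharp h x (J x v) u - (2 : ℝ) • gam h x u (J x v))))
    (fun u u' v => by simp only [map_add, LinearMap.add_apply, map_sub, map_smul]; module)
    (fun c u v => by simp only [map_smul, LinearMap.smul_apply, map_sub, map_add]; module)
    (fun u v v' => by simp only [map_add, LinearMap.add_apply, map_sub, map_smul]; module)
    (fun c u v => by simp only [map_smul, LinearMap.smul_apply, map_sub, map_add]; module)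

lemma bismutTensor_apply (x : M) (u v : TangentSpace I x) :
    bismutTensor J h x u v = gam h x u v + (1 / 2 : ℝ) • (nablaGSharp h x (J x u) (J x v)
      - nablaGSharp h x (J x v) (J x u) + J x (nablaGSharp h x u (J x v)
        + nablaGSharp h x (J x v) u - (2 : ℝ) • gam h x u (J x v))) := rfl

variable (J) in
/-- The difference of the Chern connection and `∇`, see `IsParallelHermitian.chern_apply`. -/
def chernTensor (h : IsAffRiem nabla g) (x : M) :
    TangentSpace I x →ₗ[ℝ] TangentSpace I x →ₗ[ℝ] TangentSpace I x :=
  LinearMap.mk₂ ℝ (fun u v => (1 / 2 : ℝ) • (nablaGSharp h x u v - nablaGSharp h x (J x u) (J x v)))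
    (fun u u' v => by simp only [map_add, LinearMap.add_apply]; module)
    (fun c u v => by simp only [map_smul, LinearMap.smul_apply]; module)
    (fun u v v' => by simp only [map_add]; module)
    (fun c u v => by simp only [map_smul]; module)

lemma chernTensor_apply (x : M) (u v : TangentSpace I x) :
    chernTensor J h x u v
      = (1 / 2 : ℝ) • (nablaGSharp h x u v - nablaGSharp h x (J x u) (J x v)) := rfl

namespace IsParallelHermitian

include hJ

lemma metric_bismutTensor (x : M) (u v w : TangentSpace I x) :
    g x (bismutTensor J h x u v) w = 1 / 2 * (nablaG h.cov g x u v w + nablaG h.cov g x v u w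
      - nablaG h.cov g x w u v - nablaG h.cov g x (J x u) v (J x w)
      - nablaG h.cov g x (J x v) w (J x u) - nablaG h.cov g x (J x w) u (J x v)) := by
  rw [bismutTensor_apply]
  simp only [map_add, map_sub, map_smul, add_apply, sub_apply, smul_apply, smul_eq_mul,
    hJ.metric_J_left, metric_gam, metric_nablaGSharp]
  rw [hJ.nablaG_J_left h x (J x u) v w, nablaG_symm h.cov h.metric x (J x v) w (J x u)]
  ring

lemma metric_chernTensor (x : M) (u v w : TangentSpace I x) :
    g x (chernTensor J h x u v) w
      = 1 / 2 * (nablaG h.cov g x u v w - nablaG h.cov g x (J x u) (J x v) w) := by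
  rw [chernTensor_apply]
  simp only [map_sub, map_smul, sub_apply, smul_apply, smul_eq_mul, metric_nablaGSharp]

lemma bismut_apply {x : M} {Y : Π y : M, TangentSpace I y} (hY : MDiffAt (T% Y) x)
    (u : TangentSpace I x) :
    bismut g J Y x u = nabla Y x u + bismutTensor J h x u (Y x) := by
  have h1 : sharp g x (fun z => extDerivTwo (fundamentalForm g J) x (J x u) (J x (Y x)) (J x z))
      = (2 : ℝ) • (bismutTensor J h x u (Y x) - gam h x u (Y x)) := by
    refine sharp_eq h.metric fun z => ?_
    rw [hJ.extDerivTwo_fundamentalForm h, map_smul, map_sub, smul_apply, sub_apply,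
      hJ.metric_bismutTensor h, metric_gam, hJ.sq, hJ.sq, hJ.sq]
    simp only [map_neg, LinearMap.neg_apply, smul_eq_mul]
    ring
  rw [bismut, h1, leviCivita_apply h hY]
  module

lemma chern_apply {x : M} {Y : Π y : M, TangentSpace I y} (hY : MDiffAt (T% Y) x)
    (u : TangentSpace I x) :
    chern g J Y x u = nabla Y x u + chernTensor J h x u (Y x) := by
  have h1 : sharp g x (fun z => extDerivTwo (fundamentalForm g J) x (J x u) (Y x) z)
      = (2 : ℝ) • (gam h x u (Y x) - chernTensor J h x u (Y x)) := by
    refine sharp_eq h.metric fun z => ?_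
    rw [hJ.extDerivTwo_fundamentalForm h, map_smul, map_sub, smul_apply, sub_apply,
      hJ.metric_chernTensor h, metric_gam, hJ.nablaG_J h, hJ.sq,
      nablaG_symm h.cov h.metric x (Y x) z u]
    simp only [map_neg, LinearMap.neg_apply, smul_eq_mul]
    ring
  rw [chern, h1, leviCivita_apply h hY]
  module

lemma J_bismutTensor (x : M) (u v : TangentSpace I x) :
    J x (bismutTensor J h x u v) = bismutTensor J h x u (J x v) := h.metric.ext fun w => by
  rw [hJ.metric_J_left, hJ.metric_bismutTensor h, hJ.metric_bismutTensor h]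
  simp only [hJ.sq, map_neg, LinearMap.neg_apply]
  have e := nablaG_symm h.cov h.metric x
  have e1 := hJ.nablaG_J h x (J x v) w u
  have e2 := hJ.nablaG_J_left h x u v w
  have e3 := hJ.nablaG_J_left h x v u w
  have e4 := hJ.nablaG_J h x (J x u) v w
  rw [e (J x v) u w, e v w (J x u)]
  linarith

lemma J_chernTensor (x : M) (u v : TangentSpace I x) :
    J x (chernTensor J h x u v) = chernTensor J h x u (J x v) := h.metric.ext fun w => by
  rw [hJ.metric_J_left, hJ.metric_chernTensor h, hJ.metric_chernTensor h, hJ.nablaG_J_left h x u v w,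
    hJ.nablaG_J_left h x (J x u) (J x v) w]
  ring

lemma mdiffAt_bismutTensor {x : M} {X Y : Π y : M, TangentSpace I y}
    (hX : MDiffAt (T% X) x) (hY : MDiffAt (T% Y) x) :
    MDiffAt (T% (fun y => bismutTensor J h y (X y) (Y y))) x := by
  have hJX := hJ.mdiffAt hX
  have hJY := hJ.mdiffAt hY
  have h1 := mdifferentiableAt_sub_section (mdiffAt_nablaGSharp h hJX hJY) (mdiffAt_nablaGSharp h hJY hJX)
  have h2 := mdifferentiableAt_sub_section
    (mdifferentiableAt_add_section (mdiffAt_nablaGSharp h hX hJY) (mdiffAt_nablaGSharp h hJY hX))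
    ((mdiffAt_gam h hX hJY).smul_const_section (a := (2 : ℝ)))
  exact mdifferentiableAt_add_section (mdiffAt_gam h hX hY)
    ((mdifferentiableAt_add_section h1 (hJ.mdiffAt h2)).smul_const_section (a := (1 / 2 : ℝ)))

lemma mdiffAt_chernTensor {x : M} {X Y : Π y : M, TangentSpace I y}
    (hX : MDiffAt (T% X) x) (hY : MDiffAt (T% Y) x) :
    MDiffAt (T% (fun y => chernTensor J h y (X y) (Y y))) x :=
  (mdifferentiableAt_sub_section (mdiffAt_nablaGSharp h hX hY)
    (mdiffAt_nablaGSharp h (hJ.mdiffAt hX) (hJ.mdiffAt hY))).smul_const_section (a := (1 / 2 : ℝ))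

/-- The Ricci form of a connection `∇ + B` commuting with `J` is exact. -/
lemma ricciForm_eq (h : IsAffRiem nabla g)
    {nab' : (Π x : M, TangentSpace I x) → Π x : M, TangentSpace I x → TangentSpace I x}
    {B : Π y : M, TangentSpace I y →ₗ[ℝ] TangentSpace I y →ₗ[ℝ] TangentSpace I y}
    (hnab : ∀ (y : M) (Y : Π z : M, TangentSpace I z), MDiffAt (T% Y) y → ∀ u,
      nab' Y y u = nabla Y y u + B y u (Y y))
    (hB : ∀ (x : M) (X Y : Π z : M, TangentSpace I z), MDiffAt (T% X) x → MDiffAt (T% Y) x →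
      MDiffAt (T% (fun y => B y (X y) (Y y))) x)
    (hcomm : ∀ (x : M) (u v : TangentSpace I x), J x (B x u v) = B x u (J x v))
    (x : M) (u v : TangentSpace I x) :
    ricciForm g J nab' x u v = 1 / 2 * extDerivOne
      (fun y v => LinearMap.trace ℝ _ ((J y).toLinearMap ∘ₗ B y v)) x u v := by
  have := sum_metric_curvature h (K := fun y => (J y).toLinearMap) hnab hB
    (fun x Y hY => hJ.mdiffAt hY) (fun x Y hY u => hJ.parallel x Y hY u) hcomm
    (isParseval_frame h.metric x) u v
  simp only [ContinuousLinearMap.coe_coe, hJ.metric_J_left, Finset.sum_neg_distrib] at this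
  rw [ricciForm, neg_injective this]

/-- The trace form of the Bismut connection is `(2a - s) ∘ J`. -/
lemma trace_J_bismutTensor (x : M) (u : TangentSpace I x) :
    LinearMap.trace ℝ _ ((J x).toLinearMap ∘ₗ bismutTensor J h x u)
      = 2 * aForm h x (J x u) - sForm h x (J x u) := by
  have hf := isParseval_frame h.metric x
  have hi : ∀ i, g x ((J x).toLinearMap (bismutTensor J h x u (frame g x i))) (frame g x i)
      = nablaG h.cov g x (frame g x i) (frame g x i) (J x u)
        + nablaG h.cov g x (J x (frame g x i)) (J x (frame g x i)) (J x u)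
        - 1 / 2 * nablaG h.cov g x (J x u) (frame g x i) (frame g x i) := fun i => by
    have e := nablaG_symm h.cov h.metric x
    have e1 := hJ.nablaG_J_left h x u (frame g x i) (frame g x i)
    have e2 := hJ.nablaG_J_left h x (frame g x i) (frame g x i) u
    have e3 := hJ.nablaG_J h x (J x (frame g x i)) (frame g x i) u
    rw [e u] at e1
    rw [e _ _ u] at e2 e3
    rw [ContinuousLinearMap.coe_coe, hJ.metric_J_left, hJ.metric_bismutTensor h]
    simp only [hJ.sq, map_neg, LinearMap.neg_apply]
    linarith
  rw [hf.trace]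
  simp only [LinearMap.comp_apply]
  rw [Finset.sum_congr rfl fun i _ => hi i, Finset.sum_sub_distrib, Finset.sum_add_distrib,
    ← hf.aForm h, ← (hJ.isParseval hf).aForm h, ← Finset.mul_sum, ← hf.two_sForm h]
  ring

/-- The trace form of the Chern connection is `s ∘ J`. -/
lemma trace_J_chernTensor (x : M) (u : TangentSpace I x) :
    LinearMap.trace ℝ _ ((J x).toLinearMap ∘ₗ chernTensor J h x u) = sForm h x (J x u) := by
  have hf := isParseval_frame h.metric x
  have hi : ∀ i, g x ((J x).toLinearMap (chernTensor J h x u (frame g x i))) (frame g x i)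
      = 1 / 2 * nablaG h.cov g x (J x u) (frame g x i) (frame g x i) := fun i => by
    have e1 := hJ.nablaG_J_left h x u (frame g x i) (frame g x i)
    have e2 := hJ.nablaG_J h x (J x u) (frame g x i) (frame g x i)
    rw [nablaG_symm h.cov h.metric x u] at e1
    rw [ContinuousLinearMap.coe_coe, hJ.metric_J_left, hJ.metric_chernTensor h]
    linarith
  rw [hf.trace]
  simp only [LinearMap.comp_apply]
  rw [Finset.sum_congr rfl fun i _ => hi i, ← Finset.mul_sum, ← hf.two_sForm h]
  ring

end IsParallelHermitian
end ParallelHermitian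

section LocalFormulas

variable {E : Type*} [NormedAddCommGroup E] [NormedSpace ℝ E] [FiniteDimensional ℝ E]
  {H : Type*} [TopologicalSpace H] {I : ModelWithCorners ℝ E H}
  {M : Type*} [TopologicalSpace M] [ChartedSpace H M] [IsManifold I ∞ M]
  {F : Type*} [NormedAddCommGroup F] [NormedSpace ℝ F]
  {nabla : (Π x : M, TangentSpace I x) → Π x : M, TangentSpace I x →L[ℝ] TangentSpace I x}
  {g : Π x : M, TangentSpace I x →L[ℝ] TangentSpace I x →L[ℝ] ℝ}

/-! ### Brackets, curvature and smoothness in coordinates -/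

lemma mvfderiv_const_apply (c : F) (x : M) (u : TangentSpace I x) :
    mvfderiv I (fun _ : M => c) x u = 0 := by
  rw [mvfderiv_of_eventually_const c (Eventually.of_forall fun _ => rfl)]
  rfl

/-- `[X, Y] f = X (Y f) - Y (X f)` for functions with values in a vector space. -/
lemma mvfderiv_mlieBracket_vec {f : M → F} {X Y : Π y : M, TangentSpace I y} {x : M}
    (hf : ContMDiffAt I 𝓘(ℝ, F) ∞ f x) (hX : CMDiffAt ∞ (T% X) x) (hY : CMDiffAt ∞ (T% Y) x) :
    mvfderiv I f x (VectorField.mlieBracket I X Y x)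
      = mvfderiv I (fun y => mvfderiv I f y (Y y)) x (X x)
        - mvfderiv I (fun y => mvfderiv I f y (X y)) x (Y x) := by
  rw [SeparatingDual.eq_iff_forall_dual_eq (R := ℝ)]
  intro φ
  have hφ : ContMDiffAt I 𝓘(ℝ, ℝ) ∞ (fun y => φ (f y)) x :=
    φ.contDiff.contMDiff.contMDiffAt.comp x hf
  have h1 := mvfderiv_mlieBracket hφ hX hY
  have hd := hf.mdifferentiableAt (by simp)
  have h2 : ∀ {V : Π y : M, TangentSpace I y}, CMDiffAt ∞ (T% V) x → ∀ u : TangentSpace I x,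
      mvfderiv I (fun y => mvfderiv I (fun y => φ (f y)) y (V y)) x u
        = φ (mvfderiv I (fun y => mvfderiv I f y (V y)) x u) := fun {V} hV u => by
    rw [← mvfderiv_clm_comp φ ((contMDiffAt_mvfderiv_apply hf hV).mdifferentiableAt (by simp))]
    refine congrArg (fun L : TangentSpace I x →L[ℝ] ℝ => L u) (mvfderiv_congr ?_)
    filter_upwards [eventually_mdiffAt hf] with y hy using mvfderiv_clm_comp φ hy _
  rw [mvfderiv_clm_comp φ hd, h2 hY, h2 hX] at h1
  rw [h1, map_sub]

/-- The coordinates of a Lie bracket. -/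
lemma tcoord_mlieBracket {x : M} {X Y : Π y : M, TangentSpace I y}
    (hX : CMDiffAt ∞ (T% X) x) (hY : CMDiffAt ∞ (T% Y) x) :
    tcoord I x x (VectorField.mlieBracket I X Y x)
      = mvfderiv I (fun y => tcoord I x y (Y y)) x (X x)
        - mvfderiv I (fun y => tcoord I x y (X y)) x (Y x) := by
  have hx := mem_chart_source H x
  have e : ∀ V : Π y : M, TangentSpace I y, (fun y => mvfderiv I (extChartAt I x) y (V y)) =ᶠ[𝓝 x]
      fun y => tcoord I x y (V y) := fun V => by
    filter_upwards [eventually_mem_chart (H := H) x] with y hy using (tcoord_eq_mfderiv hy _).symm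
  rw [tcoord_eq_mfderiv hx, mvfderiv_mlieBracket_vec (contMDiffAt_extChartAt' hx) hX hY,
    mvfderiv_congr (e X), mvfderiv_congr (e Y)]

lemma mvfderiv_tcoord_extend {x : M} (v : TangentSpace I x) :
    mvfderiv I (fun y => tcoord I x y (FiberBundle.extend E v y)) x = 0 := by
  refine mvfderiv_of_eventually_const (tcoord I x x v) ?_
  filter_upwards [eventually_mem_chart (H := H) x] with y hy
  rw [extend_eq_cfield hy, tcoord_self]
  exact tcoord_tlift hy _

lemma mlieBracket_extend (x : M) (u v : TangentSpace I x) :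
    VectorField.mlieBracket I (FiberBundle.extend E u : Π y : M, TangentSpace I y)
      (FiberBundle.extend E v) x = 0 := by
  have h := tcoord_mlieBracket (cmdiffAt_extend (n := ⊤) u) (cmdiffAt_extend (n := ⊤) v)
  rw [mvfderiv_tcoord_extend, mvfderiv_tcoord_extend, zero_apply, zero_apply, sub_zero] at h
  rw [← tlift_tcoord (mem_chart_source H x) (VectorField.mlieBracket I _ _ x), h, map_zero]

/-- Christoffel symbols of a torsion-free connection are symmetric. -/
lemma christ_symm (hcov : IsCovariantDerivativeOn E nabla univ) (htf : IsTorsionFree nabla) (x : M)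
    (e b : E) : christ hcov x x e b = christ hcov x x b e := by
  have h1 := htf x _ _ (mdiffAt_extend (tlift I x x b)) (mdiffAt_extend (tlift I x x e))
  have hx := mem_chart_source H x
  rw [mlieBracket_extend] at h1
  have h2 := congrArg (tcoord I x x) h1
  rw [map_sub, tcoord_nabla hcov hx (mdiffAt_extend _), tcoord_nabla hcov hx (mdiffAt_extend _),
    mvfderiv_tcoord_extend, mvfderiv_tcoord_extend, map_zero] at h2
  simp only [FiberBundle.extend_apply_self, tcoord_tlift hx, zero_apply, zero_add] at h2
  exact sub_eq_zero.1 h2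

/-- Flatness in coordinates. -/
lemma christ_flat (h : IsAffRiem nabla g) (x : M) (e : E) (u v : TangentSpace I x) :
    mvfderiv I (christ h.cov x) x u e (tcoord I x x v)
        + christ h.cov x x (christ h.cov x x e (tcoord I x x v)) (tcoord I x x u)
      = mvfderiv I (christ h.cov x) x v e (tcoord I x x u)
        + christ h.cov x x (christ h.cov x x e (tcoord I x x u)) (tcoord I x x v) := by
  have hx := mem_chart_source H x
  have hΓ := (contMDiffAt_christ h.cov h.smooth hx).mdifferentiableAt (by simp)
  have hflat := h.flat x u v (tlift I x x e)
  simp only [curvature, mlieBracket_extend, map_zero, zero_sub] at hflat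
  have key : ∀ a b : TangentSpace I x, tcoord I x x (nabla (fun y =>
      nabla (FiberBundle.extend E (tlift I x x e)) y (FiberBundle.extend E b y)) x a)
      = mvfderiv I (christ h.cov x) x a e (tcoord I x x b)
        + christ h.cov x x (christ h.cov x x e (tcoord I x x b)) (tcoord I x x a) := fun a b => by
    have hd := (cmdiffAt_nabla_extend h (tlift I x x e) (cmdiffAt_extend b)).mdifferentiableAt
      (by simp)
    have e1 : (fun y => tcoord I x y (nabla (FiberBundle.extend E (tlift I x x e)) y
        (FiberBundle.extend E b y))) =ᶠ[𝓝 x] fun y => christ h.cov x y e (tcoord I x x b) := by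
      filter_upwards [eventually_mem_chart (H := H) x] with y hy
      have hs : (fun z => (FiberBundle.extend E (tlift I x x e) : Π z : M, TangentSpace I z) z)
          =ᶠ[𝓝 y] cfield I x e := by
        filter_upwards [(chartAt H x).open_source.mem_nhds hy] with z hz
        rw [extend_eq_cfield hz, tlift_self]
      have := nabla_congr h.cov (mdiffAt_cfield hy e) hs.symm
      rw [christ_apply h.cov hy, this, extend_eq_cfield hy, tcoord_self]
      rfl
    rw [tcoord_nabla h.cov hx hd, mvfderiv_congr e1, e1.eq_of_nhds,
      mvfderiv_clm_apply₂ hΓ mdifferentiableAt_const mdifferentiableAt_const,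
      mvfderiv_const_apply, mvfderiv_const_apply]
    simp
  have h1 := congrArg (tcoord I x x) hflat
  rw [map_add, map_neg, key u v, key v u, map_zero, neg_add_eq_zero] at h1
  exact h1

/-- The exterior derivative of a 1-form in coordinates. -/
lemma extDerivOne_eq (η : Π x : M, TangentSpace I x →ₗ[ℝ] ℝ) {x : M}
    (hη : ∀ X : Π y : M, TangentSpace I y, MDiffAt (T% X) x →
      MDifferentiableAt I 𝓘(ℝ, ℝ) (fun y => η y (X y)) x) :
    ∃ N : M → E →L[ℝ] ℝ, MDifferentiableAt I 𝓘(ℝ, E →L[ℝ] ℝ) N x ∧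
      (∀ y ∈ (chartAt H x).source, ∀ v, η y v = N y (tcoord I x y v)) ∧
      ∀ u v, extDerivOne (fun y v => η y v) x u v
        = mvfderiv I N x u (tcoord I x x v) - mvfderiv I N x v (tcoord I x x u) := by
  have hx := mem_chart_source H x
  let N : M → E →L[ℝ] ℝ := fun y => LinearMap.toContinuousLinearMap
    ((η y).comp (tlift I x y).toLinearMap)
  have hN : MDifferentiableAt I 𝓘(ℝ, E →L[ℝ] ℝ) N x := mdiffAt_clm_of_apply fun e =>
    hη _ (mdiffAt_cfield hx e)
  have hNη : ∀ y ∈ (chartAt H x).source, ∀ v, η y v = N y (tcoord I x y v) := fun y hy v => by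
    change _ = η y (tlift I x y (tcoord I x y v))
    rw [tlift_tcoord hy]
  refine ⟨N, hN, hNη, fun u v => ?_⟩
  have key : ∀ a b : TangentSpace I x, mvfderiv I (fun y => η y (FiberBundle.extend E b y)) x a
      = mvfderiv I N x a (tcoord I x x b) := fun a b => by
    have e1 : (fun y => η y (FiberBundle.extend E b y)) =ᶠ[𝓝 x] fun y => N y (tcoord I x x b) := by
      filter_upwards [eventually_mem_chart (H := H) x] with y hy
      rw [hNη y hy, extend_eq_cfield hy, tcoord_self]
      exact congrArg (N y) (tcoord_tlift hy _)
    rw [mvfderiv_congr e1, mvfderiv_clm_apply hN mdifferentiableAt_const, mvfderiv_const_apply,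
      map_zero, add_zero]
  simp only [extDerivOne]
  rw [key, key, mlieBracket_extend, map_zero, sub_zero]

/-- A field of endomorphisms is smooth if its values on fields with constant coordinates are. -/
lemma contMDiffAt_end_of_cfield {L : Π y : M, TangentSpace I y →L[ℝ] TangentSpace I y} {x : M}
    (hL : ∀ e, CMDiffAt ∞ (T% (fun y => L y (cfield I x e y))) x) :
    ContMDiffAt I (I.prod 𝓘(ℝ, E →L[ℝ] E)) ∞
      (fun x => TotalSpace.mk' (E →L[ℝ] E)
        (E := fun x : M => TangentSpace I x →L[ℝ] TangentSpace I x) x (L x)) x := by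
  rw [contMDiffAt_hom_bundle]
  exact ⟨contMDiffAt_id, contMDiffAt_clm_of_apply (n := ⊤) fun e =>
    (cmdiffAt_iff_tcoord (n := ⊤) (mem_chart_source H x)).1 (hL e)⟩

/-- A field of bilinear forms is smooth if its values on fields with constant coordinates are. -/
lemma contMDiffAt_bilin_of_cfield {x : M}
    (hg : ∀ e e', ContMDiffAt I 𝓘(ℝ, ℝ) ∞ (fun y => g y (cfield I x e y) (cfield I x e' y)) x) :
    ContMDiffAt I (I.prod 𝓘(ℝ, E →L[ℝ] E →L[ℝ] ℝ)) ∞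
      (fun x => TotalSpace.mk' (E →L[ℝ] E →L[ℝ] ℝ)
        (E := fun x : M => TangentSpace I x →L[ℝ] TangentSpace I x →L[ℝ] ℝ) x (g x)) x := by
  rw [contMDiffAt_hom_bundle]
  refine ⟨contMDiffAt_id, contMDiffAt_clm_of_apply (n := ⊤) fun e =>
    contMDiffAt_clm_of_apply (n := ⊤) fun e' => ?_⟩
  refine (hg e e').congr_of_eventuallyEq ?_
  filter_upwards [eventually_mem_chart (H := H) x] with y hy
  rw [inCoordinates_apply_eq₂ hy hy (mem_univ _)]
  simp only [Trivial.fiberBundle_trivializationAt', Trivial.linearMapAt_trivialization,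
    LinearMap.id_coe, id_eq, cfield, tlift,
    Trivialization.symmL_apply (R := ℝ) (trivializationAt E (TangentSpace I) x) hy]

end LocalFormulas

namespace ConnMetricManifold

section TangentCoordinates

variable (A : ConnMetricManifold.{u, v})

/-! ### Coordinates on the tangent bundle -/

/-- The fibre coordinates of a tangent vector in the preferred chart at `x`. -/
def fibre (x : A.M) (q : TangentBundle A.I A.M) : A.E := tcoord A.I x q.proj q.snd

lemma mem_chart_source_tangent {p q : TangentBundle A.I A.M} :
    q ∈ (chartAt (ModelProd A.H A.E) p).source ↔ q.proj ∈ (chartAt A.H p.proj).source :=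
  TangentBundle.mem_chart_source_iff ..

lemma extChartAt_tangent {p q : TangentBundle A.I A.M}
    (hq : q.proj ∈ (chartAt A.H p.proj).source) :
    extChartAt A.I.tangent p q = (extChartAt A.I p.proj q.proj, A.fibre p.proj q) := by
  have h1 : ((trivializationAt A.E (TangentSpace A.I) p.proj) q).2 = A.fibre p.proj q := by
    rw [fibre, tcoord, Trivialization.continuousLinearMapAt_apply,
      Trivialization.coe_linearMapAt_of_mem _ hq]
  have h2 : extChartAt A.I.tangent p = extChartAt (A.I.prod 𝓘(ℝ, A.E)) p := rfl
  rw [h2, FiberBundle.extChartAt]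
  simp only [PartialEquiv.coe_trans, Function.comp_apply, PartialEquiv.prod_coe]
  exact Prod.ext rfl h1

lemma contMDiff_proj : ContMDiff A.I.tangent A.I ∞ (fun q : TangentBundle A.I A.M => q.proj) :=
  Bundle.contMDiff_proj (TangentSpace A.I)

lemma contMDiffAt_fibre {x : A.M} {q : TangentBundle A.I A.M} (hq : q.proj ∈ (chartAt A.H x).source) :
    ContMDiffAt A.I.tangent 𝓘(ℝ, A.E) ∞ (A.fibre x) q := by
  let p : TangentBundle A.I A.M := ⟨x, 0⟩
  have h1 : ContMDiffAt A.I.tangent 𝓘(ℝ, A.E × A.E) ∞ (extChartAt A.I.tangent p) q :=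
    contMDiffAt_extChartAt' (A.mem_chart_source_tangent.2 hq)
  have h2 : ContMDiffAt A.I.tangent 𝓘(ℝ, A.E) ∞ (fun q => (extChartAt A.I.tangent p q).2) q :=
    (ContinuousLinearMap.snd ℝ A.E A.E).contDiff.contMDiff.contMDiffAt.comp q h1
  refine h2.congr_of_eventuallyEq ?_
  filter_upwards [A.contMDiff_proj.continuous.continuousAt.eventually
    ((chartAt A.H x).open_source.mem_nhds hq)] with r hr
  rw [A.extChartAt_tangent (p := p) hr]

lemma eventually_proj_mem {x : A.M} {p : TangentBundle A.I A.M}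
    (hp : p.proj ∈ (chartAt A.H x).source) : ∀ᶠ q in 𝓝 p, q.proj ∈ (chartAt A.H x).source :=
  (A.contMDiff_proj.continuous.continuousAt (x := p)).eventually
    ((chartAt A.H x).open_source.mem_nhds hp)

/-- Tangent vectors of `TM` in coordinates. -/
lemma tcoord_tangent {p q : TangentBundle A.I A.M} (hq : q.proj ∈ (chartAt A.H p.proj).source)
    (w : TangentSpace A.I.tangent q) :
    tcoord A.I.tangent p q w
      = (tcoord A.I p.proj q.proj (mfderiv A.I.tangent A.I (fun q => q.proj) q w),
        mvfderiv A.I.tangent (A.fibre p.proj) q w) := by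
  have h1 : MDifferentiableAt A.I.tangent 𝓘(ℝ, A.E × A.E) (extChartAt A.I.tangent p) q :=
    (contMDiffAt_extChartAt' (n := ∞) (A.mem_chart_source_tangent.2 hq)).mdifferentiableAt (by simp)
  have h2 : MDifferentiableAt A.I 𝓘(ℝ, A.E) (extChartAt A.I p.proj) q.proj :=
    (contMDiffAt_extChartAt' (n := ∞) hq).mdifferentiableAt (by simp)
  have h3 := ((A.contMDiff_proj q).mdifferentiableAt (by simp)).hasMFDerivAt
  have h4 := mvfderiv_of_hasMFDerivAt ((hasMFDerivAt_mvfderiv h2).comp q h3)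
  rw [tcoord_eq_mfderiv (A.mem_chart_source_tangent.2 hq), tcoord_eq_mfderiv hq]
  refine Prod.ext ?_ ?_
  · rw [← ContinuousLinearMap.coe_fst' (R := ℝ), ← mvfderiv_clm_comp _ h1]
    refine Eq.trans (congrArg (fun L : TangentSpace A.I.tangent q →L[ℝ] A.E => L w)
      (mvfderiv_congr ?_)) (congrArg (fun L : TangentSpace A.I.tangent q →L[ℝ] A.E => L w) h4)
    filter_upwards [A.eventually_proj_mem hq] with r hr
    rw [A.extChartAt_tangent hr]
    rfl
  · rw [← ContinuousLinearMap.coe_snd' (R := ℝ), ← mvfderiv_clm_comp _ h1]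
    refine congrArg (fun L : TangentSpace A.I.tangent q →L[ℝ] A.E => L w) (mvfderiv_congr ?_)
    filter_upwards [A.eventually_proj_mem hq] with r hr
    rw [A.extChartAt_tangent hr]
    rfl

lemma dproj_eq (q : TangentBundle A.I A.M) (w : TangentSpace A.I.tangent q) :
    A.dproj q w = mfderiv A.I.tangent A.I (fun q : TangentBundle A.I A.M => q.proj) q w := by
  have h := tcoord_tangent A (p := q) (mem_chart_source A.H q.proj) w
  rw [tcoord_self, tcoord_self] at h
  exact congrArg Prod.fst h

end TangentCoordinates
section Lifts

variable {A : ConnMetricManifold.{u, v}}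

/-! ### The connection map and the lifts -/

lemma dproj_hlift (p : TangentBundle A.I A.M) (a : TangentSpace A.I p.proj) :
    A.dproj p (A.hlift p a) = a := by
  exact sub_zero (G := A.E) a

lemma dproj_vlift (p : TangentBundle A.I A.M) (a : TangentSpace A.I p.proj) :
    A.dproj p (A.vlift p a) = 0 := rfl

lemma connMap_vlift (p : TangentBundle A.I A.M) (a : TangentSpace A.I p.proj) :
    A.connMap p (A.vlift p a) = a := by
  have h0 : A.nabla (FiberBundle.extend A.E p.snd) p.proj (A.dproj p (A.vlift p a)) = 0 := by
    rw [dproj_vlift, map_zero]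
  let a' : A.E := a
  exact (congrArg (fun b : A.E => a' + b) h0).trans (add_zero a')

lemma connMap_hlift (p : TangentBundle A.I A.M) (a : TangentSpace A.I p.proj) :
    A.connMap p (A.hlift p a) = 0 := by
  let n : A.E := A.nabla (FiberBundle.extend A.E p.snd) p.proj a
  have h0 : A.nabla (FiberBundle.extend A.E p.snd) p.proj (A.dproj p (A.hlift p a)) = n := by
    rw [dproj_hlift]
  refine (congrArg (fun b : A.E => (0 - n) + b) h0).trans ?_
  change (0 - n) + n = 0
  abel

lemma hlift_add_vlift (p : TangentBundle A.I A.M) (w : TangentSpace A.I.tangent p) :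
    A.hlift p (A.dproj p w) + A.vlift p (A.connMap p w) = w := by
  let n : A.E := A.nabla (FiberBundle.extend A.E p.snd) p.proj (A.dproj p w)
  let a : A.E × A.E := w
  refine Prod.ext ?_ ?_
  · change (a.1 - 0) + 0 = a.1
    abel
  · change (0 - n) + (a.2 + n) = a.2
    abel

/-- A tangent vector of `TM` is determined by its projection and its vertical part. -/
lemma tangent_ext {p : TangentBundle A.I A.M} {w w' : TangentSpace A.I.tangent p}
    (h1 : A.dproj p w = A.dproj p w') (h2 : A.connMap p w = A.connMap p w') : w = w' := by
  rw [← hlift_add_vlift p w, h1, h2, hlift_add_vlift]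

lemma tangentMetric_apply (p : TangentBundle A.I A.M) (w w' : TangentSpace A.I.tangent p) :
    A.tangentMetric p w w' = A.g p.proj (A.dproj p w) (A.dproj p w')
      + A.g p.proj (A.connMap p w) (A.connMap p w') := rfl

lemma dproj_tangentJ (p : TangentBundle A.I A.M) (w : TangentSpace A.I.tangent p) :
    A.dproj p (A.tangentJ p w) = - A.connMap p w := by
  change A.dproj p (A.vlift p (A.dproj p w) - A.hlift p (A.connMap p w)) = _
  rw [map_sub, dproj_vlift, dproj_hlift, zero_sub]

lemma connMap_tangentJ (p : TangentBundle A.I A.M) (w : TangentSpace A.I.tangent p) :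
    A.connMap p (A.tangentJ p w) = A.dproj p w := by
  change A.connMap p (A.vlift p (A.dproj p w) - A.hlift p (A.connMap p w)) = _
  rw [map_sub, connMap_vlift, connMap_hlift, sub_zero]

lemma dproj_tangentNabla (V : Π q : TangentBundle A.I A.M, TangentSpace A.I.tangent q)
    (p : TangentBundle A.I A.M) (w : TangentSpace A.I.tangent p) :
    A.dproj p (A.tangentNabla V p w) = A.pullbackNabla (fun q => A.dproj q (V q)) p w := by
  change A.dproj p (A.hlift p (A.pullbackNabla (fun q => A.dproj q (V q)) p w)
    + A.vlift p (A.pullbackNabla (fun q => A.connMap q (V q)) p w)) = _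
  rw [map_add, dproj_vlift, dproj_hlift, add_zero]

lemma connMap_tangentNabla (V : Π q : TangentBundle A.I A.M, TangentSpace A.I.tangent q)
    (p : TangentBundle A.I A.M) (w : TangentSpace A.I.tangent p) :
    A.connMap p (A.tangentNabla V p w) = A.pullbackNabla (fun q => A.connMap q (V q)) p w := by
  change A.connMap p (A.hlift p (A.pullbackNabla (fun q => A.dproj q (V q)) p w)
    + A.vlift p (A.pullbackNabla (fun q => A.connMap q (V q)) p w)) = _
  rw [map_add, connMap_vlift, connMap_hlift, zero_add]

variable (hcov : IsCovariantDerivativeOn A.E A.nabla univ)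
include hcov

/-- The connection map in the coordinates of the preferred chart at `x`. The definition of `connMap`
uses the chart at `π q`, so this is the transformation law of the Christoffel symbols. -/
lemma tcoord_connMap {x : A.M} {q : TangentBundle A.I A.M} (hq : q.proj ∈ (chartAt A.H x).source)
    (w : TangentSpace A.I.tangent q) :
    tcoord A.I x q.proj (A.connMap q w) = mvfderiv A.I.tangent (A.fibre x) q w
      + christ hcov x q.proj (A.fibre x q) (tcoord A.I x q.proj (A.dproj q w)) := by
  set y := q.proj with hy
  have hyy := mem_chart_source A.H y
  -- the coordinate change of tangent vectors from the chart at `y` to the chart at `x`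
  let T : A.M → A.E →L[ℝ] A.E := fun z => (tcoord A.I x z).comp (tlift A.I y z)
  have hT : MDifferentiableAt A.I 𝓘(ℝ, A.E →L[ℝ] A.E) T y := mdiffAt_clm_of_apply fun e =>
    (mdiffAt_iff_tcoord hq).1 (mdiffAt_cfield hyy e)
  have hproj := ((A.contMDiff_proj q).mdifferentiableAt (by simp)).hasMFDerivAt
  have hTq := (hasMFDerivAt_mvfderiv hT).comp q hproj
  have hfib := (A.contMDiffAt_fibre (x := y) (q := q) hyy).mdifferentiableAt (by simp)
  have e1 : A.fibre x =ᶠ[𝓝 q] fun r => T r.proj (A.fibre y r) := by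
    filter_upwards [A.eventually_proj_mem (p := q) (x := y) hyy] with r hr
    change _ = tcoord A.I x r.proj (tlift A.I y r.proj (tcoord A.I y r.proj r.snd))
    rw [tlift_tcoord hr]
    rfl
  have hTd := hTq.mdifferentiableAt
  have h1 := mvfderiv_clm_apply (B := T ∘ fun r : TangentBundle A.I A.M => r.proj)
    (s := A.fibre y) hTd hfib w
  rw [mvfderiv_of_hasMFDerivAt hTq] at h1
  have h2 : mvfderiv A.I.tangent (A.fibre x) q w
      = mvfderiv A.I T y (A.dproj q w) (A.fibre y q) + T y (mvfderiv A.I.tangent (A.fibre y) q w) := by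
    rw [mvfderiv_congr e1, A.dproj_eq]
    exact h1
  have hsnd : A.fibre y q = q.snd := tcoord_self y q.snd
  have h3 : A.connMap q w = tlift A.I y y (mvfderiv A.I.tangent (A.fibre y) q w)
      + A.nabla (cfield A.I y (A.fibre y q)) y (A.dproj q w) := by
    have := A.tcoord_tangent (p := q) hyy w
    rw [tcoord_self] at this
    have h5 := congrArg Prod.snd this
    have h6 : A.nabla (FiberBundle.extend A.E q.snd) y = A.nabla (cfield A.I y (A.fibre y q)) y := by
      rw [hsnd]
      exact nabla_congr hcov (mdiffAt_extend _) (extend_eventuallyEq_cfield _)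
    rw [tlift_self, ← h6]
    let n : A.E := A.nabla (FiberBundle.extend A.E q.snd) y (A.dproj q w)
    exact congrArg (fun b : A.E => b + n) h5
  have h7 : ∀ e, mvfderiv A.I (fun z => tcoord A.I x z (cfield A.I y e z)) y (A.dproj q w)
      = mvfderiv A.I T y (A.dproj q w) e := fun e => by
    have := mvfderiv_clm_apply hT (mdifferentiableAt_const (c := e)) (A.dproj q w)
    rw [mvfderiv_const_apply, map_zero, add_zero] at this
    exact this
  rw [h3, map_add, tcoord_nabla hcov hq (mdiffAt_cfield hyy _), h7, h2]
  have h8 : tcoord A.I x y (cfield A.I y (A.fibre y q) y) = A.fibre x q := e1.eq_of_nhds.symm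
  rw [h8]
  have h9 : ∀ e, tcoord A.I x y (tlift A.I y y e) = T y e := fun e => rfl
  rw [h9]
  abel

/-- The differentiability of a section of `π^*TM` can be tested in coordinates. -/
lemma mdiffAt_pullback_iff {x : A.M} {p : TangentBundle A.I A.M}
    (hp : p.proj ∈ (chartAt A.H x).source) {s : Π q : TangentBundle A.I A.M, TangentSpace A.I q.proj} :
    MDifferentiableAt A.I.tangent A.I.tangent
        (fun q => (⟨q.proj, s q⟩ : TangentBundle A.I A.M)) p ↔
      MDifferentiableAt A.I.tangent 𝓘(ℝ, A.E) (fun q => tcoord A.I x q.proj (s q)) p := by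
  have : ContMDiffVectorBundle 1 A.E (TangentSpace A.I : A.M → Type _) A.I :=
    ContMDiffVectorBundle.of_le (n := ∞) (mod_cast le_top)
  have hproj := (A.contMDiff_proj p).mdifferentiableAt (by simp)
  have h1 := Trivialization.mdifferentiableAt_totalSpace_iff A.I
    (trivializationAt A.E (TangentSpace A.I) x) (x₀ := p) (IM := A.I.tangent)
    (fun q : TangentBundle A.I A.M => (⟨q.proj, s q⟩ : TangentBundle A.I A.M))
    ((Trivialization.mem_source _).2 hp)
  have e1 : (fun q => tcoord A.I x q.proj (s q)) =ᶠ[𝓝 p] fun q : TangentBundle A.I A.M =>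
      ((trivializationAt A.E (TangentSpace A.I) x) (⟨q.proj, s q⟩ : TangentBundle A.I A.M)).2 := by
    filter_upwards [A.eventually_proj_mem hp] with q hq
    rw [tcoord, Trivialization.continuousLinearMapAt_apply, Trivialization.coe_linearMapAt_of_mem _ hq]
  refine h1.trans ⟨fun h => h.2.congr_of_eventuallyEq e1, fun h => ⟨hproj,
    h.congr_of_eventuallyEq e1.symm⟩⟩

/-- The pullback connection in coordinates. -/
lemma tcoord_pullbackNabla {x : A.M} {p : TangentBundle A.I A.M}
    (hp : p.proj ∈ (chartAt A.H x).source) {s : Π q : TangentBundle A.I A.M, TangentSpace A.I q.proj}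
    (hs : MDifferentiableAt A.I.tangent 𝓘(ℝ, A.E) (fun q => tcoord A.I x q.proj (s q)) p)
    (w : TangentSpace A.I.tangent p) :
    tcoord A.I x p.proj (A.pullbackNabla s p w)
      = mvfderiv A.I.tangent (fun q => tcoord A.I x q.proj (s q)) p w
        + christ hcov x p.proj (tcoord A.I x p.proj (s p)) (tcoord A.I x p.proj (A.dproj p w)) := by
  let f : TangentBundle A.I A.M → TangentBundle A.I A.M := fun q => ⟨q.proj, s q⟩
  have hf : MDifferentiableAt A.I.tangent A.I.tangent f p :=
    (mdiffAt_pullback_iff hcov hp).2 hs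
  have hfp : (f p).proj ∈ (chartAt A.H x).source := hp
  have hfib := (A.contMDiffAt_fibre hfp).mdifferentiableAt (by simp)
  have h1 := mvfderiv_of_hasMFDerivAt ((hasMFDerivAt_mvfderiv hfib).comp p hf.hasMFDerivAt)
  have hproj := ((A.contMDiff_proj (f p)).mdifferentiableAt (by simp)).hasMFDerivAt
  have h2 : mfderiv A.I.tangent A.I (fun q : TangentBundle A.I A.M => q.proj) p
      = (mfderiv A.I.tangent A.I (fun q : TangentBundle A.I A.M => q.proj) (f p)).comp
        (mfderiv A.I.tangent A.I.tangent f p) := (hproj.comp p hf.hasMFDerivAt).mfderiv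
  have h3 := tcoord_connMap hcov hfp (mfderiv A.I.tangent A.I.tangent f p w)
  rw [A.dproj_eq] at h3 ⊢
  rw [h2]
  refine h3.trans (congrArg₂ (· + ·) ?_ rfl)
  exact congrArg (fun L : TangentSpace A.I.tangent p →L[ℝ] A.E => L w) h1.symm

end Lifts
end ConnMetricManifold

section TcoordInj

variable {E : Type*} [NormedAddCommGroup E] [NormedSpace ℝ E]
  {H : Type*} [TopologicalSpace H] {I : ModelWithCorners ℝ E H}
  {M : Type*} [TopologicalSpace M] [ChartedSpace H M] [IsManifold I ∞ M]

lemma tcoord_injective {x y : M} (hy : y ∈ (chartAt H x).source) :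
    Function.Injective (tcoord I x y) := fun v w hvw => by
  rw [← tlift_tcoord hy v, hvw, tlift_tcoord hy]

end TcoordInj

namespace ConnMetricManifold

section PullbackConnection

variable {A : ConnMetricManifold.{u, v}}

/-! ### The pullback connection -/

/-- Differentiability at `p` of a section of `π^*TM`, in coordinates. -/
def MDiffAlong (s : Π q : TangentBundle A.I A.M, TangentSpace A.I q.proj) (p : TangentBundle A.I A.M) :
    Prop :=
  MDifferentiableAt A.I.tangent 𝓘(ℝ, A.E) (fun q => tcoord A.I p.proj q.proj (s q)) p

/-- Smoothness at `p` of a section of `π^*TM`, in coordinates. -/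
def SmoothAlong (s : Π q : TangentBundle A.I A.M, TangentSpace A.I q.proj) (p : TangentBundle A.I A.M) :
    Prop :=
  ContMDiffAt A.I.tangent 𝓘(ℝ, A.E) ∞ (fun q => tcoord A.I p.proj q.proj (s q)) p

lemma SmoothAlong.mdiffAlong {s : Π q : TangentBundle A.I A.M, TangentSpace A.I q.proj}
    {p : TangentBundle A.I A.M} (hs : SmoothAlong s p) : MDiffAlong s p :=
  hs.mdifferentiableAt (by simp)

variable (A) in
lemma tcoord_tangent' {p q : TangentBundle A.I A.M} (hq : q.proj ∈ (chartAt A.H p.proj).source)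
    (w : TangentSpace A.I.tangent q) :
    tcoord A.I.tangent p q w = (tcoord A.I p.proj q.proj (A.dproj q w),
      mvfderiv A.I.tangent (A.fibre p.proj) q w) := by
  rw [A.tcoord_tangent hq, A.dproj_eq]

lemma eventually_proj_mem_self (p : TangentBundle A.I A.M) :
    ∀ᶠ q in 𝓝 p, q.proj ∈ (chartAt A.H p.proj).source :=
  A.eventually_proj_mem (mem_chart_source _ _)

lemma tcoord_fst_eventuallyEq (p : TangentBundle A.I A.M)
    (V : Π q : TangentBundle A.I A.M, TangentSpace A.I.tangent q) :
    (fun q => tcoord A.I p.proj q.proj (A.dproj q (V q))) =ᶠ[𝓝 p]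
      fun q => ContinuousLinearMap.fst ℝ A.E A.E (tcoord A.I.tangent p q (V q)) := by
  filter_upwards [eventually_proj_mem_self p] with q hq
  rw [A.tcoord_tangent' hq]
  rfl

lemma tcoord_snd_eventuallyEq (p : TangentBundle A.I A.M)
    (V : Π q : TangentBundle A.I A.M, TangentSpace A.I.tangent q) :
    (fun q => mvfderiv A.I.tangent (A.fibre p.proj) q (V q)) =ᶠ[𝓝 p]
      fun q => ContinuousLinearMap.snd ℝ A.E A.E (tcoord A.I.tangent p q (V q)) := by
  filter_upwards [eventually_proj_mem_self p] with q hq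
  rw [A.tcoord_tangent' hq]
  rfl

section Fields

variable {p : TangentBundle A.I A.M} {V : Π q : TangentBundle A.I A.M, TangentSpace A.I.tangent q}

lemma mdiffAlong_dproj (hV : MDiffAt (T% V) p) : MDiffAlong (fun q => A.dproj q (V q)) p := by
  rw [mdiffAt_iff_tcoord (mem_chart_source _ p)] at hV
  exact ((ContinuousLinearMap.fst ℝ A.E A.E).differentiableAt.comp_mdifferentiableAt
    hV).congr_of_eventuallyEq (tcoord_fst_eventuallyEq p V)

lemma smoothAlong_dproj (hV : CMDiffAt ∞ (T% V) p) : SmoothAlong (fun q => A.dproj q (V q)) p := by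
  have hV' := (cmdiffAt_iff_tcoord (n := ⊤) (mem_chart_source _ p)).1 hV
  exact ((ContinuousLinearMap.fst ℝ A.E A.E).contDiff.contMDiff.contMDiffAt.comp p
    hV').congr_of_eventuallyEq (tcoord_fst_eventuallyEq p V)

lemma mdiffAt_mvfderiv_fibre (hV : MDiffAt (T% V) p) : MDifferentiableAt A.I.tangent 𝓘(ℝ, A.E)
    (fun q => mvfderiv A.I.tangent (A.fibre p.proj) q (V q)) p := by
  rw [mdiffAt_iff_tcoord (mem_chart_source _ p)] at hV
  exact ((ContinuousLinearMap.snd ℝ A.E A.E).differentiableAt.comp_mdifferentiableAt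
    hV).congr_of_eventuallyEq (tcoord_snd_eventuallyEq p V)

lemma smoothAt_mvfderiv_fibre (hV : CMDiffAt ∞ (T% V) p) : ContMDiffAt A.I.tangent 𝓘(ℝ, A.E) ∞
    (fun q => mvfderiv A.I.tangent (A.fibre p.proj) q (V q)) p := by
  have hV' := (cmdiffAt_iff_tcoord (n := ⊤) (mem_chart_source _ p)).1 hV
  exact ((ContinuousLinearMap.snd ℝ A.E A.E).contDiff.contMDiff.contMDiffAt.comp p
    hV').congr_of_eventuallyEq (tcoord_snd_eventuallyEq p V)

end Fields

/-- The derivative of a function pulled back from `M`. -/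
lemma mvfderiv_comp_proj {F : Type*} [NormedAddCommGroup F] [NormedSpace ℝ F] {f : A.M → F}
    {p : TangentBundle A.I A.M} (hf : MDifferentiableAt A.I 𝓘(ℝ, F) f p.proj) :
    MDifferentiableAt A.I.tangent 𝓘(ℝ, F) (fun q : TangentBundle A.I A.M => f q.proj) p ∧
    ∀ w, mvfderiv A.I.tangent (fun q : TangentBundle A.I A.M => f q.proj) p w
      = mvfderiv A.I f p.proj (A.dproj p w) := by
  have h := (hasMFDerivAt_mvfderiv hf).comp p
    ((A.contMDiff_proj p).mdifferentiableAt (by simp)).hasMFDerivAt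
  refine ⟨h.mdifferentiableAt, fun w => ?_⟩
  have := mvfderiv_of_hasMFDerivAt h
  rw [A.dproj_eq]
  exact congrArg (fun L : TangentSpace A.I.tangent p →L[ℝ] F => L w) this

lemma contMDiffAt_comp_proj {F : Type*} [NormedAddCommGroup F] [NormedSpace ℝ F] {f : A.M → F}
    {p : TangentBundle A.I A.M} (hf : ContMDiffAt A.I 𝓘(ℝ, F) ∞ f p.proj) :
    ContMDiffAt A.I.tangent 𝓘(ℝ, F) ∞ (fun q : TangentBundle A.I A.M => f q.proj) p :=
  hf.comp p (A.contMDiff_proj p)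

variable (h : IsAffRiem A.nabla A.g)

/-- The Christoffel symbols in the preferred chart at `π p`, as a function on `TM`. -/
def christPull (h : IsAffRiem A.nabla A.g) (p q : TangentBundle A.I A.M) : A.E →L[ℝ] A.E →L[ℝ] A.E :=
  christ h.cov p.proj q.proj

lemma contMDiffAt_christPull (p : TangentBundle A.I A.M) :
    ContMDiffAt A.I.tangent 𝓘(ℝ, A.E →L[ℝ] A.E →L[ℝ] A.E) ∞ (christPull h p) p :=
  contMDiffAt_comp_proj (contMDiffAt_christ h.cov h.smooth (mem_chart_source _ _))

lemma mdiffAt_christPull (p : TangentBundle A.I A.M) :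
    MDifferentiableAt A.I.tangent 𝓘(ℝ, A.E →L[ℝ] A.E →L[ℝ] A.E) (christPull h p) p :=
  (contMDiffAt_christPull h p).mdifferentiableAt (by simp)

lemma connMap_eventuallyEq (p : TangentBundle A.I A.M)
    (V : Π q : TangentBundle A.I A.M, TangentSpace A.I.tangent q) :
    (fun q => tcoord A.I p.proj q.proj (A.connMap q (V q))) =ᶠ[𝓝 p] fun q =>
      mvfderiv A.I.tangent (A.fibre p.proj) q (V q) + christPull h p q (A.fibre p.proj q)
        (tcoord A.I p.proj q.proj (A.dproj q (V q))) := by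
  filter_upwards [eventually_proj_mem_self p] with q hq using tcoord_connMap h.cov hq _

lemma contMDiffAt_fibre_self (p : TangentBundle A.I A.M) :
    ContMDiffAt A.I.tangent 𝓘(ℝ, A.E) ∞ (A.fibre p.proj) p :=
  A.contMDiffAt_fibre (mem_chart_source _ _)

section Fields

variable {p : TangentBundle A.I A.M} {V : Π q : TangentBundle A.I A.M, TangentSpace A.I.tangent q}

include h in
lemma mdiffAlong_connMap (hV : MDiffAt (T% V) p) : MDiffAlong (fun q => A.connMap q (V q)) p :=
  ((mdiffAt_mvfderiv_fibre hV).add (((mdiffAt_christPull h p).clm_apply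
    ((contMDiffAt_fibre_self p).mdifferentiableAt (by simp))).clm_apply
      (mdiffAlong_dproj hV))).congr_of_eventuallyEq (connMap_eventuallyEq h p V)

include h in
lemma smoothAlong_connMap (hV : CMDiffAt ∞ (T% V) p) : SmoothAlong (fun q => A.connMap q (V q)) p :=
  ((smoothAt_mvfderiv_fibre hV).add (((contMDiffAt_christPull h p).clm_apply
    (contMDiffAt_fibre_self p)).clm_apply
      (smoothAlong_dproj hV))).congr_of_eventuallyEq (connMap_eventuallyEq h p V)

include h in
/-- A vector field on `TM` is smooth if its two components are. -/
lemma cmdiffAt_of_smoothAlong (h1 : SmoothAlong (fun q => A.dproj q (V q)) p)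
    (h2 : SmoothAlong (fun q => A.connMap q (V q)) p) : CMDiffAt ∞ (T% V) p := by
  refine (cmdiffAt_iff_tcoord (n := ⊤) (mem_chart_source _ p)).2 ?_
  have h3 := h2.sub (((contMDiffAt_christPull h p).clm_apply (contMDiffAt_fibre_self p)).clm_apply h1)
  refine (h1.prodMk_space h3).congr_of_eventuallyEq ?_
  filter_upwards [eventually_proj_mem_self p, connMap_eventuallyEq h p V] with q hq hq'
  rw [A.tcoord_tangent' hq]
  refine Prod.ext rfl ?_
  simp only [hq']
  abel

end Fields

section Sections

variable {p : TangentBundle A.I A.M} {s s' : Π q : TangentBundle A.I A.M, TangentSpace A.I q.proj}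

/-- The pullback connection in the preferred chart. -/
lemma tcoord_pullbackNabla_self (hs : MDiffAlong s p) (w : TangentSpace A.I.tangent p) :
    tcoord A.I p.proj p.proj (A.pullbackNabla s p w)
      = mvfderiv A.I.tangent (fun q => tcoord A.I p.proj q.proj (s q)) p w
        + christ h.cov p.proj p.proj (tcoord A.I p.proj p.proj (s p))
          (tcoord A.I p.proj p.proj (A.dproj p w)) :=
  tcoord_pullbackNabla h.cov (mem_chart_source _ _) hs w

include h in
lemma pullbackNabla_add (hs : MDiffAlong s p) (hs' : MDiffAlong s' p) (w : TangentSpace A.I.tangent p) :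
    A.pullbackNabla (fun q => s q + s' q) p w
      = A.pullbackNabla s p w + A.pullbackNabla s' p w := by
  have e : (fun q => tcoord A.I p.proj q.proj (s q + s' q))
      = fun q => tcoord A.I p.proj q.proj (s q) + tcoord A.I p.proj q.proj (s' q) := by
    funext q; rw [map_add]
  have hss : MDiffAlong (fun q => s q + s' q) p := by
    unfold MDiffAlong; rw [e]; exact hs.add hs'
  refine tcoord_injective (mem_chart_source A.H p.proj) ?_
  rw [map_add, tcoord_pullbackNabla_self h hss, tcoord_pullbackNabla_self h hs,
    tcoord_pullbackNabla_self h hs', e, mvfderiv_fun_add hs hs']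
  simp only [map_add, add_apply]
  abel

include h in
lemma pullbackNabla_smul {f : TangentBundle A.I A.M → ℝ}
    (hf : MDifferentiableAt A.I.tangent 𝓘(ℝ, ℝ) f p) (hs : MDiffAlong s p)
    (w : TangentSpace A.I.tangent p) :
    A.pullbackNabla (fun q => f q • s q) p w
      = f p • A.pullbackNabla s p w + mvfderiv A.I.tangent f p w • s p := by
  have e : (fun q => tcoord A.I p.proj q.proj (f q • s q))
      = fun q => f q • tcoord A.I p.proj q.proj (s q) := by
    funext q; rw [map_smul]
  have hss : MDiffAlong (fun q => f q • s q) p := by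
    unfold MDiffAlong; rw [e]; exact hf.smul hs
  refine tcoord_injective (mem_chart_source A.H p.proj) ?_
  rw [map_add, map_smul, map_smul, tcoord_pullbackNabla_self h hss, tcoord_pullbackNabla_self h hs, e,
    mvfderiv_fun_smul hf hs]
  simp only [map_smul, add_apply, smul_apply, ContinuousLinearMap.smulRight_apply, smul_add]
  abel

include h in
lemma pullbackNabla_neg (hs : MDiffAlong s p) (w : TangentSpace A.I.tangent p) :
    A.pullbackNabla (fun q => - s q) p w = - A.pullbackNabla s p w := by
  have := pullbackNabla_smul h (f := fun _ => (-1 : ℝ)) mdifferentiableAt_const hs w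
  rw [mvfderiv_const_apply] at this
  simpa using this

/-- `w⟨s, s'⟩` for sections of `π^*TM`. -/
lemma mvfderiv_metric_along (hs : MDiffAlong s p) (hs' : MDiffAlong s' p)
    (w : TangentSpace A.I.tangent p) :
    MDifferentiableAt A.I.tangent 𝓘(ℝ, ℝ) (fun q => A.g q.proj (s q) (s' q)) p ∧
    mvfderiv A.I.tangent (fun q => A.g q.proj (s q) (s' q)) p w
      = nablaG h.cov A.g p.proj (A.dproj p w) (s p) (s' p)
        + A.g p.proj (A.pullbackNabla s p w) (s' p) + A.g p.proj (s p) (A.pullbackNabla s' p w) := by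
  have hx := mem_chart_source A.H p.proj
  have hG := mvfderiv_comp_proj ((contMDiffAt_metricCoord h.metric hx).mdifferentiableAt (by simp))
  have e1 : (fun q => A.g q.proj (s q) (s' q)) =ᶠ[𝓝 p] fun q =>
      metricCoord A.g p.proj q.proj (tcoord A.I p.proj q.proj (s q))
        (tcoord A.I p.proj q.proj (s' q)) := by
    filter_upwards [eventually_proj_mem_self p] with q hq
    rw [metricCoord_tcoord hq]
  refine ⟨((hG.1.clm_apply hs).clm_apply hs').congr_of_eventuallyEq e1, ?_⟩
  have h2 := mvfderiv_clm_apply₂ hG.1 hs hs' w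
  rw [mvfderiv_congr e1, h2, hG.2, nablaG_apply, ← metricCoord_tcoord hx, ← metricCoord_tcoord hx,
    tcoord_pullbackNabla_self h hs, tcoord_pullbackNabla_self h hs']
  simp only [map_add, add_apply]
  ring

lemma pullbackNabla_eventuallyEq (hs : SmoothAlong s p)
    (V : Π q : TangentBundle A.I A.M, TangentSpace A.I.tangent q) :
    (fun q => tcoord A.I p.proj q.proj (A.pullbackNabla s q (V q))) =ᶠ[𝓝 p] fun q =>
      mvfderiv A.I.tangent (fun q => tcoord A.I p.proj q.proj (s q)) q (V q)
        + christPull h p q (tcoord A.I p.proj q.proj (s q))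
          (tcoord A.I p.proj q.proj (A.dproj q (V q))) := by
  filter_upwards [eventually_proj_mem_self p, eventually_mdiffAt hs] with q hq hq'
    using tcoord_pullbackNabla h.cov hq hq' _

include h in
lemma smoothAlong_pullbackNabla (hs : SmoothAlong s p)
    {V : Π q : TangentBundle A.I A.M, TangentSpace A.I.tangent q} (hV : CMDiffAt ∞ (T% V) p) :
    SmoothAlong (fun q => A.pullbackNabla s q (V q)) p :=
  ((contMDiffAt_mvfderiv_apply hs hV).add (((contMDiffAt_christPull h p).clm_apply hs).clm_apply
    (smoothAlong_dproj hV))).congr_of_eventuallyEq (pullbackNabla_eventuallyEq h hs V)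

/-- The coordinates of the projection of a Lie bracket on `TM`. -/
lemma tcoord_dproj_mlieBracket {U V : Π q : TangentBundle A.I A.M, TangentSpace A.I.tangent q}
    (hU : CMDiffAt ∞ (T% U) p) (hV : CMDiffAt ∞ (T% V) p) :
    tcoord A.I p.proj p.proj (A.dproj p (VectorField.mlieBracket A.I.tangent U V p))
      = mvfderiv A.I.tangent (fun q => tcoord A.I p.proj q.proj (A.dproj q (V q))) p (U p)
        - mvfderiv A.I.tangent (fun q => tcoord A.I p.proj q.proj (A.dproj q (U q))) p (V p) := by
  have hp := mem_chart_source (ModelProd A.H A.E) p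
  have h1 := tcoord_mlieBracket hU hV
  rw [A.tcoord_tangent' (mem_chart_source _ _)] at h1
  have hd : ∀ {W : Π q : TangentBundle A.I A.M, TangentSpace A.I.tangent q}, CMDiffAt ∞ (T% W) p →
      ∀ w, mvfderiv A.I.tangent (fun q => tcoord A.I p.proj q.proj (A.dproj q (W q))) p w
        = ContinuousLinearMap.fst ℝ A.E A.E
          (mvfderiv A.I.tangent (fun q => tcoord A.I.tangent p q (W q)) p w) := fun {W} hW w => by
    rw [mvfderiv_congr (tcoord_fst_eventuallyEq p W), mvfderiv_clm_comp _
      ((mdiffAt_iff_tcoord hp).1 (hW.mdifferentiableAt (by simp)))]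
  rw [hd hV, hd hU, ← map_sub, ← h1]
  rfl

include h in
/-- The pullback of a flat connection is flat. -/
lemma pullbackNabla_flat (hs : SmoothAlong s p)
    {U V : Π q : TangentBundle A.I A.M, TangentSpace A.I.tangent q}
    (hU : CMDiffAt ∞ (T% U) p) (hV : CMDiffAt ∞ (T% V) p) :
    A.pullbackNabla s p (VectorField.mlieBracket A.I.tangent U V p)
      - A.pullbackNabla (fun q => A.pullbackNabla s q (V q)) p (U p)
      + A.pullbackNabla (fun q => A.pullbackNabla s q (U q)) p (V p) = 0 := by
  have hx := mem_chart_source A.H p.proj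
  have hd := hs.mdiffAlong
  have hΓ := mvfderiv_comp_proj ((contMDiffAt_christ h.cov h.smooth hx).mdifferentiableAt (by simp))
  have key : ∀ {W : Π q : TangentBundle A.I A.M, TangentSpace A.I.tangent q}, CMDiffAt ∞ (T% W) p →
      ∀ w, tcoord A.I p.proj p.proj (A.pullbackNabla (fun q => A.pullbackNabla s q (W q)) p w)
      = mvfderiv A.I.tangent (fun q => mvfderiv A.I.tangent
          (fun q => tcoord A.I p.proj q.proj (s q)) q (W q)) p w
        + (mvfderiv A.I (christ h.cov p.proj) p.proj (A.dproj p w) (tcoord A.I p.proj p.proj (s p))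
            (tcoord A.I p.proj p.proj (A.dproj p (W p)))
          + christ h.cov p.proj p.proj
            (mvfderiv A.I.tangent (fun q => tcoord A.I p.proj q.proj (s q)) p w)
            (tcoord A.I p.proj p.proj (A.dproj p (W p)))
          + christ h.cov p.proj p.proj (tcoord A.I p.proj p.proj (s p))
            (mvfderiv A.I.tangent (fun q => tcoord A.I p.proj q.proj (A.dproj q (W q))) p w))
        + christ h.cov p.proj p.proj
          (mvfderiv A.I.tangent (fun q => tcoord A.I p.proj q.proj (s q)) p (W p)
            + christ h.cov p.proj p.proj (tcoord A.I p.proj p.proj (s p))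
              (tcoord A.I p.proj p.proj (A.dproj p (W p))))
          (tcoord A.I p.proj p.proj (A.dproj p w)) := fun {W} hW w => by
    have hWd := (smoothAlong_dproj hW).mdiffAlong
    have e1 := pullbackNabla_eventuallyEq h hs W
    have hD := (smoothAlong_pullbackNabla h hs hW).mdiffAlong
    have m1 := (contMDiffAt_mvfderiv_apply hs hW).mdifferentiableAt (by simp)
    have m2 : MDifferentiableAt A.I.tangent 𝓘(ℝ, A.E) (fun q => christPull h p q
        (tcoord A.I p.proj q.proj (s q)) (tcoord A.I p.proj q.proj (A.dproj q (W q)))) p :=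
      (hΓ.1.clm_apply hd).clm_apply hWd
    have m3 := mvfderiv_clm_apply₂ hΓ.1 hd hWd w
    rw [tcoord_pullbackNabla_self h hD, mvfderiv_congr e1, mvfderiv_fun_add m1 m2, add_apply]
    have e2 := e1.eq_of_nhds
    rw [e2]
    rw [hΓ.2] at m3
    exact congrArg₂ (· + ·) (congrArg₂ (· + ·) rfl m3) rfl
  refine tcoord_injective hx ?_
  have hbr := mvfderiv_mlieBracket_vec hs hU hV
  have hfl := christ_flat h p.proj (tcoord A.I p.proj p.proj (s p)) (A.dproj p (U p)) (A.dproj p (V p))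
  rw [map_add, map_sub, key hV, key hU, tcoord_pullbackNabla_self h hd, hbr,
    tcoord_dproj_mlieBracket hU hV, map_zero]
  simp only [map_add, map_sub, add_apply]
  rw [← sub_eq_zero] at hfl
  rw [← neg_eq_zero, ← hfl]
  abel

end Sections

end PullbackConnection
end ConnMetricManifold

section ExtendCoord

variable {E : Type*} [NormedAddCommGroup E] [NormedSpace ℝ E]
  {H : Type*} [TopologicalSpace H] {I : ModelWithCorners ℝ E H}
  {M : Type*} [TopologicalSpace M] [ChartedSpace H M] [IsManifold I ∞ M]

lemma tcoord_extend_eventuallyEq {x : M} (v : TangentSpace I x) :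
    (fun y => tcoord I x y (FiberBundle.extend E v y)) =ᶠ[𝓝 x] fun _ => tcoord I x x v := by
  filter_upwards [eventually_mem_chart (H := H) x] with y hy
  rw [extend_eq_cfield hy, tcoord_self]
  exact tcoord_tlift hy _

end ExtendCoord

namespace ConnMetricManifold

section TangentAffine

variable {A : ConnMetricManifold.{u, v}} (h : IsAffRiem A.nabla A.g)

/-! ### The tangent bundle of an affine-Riemann manifold -/

include h in
lemma isCovariantDerivativeOn_tangentNabla :
    IsCovariantDerivativeOn (A.E × A.E) A.tangentNabla univ where
  add {V V' p} hV hV' _ := by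
    ext1 w
    refine tangent_ext ?_ ?_
    · rw [add_apply, map_add, dproj_tangentNabla, dproj_tangentNabla, dproj_tangentNabla,
        ← pullbackNabla_add h (mdiffAlong_dproj hV) (mdiffAlong_dproj hV')]
      simp only [Pi.add_apply, map_add]
    · rw [add_apply, map_add, connMap_tangentNabla, connMap_tangentNabla, connMap_tangentNabla,
        ← pullbackNabla_add h (mdiffAlong_connMap h hV) (mdiffAlong_connMap h hV')]
      simp only [Pi.add_apply, map_add]
  leibniz {V f p} hV hf _ := by
    ext1 w
    refine tangent_ext ?_ ?_
    · rw [add_apply, smul_apply, map_add, map_smul, dproj_tangentNabla, dproj_tangentNabla,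
        ContinuousLinearMap.smulRight_apply, map_smul,
        ← pullbackNabla_smul h hf (mdiffAlong_dproj hV)]
      simp only [Pi.smul_apply', map_smul]
    · rw [add_apply, smul_apply, map_add, map_smul, connMap_tangentNabla, connMap_tangentNabla,
        ContinuousLinearMap.smulRight_apply, map_smul,
        ← pullbackNabla_smul h hf (mdiffAlong_connMap h hV)]
      simp only [Pi.smul_apply', map_smul]

include h in
lemma cmdiffAt_tangentNabla {p : TangentBundle A.I A.M}
    {U V : Π q : TangentBundle A.I A.M, TangentSpace A.I.tangent q}
    (hU : CMDiffAt ∞ (T% U) p) (hV : CMDiffAt ∞ (T% V) p) :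
    CMDiffAt ∞ (T% (fun q => A.tangentNabla V q (U q))) p := by
  refine cmdiffAt_of_smoothAlong h ?_ ?_
  · simp only [dproj_tangentNabla]
    exact smoothAlong_pullbackNabla h (smoothAlong_dproj hV) hU
  · simp only [connMap_tangentNabla]
    exact smoothAlong_pullbackNabla h (smoothAlong_connMap h hV) hU

include h in
lemma contMDiff_tangentNabla {s : Set (TangentBundle A.I A.M)} (hs : IsOpen s) :
    ContMDiffCovariantDerivativeOn (A.E × A.E) ∞ A.tangentNabla s where
  contMDiff {V} hV p hp := by
    have hV' : CMDiffAt ∞ (T% V) p := (hV p hp).contMDiffAt (hs.mem_nhds hp)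
    exact (contMDiffAt_end_of_cfield (L := A.tangentNabla V) fun e => cmdiffAt_tangentNabla h
      (cmdiffAt_cfield (n := ⊤) (mem_chart_source _ p) e) hV').contMDiffWithinAt

include h in
lemma contMDiffAt_metric_along {p : TangentBundle A.I A.M}
    {s s' : Π q : TangentBundle A.I A.M, TangentSpace A.I q.proj}
    (hs : SmoothAlong s p) (hs' : SmoothAlong s' p) :
    ContMDiffAt A.I.tangent 𝓘(ℝ, ℝ) ∞ (fun q => A.g q.proj (s q) (s' q)) p := by
  have hG := contMDiffAt_comp_proj (contMDiffAt_metricCoord h.metric (mem_chart_source A.H p.proj))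
  refine ((hG.clm_apply hs).clm_apply hs').congr_of_eventuallyEq ?_
  filter_upwards [eventually_proj_mem_self p] with q hq
  rw [metricCoord_tcoord hq]

include h in
lemma metric_self_nonneg {x : A.M} (a : TangentSpace A.I x) : 0 ≤ A.g x a a := by
  rcases eq_or_ne a 0 with rfl | ha
  · simp
  · exact (h.metric.pos ha).le

include h in
lemma isRiemannianMetric_tangentMetric : IsRiemannianMetric A.tangentMetric := by
  refine ⟨⟨A.tangentMetric, fun p w w' => ?_, fun p w hw => ?_, fun p => ?_, fun p => ?_⟩, rfl⟩
  · rw [tangentMetric_apply, tangentMetric_apply, h.metric.symm, h.metric.symm (A.connMap p w)]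
  · rw [tangentMetric_apply]
    have h1 := metric_self_nonneg h (A.dproj p w)
    have h2 := metric_self_nonneg h (A.connMap p w)
    by_cases h3 : A.dproj p w = 0
    · have h4 : A.connMap p w ≠ 0 := fun h4 => hw (tangent_ext (by rw [h3, map_zero])
        (by rw [h4, map_zero]))
      have := h.metric.pos h4
      linarith
    · have := h.metric.pos h3
      linarith
  · obtain ⟨G, hG⟩ := h.metric
    have hb := G.isVonNBounded p.proj
    rw [hG] at hb
    refine ((hb.image (A.hlift p)).add (hb.image (A.vlift p))).subset fun w hw => ?_
    have hw' : A.tangentMetric p w w < 1 := hw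
    rw [tangentMetric_apply] at hw'
    have h1 := metric_self_nonneg h (A.dproj p w)
    have h2 := metric_self_nonneg h (A.connMap p w)
    have h3 : A.g p.proj (A.dproj p w) (A.dproj p w) < 1 := by linarith
    have h4 : A.g p.proj (A.connMap p w) (A.connMap p w) < 1 := by linarith
    exact ⟨_, ⟨A.dproj p w, h3, rfl⟩, _, ⟨A.connMap p w, h4, rfl⟩, hlift_add_vlift p w⟩
  · refine contMDiffAt_bilin_of_cfield fun e e' => ?_
    have he := cmdiffAt_cfield (I := A.I.tangent) (n := ⊤) (mem_chart_source _ p) e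
    have he' := cmdiffAt_cfield (I := A.I.tangent) (n := ⊤) (mem_chart_source _ p) e'
    exact (contMDiffAt_metric_along h (smoothAlong_dproj he) (smoothAlong_dproj he')).add
      (contMDiffAt_metric_along h (smoothAlong_connMap h he) (smoothAlong_connMap h he'))

include h in
/-- `∇^1` is flat, since it is the sum of two copies of the pullback of `∇`. -/
lemma isFlat_tangentNabla : IsFlat (fun V p w => A.tangentNabla V p w) := fun p u v w => by
  have hu := cmdiffAt_extend (I := A.I.tangent) (n := ⊤) u
  have hv := cmdiffAt_extend (I := A.I.tangent) (n := ⊤) v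
  have hw := cmdiffAt_extend (I := A.I.tangent) (n := ⊤) w
  simp only [curvature]
  refine tangent_ext ?_ ?_
  · have := pullbackNabla_flat h (smoothAlong_dproj hw) hu hv
    simp only [FiberBundle.extend_apply_self] at this
    rw [map_add, map_sub, dproj_tangentNabla, dproj_tangentNabla, dproj_tangentNabla, map_zero, ← this]
    simp only [dproj_tangentNabla]
  · have := pullbackNabla_flat h (smoothAlong_connMap h hw) hu hv
    simp only [FiberBundle.extend_apply_self] at this
    rw [map_add, map_sub, connMap_tangentNabla, connMap_tangentNabla, connMap_tangentNabla, map_zero,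
      ← this]
    simp only [connMap_tangentNabla]

lemma tcoord_dproj_extend_eventuallyEq {p : TangentBundle A.I A.M} (w : TangentSpace A.I.tangent p) :
    (fun q => tcoord A.I p.proj q.proj (A.dproj q (FiberBundle.extend (A.E × A.E) w q))) =ᶠ[𝓝 p]
      fun _ => tcoord A.I p.proj p.proj (A.dproj p w) := by
  filter_upwards [tcoord_extend_eventuallyEq w, eventually_proj_mem_self p] with q h1 hq
  rw [A.tcoord_tangent' hq, A.tcoord_tangent' (mem_chart_source _ _)] at h1
  exact congrArg Prod.fst h1

lemma mvfderiv_fibre_extend_eventuallyEq {p : TangentBundle A.I A.M} (w : TangentSpace A.I.tangent p) :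
    (fun q => mvfderiv A.I.tangent (A.fibre p.proj) q (FiberBundle.extend (A.E × A.E) w q)) =ᶠ[𝓝 p]
      fun _ => mvfderiv A.I.tangent (A.fibre p.proj) p w := by
  filter_upwards [tcoord_extend_eventuallyEq w, eventually_proj_mem_self p] with q h1 hq
  rw [A.tcoord_tangent' hq, A.tcoord_tangent' (mem_chart_source _ _)] at h1
  exact congrArg Prod.snd h1

/-- The horizontal component of `∇^1_u V`, for `V` with constant coordinates. -/
lemma tcoord_dproj_tangentNabla_extend {p : TangentBundle A.I A.M} (u w : TangentSpace A.I.tangent p) :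
    tcoord A.I p.proj p.proj (A.dproj p (A.tangentNabla (FiberBundle.extend (A.E × A.E) w) p u))
      = christ h.cov p.proj p.proj (tcoord A.I p.proj p.proj (A.dproj p w))
          (tcoord A.I p.proj p.proj (A.dproj p u)) := by
  rw [dproj_tangentNabla, tcoord_pullbackNabla_self h (mdiffAlong_dproj (mdiffAt_extend w)),
    mvfderiv_congr (tcoord_dproj_extend_eventuallyEq w), mvfderiv_const_apply, zero_add,
    FiberBundle.extend_apply_self]

/-- The vertical component of `∇^1_u V`, for `V` with constant coordinates. -/
lemma tcoord_connMap_tangentNabla_extend {p : TangentBundle A.I A.M} (u w : TangentSpace A.I.tangent p) :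
    tcoord A.I p.proj p.proj (A.connMap p (A.tangentNabla (FiberBundle.extend (A.E × A.E) w) p u))
      = mvfderiv A.I (christ h.cov p.proj) p.proj (A.dproj p u) (A.fibre p.proj p)
          (tcoord A.I p.proj p.proj (A.dproj p w))
        + christ h.cov p.proj p.proj (christ h.cov p.proj p.proj (A.fibre p.proj p)
          (tcoord A.I p.proj p.proj (A.dproj p w))) (tcoord A.I p.proj p.proj (A.dproj p u))
        + (christ h.cov p.proj p.proj (mvfderiv A.I.tangent (A.fibre p.proj) p u)
            (tcoord A.I p.proj p.proj (A.dproj p w))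
          + christ h.cov p.proj p.proj (mvfderiv A.I.tangent (A.fibre p.proj) p w)
            (tcoord A.I p.proj p.proj (A.dproj p u))) := by
  have hx := mem_chart_source A.H p.proj
  have hΓ := mvfderiv_comp_proj ((contMDiffAt_christ h.cov h.smooth hx).mdifferentiableAt (by simp))
  have hμ := (contMDiffAt_fibre_self p).mdifferentiableAt (by simp)
  have e1 : (fun q => tcoord A.I p.proj q.proj (A.connMap q (FiberBundle.extend (A.E × A.E) w q)))
      =ᶠ[𝓝 p] fun q => mvfderiv A.I.tangent (A.fibre p.proj) p w + christPull h p q (A.fibre p.proj q)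
        (tcoord A.I p.proj p.proj (A.dproj p w)) := by
    filter_upwards [connMap_eventuallyEq h p (FiberBundle.extend (A.E × A.E) w),
      tcoord_dproj_extend_eventuallyEq w, mvfderiv_fibre_extend_eventuallyEq w] with q h1 h2 h3
    rw [h1, h2, h3]
  have e2 : tcoord A.I p.proj p.proj (A.connMap p w) = mvfderiv A.I.tangent (A.fibre p.proj) p w
      + christ h.cov p.proj p.proj (A.fibre p.proj p) (tcoord A.I p.proj p.proj (A.dproj p w)) :=
    tcoord_connMap h.cov hx w
  have m : MDifferentiableAt A.I.tangent 𝓘(ℝ, A.E) (fun q => christPull h p q (A.fibre p.proj q)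
        (tcoord A.I p.proj p.proj (A.dproj p w))) p :=
    ((mdiffAt_christPull h p).clm_apply hμ).clm_apply mdifferentiableAt_const
  have m3 := mvfderiv_clm_apply₂ (mdiffAt_christPull h p) hμ
    (mdifferentiableAt_const (c := tcoord A.I p.proj p.proj (A.dproj p w))) u
  have m4 : mvfderiv A.I.tangent (christPull h p) p u
      = mvfderiv A.I (christ h.cov p.proj) p.proj (A.dproj p u) := hΓ.2 u
  have m5 : christPull h p p = christ h.cov p.proj p.proj := rfl
  rw [mvfderiv_const_apply, map_zero, add_zero, m4, m5] at m3
  rw [connMap_tangentNabla, tcoord_pullbackNabla_self h (mdiffAlong_connMap h (mdiffAt_extend w)),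
    mvfderiv_congr e1, mvfderiv_fun_add mdifferentiableAt_const m, add_apply, mvfderiv_const_apply, m3,
    FiberBundle.extend_apply_self, e2, map_add, add_apply]
  abel

include h in
/-- `∇^1` is torsion-free. On fields with constant coordinates, the horizontal component of the torsion
vanishes because the Christoffel symbols are symmetric, and the vertical component because `∇` is
moreover flat. -/
lemma isTorsionFree_tangentNabla : IsTorsionFree A.tangentNabla := fun p X Y hX hY => by
  have hcov := isCovariantDerivativeOn_tangentNabla h
  rw [← sub_eq_zero, ← hcov.torsion_apply hX hY, hcov.torsion_apply_eq_extend, mlieBracket_extend,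
    sub_zero, sub_eq_zero]
  refine tangent_ext ?_ ?_
  · refine tcoord_injective (mem_chart_source A.H p.proj) ?_
    rw [tcoord_dproj_tangentNabla_extend h, tcoord_dproj_tangentNabla_extend h,
      christ_symm h.cov h.torsionFree]
  · refine tcoord_injective (mem_chart_source A.H p.proj) ?_
    rw [tcoord_connMap_tangentNabla_extend h, tcoord_connMap_tangentNabla_extend h, christ_flat h,
      add_comm (christ h.cov p.proj p.proj (mvfderiv A.I.tangent (A.fibre p.proj) p _) _)]

/-- The tangent bundle of an affine-Riemann manifold is an affine-Riemann manifold. -/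
lemma isAffRiem_tangent (h : IsAffRiem A.nabla A.g) : IsAffRiem A.tangentNabla A.tangentMetric where
  cov := isCovariantDerivativeOn_tangentNabla h
  smooth _ hs := contMDiff_tangentNabla h hs
  torsionFree := isTorsionFree_tangentNabla h
  flat := isFlat_tangentNabla h
  metric := isRiemannianMetric_tangentMetric h

include h in
/-- The complex structure of `TM` is orthogonal and parallel. -/
lemma isParallelHermitian_tangentJ :
    IsParallelHermitian A.tangentNabla A.tangentMetric A.tangentJ where
  smooth p := contMDiffAt_end_of_cfield fun e => by
    have he := cmdiffAt_cfield (I := A.I.tangent) (n := ⊤) (mem_chart_source _ p) e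
    refine cmdiffAt_of_smoothAlong h ?_ ?_
    · simp only [dproj_tangentJ]
      have := (smoothAlong_connMap h he).neg
      unfold SmoothAlong
      simp only [map_neg]
      exact this
    · simp only [connMap_tangentJ]
      exact smoothAlong_dproj he
  sq p u := tangent_ext (by rw [dproj_tangentJ, connMap_tangentJ, map_neg])
    (by rw [connMap_tangentJ, dproj_tangentJ, map_neg])
  compatible p u v := by
    simp only [tangentMetric_apply, dproj_tangentJ, connMap_tangentJ, map_neg, neg_apply, neg_neg]
    ring
  parallel p Y hY u := by
    refine tangent_ext ?_ ?_
    · rw [dproj_tangentNabla, dproj_tangentJ, connMap_tangentNabla,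
        ← pullbackNabla_neg h (mdiffAlong_connMap h hY)]
      simp only [dproj_tangentJ]
    · rw [connMap_tangentNabla, connMap_tangentJ, dproj_tangentNabla]
      simp only [connMap_tangentJ]

end TangentAffine
section TangentTensors

variable {A : ConnMetricManifold.{u, v}} (h : IsAffRiem A.nabla A.g)

/-! ### The covariant derivative of the metric and its traces on the tangent bundle -/

/-- `∇^1 g_1` is the sum of the pullbacks of `∇g` to the horizontal and vertical components. -/
lemma nablaG_tangent (p : TangentBundle A.I A.M) (u v w : TangentSpace A.I.tangent p) :
    nablaG (isAffRiem_tangent h).cov A.tangentMetric p u v w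
      = nablaG h.cov A.g p.proj (A.dproj p u) (A.dproj p v) (A.dproj p w)
        + nablaG h.cov A.g p.proj (A.dproj p u) (A.connMap p v) (A.connMap p w) := by
  have h1 := isAffRiem_tangent h
  have hv := mdiffAt_extend (I := A.I.tangent) v
  have hw := mdiffAt_extend (I := A.I.tangent) w
  have e := mvfderiv_metric h1.cov h1.metric hv hw u
  obtain ⟨d1, e1⟩ := mvfderiv_metric_along h (mdiffAlong_dproj hv) (mdiffAlong_dproj hw) u
  obtain ⟨d2, e2⟩ := mvfderiv_metric_along h (mdiffAlong_connMap h hv) (mdiffAlong_connMap h hw) u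
  simp only [tangentMetric_apply] at e
  rw [mvfderiv_fun_add d1 d2, add_apply, e1, e2] at e
  simp only [dproj_tangentNabla, connMap_tangentNabla, FiberBundle.extend_apply_self] at e
  linarith

/-- The horizontal and vertical lifts of an orthonormal basis form an orthonormal basis. -/
lemma isParseval_lifts {p : TangentBundle A.I A.M} {ι : Type*} [Fintype ι]
    {f : ι → TangentSpace A.I p.proj} (hf : IsParseval A.g p.proj f) :
    IsParseval A.tangentMetric p
      (Sum.elim (fun i => A.hlift p (f i)) (fun i => A.vlift p (f i))) := fun w => by
  rw [Fintype.sum_sum_type]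
  simp only [Sum.elim_inl, Sum.elim_inr, tangentMetric_apply, dproj_hlift, dproj_vlift, connMap_hlift,
    connMap_vlift, map_zero, add_zero, zero_add]
  simp only [← map_smul, ← map_sum]
  rw [hf, hf, hlift_add_vlift]

/-- The vertical part of a frame does not contribute to `∑ i, (∇_{E_i} g)(E_i, ·)`, since `∇^1 g_1`
vanishes in vertical directions. -/
lemma aForm_tangent (p : TangentBundle A.I A.M) (w : TangentSpace A.I.tangent p) :
    aForm (isAffRiem_tangent h) p w = aForm h p.proj (A.dproj p w) := by
  have hf := isParseval_frame h.metric p.proj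
  rw [hf.aForm h, (isParseval_lifts hf).aForm (isAffRiem_tangent h), Fintype.sum_sum_type]
  simp only [Sum.elim_inl, Sum.elim_inr, nablaG_tangent h, dproj_hlift, dproj_vlift, connMap_hlift,
    connMap_vlift, map_zero, LinearMap.zero_apply, add_zero, Finset.sum_const_zero]

/-- Both the horizontal and the vertical part of a frame contribute the trace of `∇g`, whence the
factor 2. -/
lemma sForm_tangent (p : TangentBundle A.I A.M) (w : TangentSpace A.I.tangent p) :
    sForm (isAffRiem_tangent h) p w = 2 * sForm h p.proj (A.dproj p w) := by
  have hf := isParseval_frame h.metric p.proj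
  have h1 := hf.two_sForm h (A.dproj p w)
  have h2 := (isParseval_lifts hf).two_sForm (isAffRiem_tangent h) w
  rw [Fintype.sum_sum_type] at h2
  simp only [Sum.elim_inl, Sum.elim_inr, nablaG_tangent h, dproj_hlift, dproj_vlift, connMap_hlift,
    connMap_vlift, map_zero, add_zero, zero_add, ← h1] at h2
  linarith

/-- The exterior derivative commutes with the pullback by `π`. -/
lemma extDerivOne_comp_dproj (η : Π x : A.M, TangentSpace A.I x →ₗ[ℝ] ℝ)
    (hη : ∀ (x : A.M) (X : Π y : A.M, TangentSpace A.I y), MDifferentiableAt A.I A.I.tangent (T% X) x →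
      MDifferentiableAt A.I 𝓘(ℝ, ℝ) (fun y => η y (X y)) x)
    (p : TangentBundle A.I A.M) (u w : TangentSpace A.I.tangent p) :
    extDerivOne (I := A.I.tangent) (fun q a => η q.proj (A.dproj q a)) p u w
      = extDerivOne (fun y a => η y a) p.proj (A.dproj p u) (A.dproj p w) := by
  obtain ⟨N, hN, hNη, hd⟩ := extDerivOne_eq η (hη p.proj)
  obtain ⟨hN1, hN2⟩ := mvfderiv_comp_proj hN
  have key : ∀ a b : TangentSpace A.I.tangent p,
      mvfderiv A.I.tangent (fun q => η q.proj (A.dproj q (FiberBundle.extend (A.E × A.E) b q))) p a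
        = mvfderiv A.I N p.proj (A.dproj p a) (tcoord A.I p.proj p.proj (A.dproj p b)) := fun a b => by
    have e : (fun q => η q.proj (A.dproj q (FiberBundle.extend (A.E × A.E) b q))) =ᶠ[𝓝 p]
        fun q => N q.proj (tcoord A.I p.proj p.proj (A.dproj p b)) := by
      filter_upwards [eventually_proj_mem_self p, tcoord_dproj_extend_eventuallyEq b] with q hq hq'
      rw [hNη _ hq, hq']
    rw [mvfderiv_congr e, mvfderiv_clm_apply hN1 mdifferentiableAt_const, mvfderiv_const_apply, map_zero,
      add_zero, hN2]
  simp only [extDerivOne]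
  rw [key, key, mlieBracket_extend, map_zero, map_zero, sub_zero]
  exact (hd _ _).symm

end TangentTensors
end ConnMetricManifold

section ParallelMetric

variable {E : Type*} [NormedAddCommGroup E] [NormedSpace ℝ E] [FiniteDimensional ℝ E]
  {H : Type*} [TopologicalSpace H] {I : ModelWithCorners ℝ E H}
  {M : Type*} [TopologicalSpace M] [ChartedSpace H M] [IsManifold I ∞ M]
  {nabla : (Π x : M, TangentSpace I x) → Π x : M, TangentSpace I x →L[ℝ] TangentSpace I x}
  {g : Π x : M, TangentSpace I x →L[ℝ] TangentSpace I x →L[ℝ] ℝ}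
  {J : Π x : M, TangentSpace I x →L[ℝ] TangentSpace I x}

/-! ### Affine-Riemann manifolds with parallel metric -/

lemma extDerivOne_zero (x : M) (u v : TangentSpace I x) :
    extDerivOne (fun (y : M) (_ : TangentSpace I y) => (0 : ℝ)) x u v = 0 := by
  simp only [extDerivOne, mvfderiv_const_apply, sub_zero]

variable (h : IsAffRiem nabla g)

lemma gam_eq_zero_iff : (∀ x u v, gam h x u v = 0) ↔ ∀ x, nablaG h.cov g x = 0 := by
  refine ⟨fun h0 x => ?_, fun h0 x u v => h.metric.ext fun w => ?_⟩
  · ext u v w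
    rw [← metric_gam_add h, h0, h0]
    simp
  · rw [metric_gam, h0]
    simp

include h in
lemma isLeviCivita_of_nablaG (h0 : ∀ x, nablaG h.cov g x = 0) : IsLeviCivita g nabla where
  isCovariantDerivative := h.cov
  torsionFree := h.torsionFree
  metric x Y Z hY hZ w := by
    rw [mvfderiv_metric h.cov h.metric hY hZ, h0]
    simp

include h in
/-- If `∇` is metric, then the Levi-Civita connection is flat, since it agrees with `∇` on
differentiable vector fields. -/
lemma isFlat_leviCivita_of_nablaG (h0 : ∀ x, nablaG h.cov g x = 0) :
    IsFlat (fun Y x w => leviCivita g Y x w) := fun x u v w => by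
  have hlc := isLeviCivita_leviCivita h
  have hg0 := (gam_eq_zero_iff h).2 h0
  have hap : ∀ {y : M} {Y : Π z : M, TangentSpace I z}, MDiffAt (T% Y) y → ∀ a,
      leviCivita g Y y a = nabla Y y a := fun hY a => by
    rw [leviCivita_apply h hY, hg0, add_zero]
  have key : ∀ a b : TangentSpace I x, leviCivita g (fun y => leviCivita g (FiberBundle.extend E w) y
      (FiberBundle.extend E b y)) x a
      = nabla (fun y => nabla (FiberBundle.extend E w) y (FiberBundle.extend E b y)) x a := fun a b => by
    have hd := (cmdiffAt_nabla_extend h w (cmdiffAt_extend b)).mdifferentiableAt (by simp)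
    have e : (fun y => nabla (FiberBundle.extend E w) y (FiberBundle.extend E b y)) =ᶠ[𝓝 x]
        fun y => leviCivita g (FiberBundle.extend E w) y (FiberBundle.extend E b y) := by
      filter_upwards [eventually_mdiffAt_extend w] with y hy using (hap hy _).symm
    rw [← nabla_congr hlc.isCovariantDerivative hd e, hap hd]
  have hfl := h.flat x u v w
  simp only [curvature] at hfl ⊢
  rw [key, key, hap (mdiffAt_extend w)]
  exact hfl

lemma IsParallelHermitian.isKahler_of_nablaG (hJ : IsParallelHermitian nabla g J)
    (h : IsAffRiem nabla g) (h0 : ∀ x, nablaG h.cov g x = 0) : IsKahler g J :=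
  ⟨hJ.isHermitian h, fun x u v w => by
    rw [hJ.extDerivTwo_fundamentalForm h, h0]
    simp⟩

end ParallelMetric

namespace ConnMetricManifold

section TangentHermitian

variable {A : ConnMetricManifold.{u, v}} (h : IsAffRiem A.nabla A.g)

/-! ### Special Hermitian structures on the tangent bundle -/

lemma forall_dproj_iff {P : Π x : A.M, TangentSpace A.I x → Prop} :
    (∀ (p : TangentBundle A.I A.M) (w : TangentSpace A.I.tangent p), P p.proj (A.dproj p w)) ↔
      ∀ x v, P x v := by
  refine ⟨fun hP x v => ?_, fun hP p w => hP _ _⟩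
  have := hP ⟨x, 0⟩ (A.hlift ⟨x, 0⟩ v)
  rwa [dproj_hlift] at this

lemma nablaG_tangent_eq_zero_iff :
    (∀ p, nablaG (isAffRiem_tangent h).cov A.tangentMetric p = 0) ↔ ∀ x, nablaG h.cov A.g x = 0 := by
  refine ⟨fun h0 x => ?_, fun h0 p => ?_⟩
  · ext u v w
    let p : TangentBundle A.I A.M := ⟨x, 0⟩
    have := nablaG_tangent h p (A.hlift p u) (A.hlift p v) (A.hlift p w)
    rw [h0] at this
    simp only [dproj_hlift, connMap_hlift, map_zero, add_zero] at this
    exact this.symm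
  · ext u v w
    rw [nablaG_tangent h, h0]
    simp

/-- If `TM` is Kähler, then `∇g` is invariant under cyclic permutations; this is `dω = 0` on two
horizontal vectors and a vertical one. -/
lemma nablaG_cyclic_of_isKahler (hK : IsKahler A.tangentMetric A.tangentJ) (x : A.M)
    (u v w : TangentSpace A.I x) : nablaG h.cov A.g x u v w = nablaG h.cov A.g x v w u := by
  let p : TangentBundle A.I A.M := ⟨x, 0⟩
  have := hK.2 p (A.hlift p u) (A.hlift p v) (A.vlift p w)
  rw [(isParallelHermitian_tangentJ h).extDerivTwo_fundamentalForm (isAffRiem_tangent h)] at this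
  simp only [nablaG_tangent h, dproj_tangentJ, connMap_tangentJ, dproj_hlift, dproj_vlift, connMap_hlift,
    connMap_vlift, map_zero, map_neg, LinearMap.zero_apply, LinearMap.neg_apply, add_zero,
    zero_add, neg_zero] at this
  exact sub_eq_zero.1 ((sub_eq_add_neg _ _).trans this)

lemma leeForm_tangent (p : TangentBundle A.I A.M) (w : TangentSpace A.I.tangent p) :
    leeForm A.tangentMetric A.tangentJ p w
      = -(aForm h p.proj (A.dproj p w) - 2 * sForm h p.proj (A.dproj p w)) := by
  rw [(isParallelHermitian_tangentJ h).leeForm_eq (isAffRiem_tangent h), aForm_tangent, sForm_tangent]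

lemma isBalanced_tangent_iff : IsBalanced A.tangentMetric A.tangentJ ↔
    ∀ x v, aForm h x v = 2 * sForm h x v := by
  have h1 := (isParallelHermitian_tangentJ h).isHermitian (isAffRiem_tangent h)
  rw [IsBalanced, and_iff_right h1, ← forall_dproj_iff]
  simp only [leeForm_tangent h, neg_eq_zero, sub_eq_zero]

lemma extDerivOne_aForm_tangent (p : TangentBundle A.I A.M) (u w : TangentSpace A.I.tangent p) :
    extDerivOne (fun q a => aForm (isAffRiem_tangent h) q a) p u w
      = extDerivOne (fun x a => aForm h x a) p.proj (A.dproj p u) (A.dproj p w) := by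
  rw [← extDerivOne_comp_dproj (aForm h) fun _ _ hX => mdiffAt_aForm h hX]
  simp only [aForm_tangent h]

lemma extDerivOne_leeForm_tangent (p : TangentBundle A.I A.M) (u w : TangentSpace A.I.tangent p) :
    extDerivOne (leeForm A.tangentMetric A.tangentJ) p u w
      = - extDerivOne (fun x a => aForm h x a) p.proj (A.dproj p u) (A.dproj p w) := by
  have h1 := isAffRiem_tangent h
  have e : leeForm A.tangentMetric A.tangentJ
      = fun p w => (-1) * aForm h1 p w - (-1) * sForm h1 p w := by
    funext p w
    rw [(isParallelHermitian_tangentJ h).leeForm_eq h1]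
    ring
  have ha : ∀ X : Π y : TangentBundle A.I A.M, TangentSpace A.I.tangent y, MDiffAt (T% X) p →
      MDifferentiableAt A.I.tangent 𝓘(ℝ, ℝ) (fun y => aForm h1 y (X y)) p := fun X hX => mdiffAt_aForm h1 hX
  have hs : ∀ X : Π y : TangentBundle A.I A.M, TangentSpace A.I.tangent y, MDiffAt (T% X) p →
      MDifferentiableAt A.I.tangent 𝓘(ℝ, ℝ) (fun y => sForm h1 y (X y)) p := fun X hX => mdiffAt_sForm h1 hX
  rw [e, extDerivOne_sub (η := fun p w => (-1) * aForm h1 p w) (η' := fun p w => (-1) * sForm h1 p w)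
    (fun X hX => mdifferentiableAt_const.mul (ha X hX))
    (fun X hX => mdifferentiableAt_const.mul (hs X hX)), extDerivOne_const_mul _ ha,
    extDerivOne_const_mul _ hs, extDerivOne_sForm, extDerivOne_aForm_tangent h]
  ring

lemma isLocallyConformallyBalanced_tangent_iff :
    IsLocallyConformallyBalanced A.tangentMetric A.tangentJ ↔
      ∀ x u v, extDerivOne (fun y a => aForm h y a) x u v = 0 := by
  have h1 := (isParallelHermitian_tangentJ h).isHermitian (isAffRiem_tangent h)
  rw [IsLocallyConformallyBalanced, and_iff_right h1]
  simp only [extDerivOne_leeForm_tangent h, neg_eq_zero]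
  refine ⟨fun h0 x u v => ?_, fun h0 p u v => h0 _ _ _⟩
  have := h0 ⟨x, 0⟩ (A.hlift ⟨x, 0⟩ u) (A.hlift ⟨x, 0⟩ v)
  rwa [dproj_hlift, dproj_hlift] at this

/-- The Ricci form of the Bismut connection of `TM` is half of the exterior derivative of
`(2a - s) ∘ J`, and `2a - s` on `TM` is the pullback of `2a - 2s` on `M`. -/
lemma isCalabiYauWithTorsion_tangent (h0 : ∀ x v, aForm h x v = sForm h x v) :
    IsCalabiYauWithTorsion A.tangentMetric A.tangentJ := by
  have h1 := isAffRiem_tangent h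
  have hJ := isParallelHermitian_tangentJ h
  refine ⟨hJ.isHermitian h1, fun p u v => ?_⟩
  rw [hJ.ricciForm_eq h1 (fun y Y hY u => hJ.bismut_apply h1 hY u)
    (fun x X Y hX hY => hJ.mdiffAt_bismutTensor h1 hX hY) (hJ.J_bismutTensor h1)]
  simp only [hJ.trace_J_bismutTensor h1, aForm_tangent h, sForm_tangent h, h0, sub_self,
    extDerivOne_zero, mul_zero]

lemma ricciForm_chern_tangent (h0 : ∀ x v, sForm h x v = 0) (p : TangentBundle A.I A.M)
    (u v : TangentSpace A.I.tangent p) :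
    ricciForm A.tangentMetric A.tangentJ (chern A.tangentMetric A.tangentJ) p u v = 0 := by
  have h1 := isAffRiem_tangent h
  have hJ := isParallelHermitian_tangentJ h
  rw [hJ.ricciForm_eq h1 (fun y Y hY u => hJ.chern_apply h1 hY u)
    (fun x X Y hX hY => hJ.mdiffAt_chernTensor h1 hX hY) (hJ.J_chernTensor h1)]
  simp only [hJ.trace_J_chernTensor h1, sForm_tangent h, h0, mul_zero, extDerivOne_zero]

end TangentHermitian

section Tower

variable {A : ConnMetricManifold.{u, v}}

/-! ### The tower of tangent bundles -/

lemma isAffineRiemann_iff : A.IsAffineRiemann ↔ IsAffRiem A.nabla A.g :=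
  ⟨fun h => ⟨h.1, h.2, h.3, h.4, h.5⟩, fun h => ⟨h.1, h.2, h.3, h.4, h.5⟩⟩

variable (hA : IsAffRiem A.nabla A.g)

lemma gamma_eq (x : A.M) (u v : TangentSpace A.I x) : A.gamma x u v = gam hA x u v :=
  leviCivita_sub_nabla hA x u v

lemma metric_trGamma (x : A.M) (v : TangentSpace A.I x) :
    A.g x (A.trGamma x) v = aForm hA x v - sForm hA x v := by
  rw [← (isParseval_frame hA.metric x).sum_metric_gam hA]
  simp only [trGamma, map_sum, sum_apply, gamma_eq hA]

lemma metric_trGammaStar (x : A.M) (v : TangentSpace A.I x) :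
    A.g x (A.trGammaStar x) v = sForm hA x v := by
  have hs : ∀ u w z, A.g x (A.gammaStar x u w) z = A.g x w (gam hA x u z) := fun u w z => by
    have : A.gammaStar x u w
        = sharp A.g x (((A.g x w).toLinearMap.comp (gam hA x u) : TangentSpace A.I x →ₗ[ℝ] ℝ)) := by
      simp only [gammaStar, gamma_eq hA]
      rfl
    rw [this, sharp_spec hA.metric]
    rfl
  rw [sForm_apply, (isParseval_frame hA.metric x).trace]
  simp only [trGammaStar, map_sum, sum_apply, hs]
  refine Finset.sum_congr rfl fun i _ => ?_
  rw [hA.metric.symm, gam_symm]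

lemma trGamma_eq_smul_iff (c : ℝ) : (∀ x, A.trGamma x = c • A.trGammaStar x) ↔
    ∀ x v, aForm hA x v = (c + 1) * sForm hA x v := by
  refine ⟨fun h0 x v => ?_, fun h0 x => hA.metric.ext fun v => ?_⟩
  · have h1 := metric_trGamma hA x v
    rw [h0, map_smul, smul_apply, metric_trGammaStar hA, smul_eq_mul] at h1
    linarith
  · rw [metric_trGamma hA, map_smul, smul_apply, metric_trGammaStar hA, h0, smul_eq_mul]
    ring

lemma extDerivOne_xi (x : A.M) (u v : TangentSpace A.I x) :
    extDerivOne A.xi x u v = extDerivOne (fun y a => aForm hA y a) x u v := by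
  have e : A.xi = fun y a => aForm hA y a - sForm hA y a := by
    funext y a
    exact metric_trGamma hA y a
  rw [e, extDerivOne_sub (fun X hX => mdiffAt_aForm hA hX) (fun X hX => mdiffAt_sForm hA hX),
    extDerivOne_sForm, sub_zero]

lemma isAffRiem_tower (hA : IsAffRiem A.nabla A.g) :
    ∀ k, IsAffRiem (A.tower k).nabla (A.tower k).g
  | 0 => hA
  | k + 1 => isAffRiem_tangent (isAffRiem_tower hA k)

include hA in
lemma isHermitian_tower (k : ℕ) : IsHermitian (A.tower (k + 1)).g (A.towerJ (k + 1)) :=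
  (isParallelHermitian_tangentJ (isAffRiem_tower hA k)).isHermitian (isAffRiem_tower hA (k + 1))

lemma nablaG_tower_eq_zero_iff (k : ℕ) :
    (∀ x, nablaG (isAffRiem_tower hA k).cov (A.tower k).g x = 0) ↔ ∀ x, nablaG hA.cov A.g x = 0 := by
  induction k with
  | zero => exact Iff.rfl
  | succ k ih => exact (nablaG_tangent_eq_zero_iff (isAffRiem_tower hA k)).trans ih

/-- If `T^{k+2}M` is Kähler, then `∇^k g_k = 0`. Indeed `∇^{k+1} g_{k+1}` is cyclic, it vanishes on
`(v^v, w^v, u^h)`, and on `(u^h, v^v, w^v)` it is `∇^k g_k` on `(u, v, w)`. -/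
lemma nablaG_tower_eq_zero_of_isKahler (k : ℕ)
    (hK : IsKahler (A.tower (k + 2)).g (A.towerJ (k + 2))) (x : (A.tower k).M) :
    nablaG (isAffRiem_tower hA k).cov (A.tower k).g x = 0 := by
  ext u v w
  have hk := isAffRiem_tower hA k
  let p : TangentBundle (A.tower k).I (A.tower k).M := ⟨x, 0⟩
  have h1 := nablaG_cyclic_of_isKahler (A := (A.tower k).tangent) (isAffRiem_tangent hk) hK p
    ((A.tower k).hlift p u) ((A.tower k).vlift p v) ((A.tower k).vlift p w)
  have h2 := (nablaG_tangent hk p _ _ _).symm.trans (h1.trans (nablaG_tangent hk p _ _ _))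
  simp only [dproj_hlift, dproj_vlift, connMap_hlift, connMap_vlift, map_zero, LinearMap.zero_apply,
    add_zero, zero_add] at h2
  exact h2

/-- A linear relation between the two trace forms on `T^kM`, in terms of the trace forms on `M`. -/
lemma forms_tower_iff (k : ℕ) (c d : ℝ) :
    (∀ x v, c * aForm (isAffRiem_tower hA k) x v = d * sForm (isAffRiem_tower hA k) x v) ↔
      ∀ x v, c * aForm hA x v = 2 ^ k * d * sForm hA x v := by
  induction k generalizing d with
  | zero => simp only [pow_zero, one_mul]; exact Iff.rfl
  | succ k ih =>
    have hk := isAffRiem_tower hA k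
    have h1 : (∀ (p : TangentBundle (A.tower k).I (A.tower k).M) w, c * aForm (isAffRiem_tangent hk) p w
        = d * sForm (isAffRiem_tangent hk) p w) ↔ ∀ x v, c * aForm hk x v = d * 2 * sForm hk x v := by
      simp only [aForm_tangent hk, sForm_tangent hk, ← mul_assoc]
      exact forall_dproj_iff (P := fun x v => c * aForm hk x v = d * 2 * sForm hk x v)
    refine h1.trans ((ih (d * 2)).trans ?_)
    rw [pow_succ, show (2 : ℝ) ^ k * (d * 2) = 2 ^ k * 2 * d by ring]

lemma isBalanced_tower_iff (k : ℕ) : IsBalanced (A.tower (k + 1)).g (A.towerJ (k + 1)) ↔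
    ∀ x v, aForm hA x v = 2 ^ (k + 1) * sForm hA x v := by
  have h1 := forms_tower_iff hA k 1 2
  simp only [one_mul] at h1
  exact (isBalanced_tangent_iff (isAffRiem_tower hA k)).trans (by rw [h1, pow_succ])

lemma extDerivOne_aForm_tower_iff (k : ℕ) :
    (∀ x u v, extDerivOne (fun y a => aForm (isAffRiem_tower hA k) y a) x u v = 0) ↔
      ∀ x u v, extDerivOne (fun y a => aForm hA y a) x u v = 0 := by
  induction k with
  | zero => exact Iff.rfl
  | succ k ih =>
    have hk := isAffRiem_tower hA k
    refine Iff.trans ⟨fun h0 x u v => ?_, fun h0 p u v => ?_⟩ ih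
    · let p : TangentBundle (A.tower k).I (A.tower k).M := ⟨x, 0⟩
      have := (extDerivOne_aForm_tangent hk p _ _).symm.trans
        (h0 p ((A.tower k).hlift p u) ((A.tower k).hlift p v))
      rwa [dproj_hlift, dproj_hlift] at this
    · exact (extDerivOne_aForm_tangent hk p u v).trans (h0 _ _ _)

include hA in
lemma isLocallyConformallyBalanced_tower_iff (k : ℕ) :
    IsLocallyConformallyBalanced (A.tower (k + 1)).g (A.towerJ (k + 1)) ↔
      ∀ x u v, extDerivOne A.xi x u v = 0 := by
  simp only [extDerivOne_xi hA]
  exact (isLocallyConformallyBalanced_tangent_iff (isAffRiem_tower hA k)).trans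
    (extDerivOne_aForm_tower_iff hA k)

lemma isCalabiYauWithTorsion_tower (k : ℕ) (h0 : ∀ x v, aForm hA x v = 2 ^ k * sForm hA x v) :
    IsCalabiYauWithTorsion (A.tower (k + 1)).g (A.towerJ (k + 1)) := by
  have h1 := (forms_tower_iff hA k 1 1).2 (by simpa only [one_mul, mul_one] using h0)
  simp only [one_mul] at h1
  exact isCalabiYauWithTorsion_tangent (isAffRiem_tower hA k) h1

lemma ricciForm_chern_tower (k : ℕ) (h0 : ∀ x v, sForm hA x v = 0) (x : (A.tower (k + 1)).M)
    (u v : TangentSpace (A.tower (k + 1)).I x) :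
    ricciForm (A.tower (k + 1)).g (A.towerJ (k + 1))
      (chern (A.tower (k + 1)).g (A.towerJ (k + 1))) x u v = 0 := by
  have h1 := (forms_tower_iff hA k 0 1).2 (fun x v => by rw [h0, zero_mul, mul_zero])
  simp only [one_mul, zero_mul] at h1
  exact ricciForm_chern_tangent (isAffRiem_tower hA k) (fun x v => (h1 x v).symm) x u v

end Tower
end ConnMetricManifold

end AffRiem

end

open AffRiem ConnMetricManifold

theorem mainTheorem1 (A : AffRiem.ConnMetricManifold.{u, v}) (hA : A.IsAffineRiemann) :
    (∀ k, (A.tower k).IsAffineRiemann) ∧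
    (∀ k, 1 ≤ k → AffRiem.IsHermitian (A.tower k).g (A.towerJ k)) ∧
    ((∀ x u v, A.gamma x u v = 0) → ∀ k, 1 ≤ k →
      AffRiem.IsLeviCivita (A.tower k).g (A.tower k).nabla ∧
      AffRiem.IsKahler (A.tower k).g (A.towerJ k) ∧
      AffRiem.IsFlat (fun Y x w => AffRiem.leviCivita (A.tower k).g Y x w)) ∧
    (∀ k, 2 ≤ k →
      (AffRiem.IsKahler (A.tower k).g (A.towerJ k) ↔ ∀ x u v, A.gamma x u v = 0)) ∧
    (∀ k, 1 ≤ k →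
      (AffRiem.IsLocallyConformallyBalanced (A.tower k).g (A.towerJ k) ↔
        AffRiem.IsLocallyConformallyBalanced (A.tower 1).g (A.towerJ 1)) ∧
      (AffRiem.IsLocallyConformallyBalanced (A.tower 1).g (A.towerJ 1) ↔
        ∀ x u v, AffRiem.extDerivOne A.xi x u v = 0)) ∧
    (∀ k₀, 1 ≤ k₀ →
      (AffRiem.IsBalanced (A.tower k₀).g (A.towerJ k₀) ↔
        ∀ x, A.trGamma x = ((2 : ℝ) ^ k₀ - 1) • A.trGammaStar x) ∧
      (AffRiem.IsBalanced (A.tower k₀).g (A.towerJ k₀) →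
        AffRiem.IsCalabiYauWithTorsion (A.tower (k₀ + 1)).g (A.towerJ (k₀ + 1)) ∧
        ∀ k, 1 ≤ k → k ≠ k₀ →
          AffRiem.IsLocallyConformallyBalanced (A.tower k).g (A.towerJ k))) ∧
    ((∀ x, A.trGamma x = 0) → (∀ x, A.trGammaStar x = 0) → ∀ k, 1 ≤ k →
      AffRiem.IsBalanced (A.tower k).g (A.towerJ k) ∧
      AffRiem.IsCalabiYauWithTorsion (A.tower k).g (A.towerJ k) ∧
      ∀ x u v, AffRiem.ricciForm (A.tower k).g (A.towerJ k)
        (AffRiem.chern (A.tower k).g (A.towerJ k)) x u v = 0) := by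
  have h := isAffineRiemann_iff.1 hA
  have hγ : (∀ x u v, A.gamma x u v = 0) ↔ ∀ x, nablaG h.cov A.g x = 0 := by
    simp only [gamma_eq h]
    exact gam_eq_zero_iff h
  have flatCase : (∀ x u v, A.gamma x u v = 0) → ∀ k, 1 ≤ k →
      IsLeviCivita (A.tower k).g (A.tower k).nabla ∧ IsKahler (A.tower k).g (A.towerJ k) ∧
      IsFlat (fun Y x w => leviCivita (A.tower k).g Y x w) := by
    rintro h0 (_ | k) hk
    · omega
    have hk1 := isAffRiem_tower h (k + 1)
    have h1 := (nablaG_tower_eq_zero_iff h (k + 1)).2 (hγ.1 h0)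
    exact ⟨isLeviCivita_of_nablaG hk1 h1, (isParallelHermitian_tangentJ
      (isAffRiem_tower h k)).isKahler_of_nablaG hk1 h1, isFlat_leviCivita_of_nablaG hk1 h1⟩
  refine ⟨fun k => isAffineRiemann_iff.2 (isAffRiem_tower h k), ?_, flatCase, ?_, ?_, ?_, ?_⟩
  · rintro (_ | k) hk
    · omega
    exact isHermitian_tower h k
  · rintro (_ | _ | k) hk
    · omega
    · omega
    exact ⟨fun hK => hγ.2 ((nablaG_tower_eq_zero_iff h k).1 (nablaG_tower_eq_zero_of_isKahler h k hK)),
      fun h0 => (flatCase h0 (k + 2) (by omega)).2.1⟩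
  · rintro (_ | k) hk
    · omega
    exact ⟨(isLocallyConformallyBalanced_tower_iff h k).trans
      (isLocallyConformallyBalanced_tower_iff h 0).symm, isLocallyConformallyBalanced_tower_iff h 0⟩
  · rintro (_ | k₀) hk₀
    · omega
    refine ⟨?_, fun hb => ?_⟩
    · rw [isBalanced_tower_iff h, trGamma_eq_smul_iff h, sub_add_cancel]
    have h0 := (isBalanced_tower_iff h k₀).1 hb
    refine ⟨isCalabiYauWithTorsion_tower h (k₀ + 1) h0, ?_⟩
    rintro (_ | k) hk -
    · omega
    rw [isLocallyConformallyBalanced_tower_iff h]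
    intro x u v
    -- `ξ = a - s` is a multiple of the closed form `s`
    have e : (fun y a => aForm h y a : Π x : A.M, TangentSpace A.I x → ℝ)
        = fun y a => 2 ^ (k₀ + 1) * sForm h y a := by
      funext y a
      exact h0 y a
    rw [extDerivOne_xi h, e, extDerivOne_const_mul _ fun X hX => mdiffAt_sForm h hX,
      extDerivOne_sForm, mul_zero]
  · rintro h1 h2 (_ | k) hk
    · omega
    have hs : ∀ x v, sForm h x v = 0 := fun x v => by
      rw [← metric_trGammaStar h, h2, map_zero, zero_apply]
    have ha : ∀ x v, aForm h x v = 0 := fun x v => by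
      have := metric_trGamma h x v
      rw [h1, map_zero, zero_apply, hs, sub_zero] at this
      exact this.symm
    exact ⟨(isBalanced_tower_iff h k).2 fun x v => by rw [ha, hs, mul_zero],
      isCalabiYauWithTorsion_tower h k fun x v => by rw [ha, hs, mul_zero],
      ricciForm_chern_tower h k hs⟩
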